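/- Let $\Psi(x,y)$ be the number of positive integers $n\le x$ all of whose prime factors are at most $y$. Let $\rho$ be the Dickman function: the continuous function on $[0,\infty)$ with $\rho(t)=1$ on $[0,1]$ and $t\rho'(t)=-\rho(t-1)$ for $t>1$. Write $u=\log x/\log y$. For $u\ge 1$ let $\xi(u)\ge 0$ be given by $\xi(1)=0$ and, for $u>1$, by the unique $\xi(u)>0$ with $e^{\xi(u)}=1+u\,\xi(u)$. For $x\ge y>2$ put $\sigma(x,y)=1-\xi(u)/\log y$. For $x>1$, $y\ge 2$ let $\alpha(x,y)>0$ be the point at which $s\mapsto x^{s}\prod_{p\le y}(1-p^{-s})^{-1}$ attains its minimum on $(0,\infty)$. For real functions $h,g$ with $g>0$, $h=\Omega_+(g)$ (resp. $h=\Omega_-(g)$) means that there is $c>0$ such that $h(y)\ge c\,g(y)$ (resp. $h(y)\le -c\,g(y)$) for arbitrarily large $y$; $\exp(\Omega_\pm(g))$ stands for $\exp(h(y))$ with some $h=\Omega_\pm(g)$. The constants implied by $\ll$ and $\gg$ are absolute and positive. Let $\Theta\in[1/2,1]$ be the supremum of the real parts of the zeros of the Riemann zeta function, and let $\varepsilon>0$.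 1. Assume that the Riemann Hypothesis fails and fix $\sigma_0\in(1-\Theta,\Theta)$. For each $y>2$ there is a unique $x=x(y)\ge y$ with $\sigma(x,y)=\sigma_0$, and for all $y>2$ \[ \Psi(x(y),y)\ll x\rho(u)\exp\left(\Omega_{-}\left(y^{\Theta-\sigma_0-\varepsilon}\right)\right). \] 2. Fix $\alpha_0\in(0,\Theta)$. For each $y>2$ there is a unique $x=x(y)>1$ with $\alpha(x,y)=\alpha_0$. Regardless of the truth of the Riemann Hypothesis, there is $c_{\alpha_0}>0$, depending only on $\alpha_0$, such that for all $y>2$ \[ \Psi(x(y),y)\gg x\rho(u)\exp\left(c_{\alpha_0}\,y^{\max\{1-2\alpha_0,\,\frac12-\alpha_0\}}/\log y\right)\exp\left(\Omega_{+}\left(y^{\Theta-\alpha_0-\varepsilon}\right)\right). \] -/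

import Mathlib

open Filter Topology

noncomputable section

/-- `Ψ(x, y)`: the number of positive integers `n ≤ x` all of whose prime factors are `≤ y`
(for a prime `p`, `p < ⌊y⌋₊ + 1` is the same as `p ≤ y`). -/
def friableCount (x y : ℝ) : ℕ := (Nat.smoothNumbersUpTo ⌊x⌋₊ (⌊y⌋₊ + 1)).card

/-- Successive integrations of the delay equation `t ρ'(t) = -ρ(t - 1)` from `ρ = 1` on `[0, 1]`;
the `n`-th iterate is the Dickman function on `[0, n + 1]`. -/
def dickmanIter : ℕ → ℝ → ℝ
  | 0, _ => 1
  | n + 1, t => 1 - ∫ s in (1 : ℝ)..max 1 t, dickmanIter n (s - 1) / s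

/-- The Dickman function `ρ` (characterised by the next three theorems). -/
def dickman (t : ℝ) : ℝ := dickmanIter ⌈t⌉₊ t

theorem continuous_dickmanIter (n : ℕ) : Continuous (dickmanIter n) := by
  induction n with
  | zero => exact continuous_const
  | succ n ih =>
    have hg : Continuous (fun s : ℝ => dickmanIter n (s - 1) / max 1 s) := by
      refine (ih.comp (continuous_id.sub continuous_const)).div (by fun_prop) ?_
      intro s
      have : (1 : ℝ) ≤ max 1 s := le_max_left _ _
      positivity
    have hF : Continuous (fun t : ℝ =>
        1 - ∫ s in (1 : ℝ)..max 1 t, dickmanIter n (s - 1) / max 1 s) :=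
      continuous_const.sub ((intervalIntegral.continuous_primitive
        (fun a b => hg.intervalIntegrable a b) 1).comp (by fun_prop))
    convert hF using 1
    funext t
    simp only [dickmanIter]
    congr 1
    refine intervalIntegral.integral_congr ?_
    intro s hs
    rw [Set.uIcc_of_le (le_max_left _ _)] at hs
    simp only [max_eq_right hs.1]

theorem dickmanIter_succ_eq (n : ℕ) (t : ℝ) (ht : t ≤ n + 1) :
    dickmanIter (n + 1) t = dickmanIter n t := by
  induction n generalizing t with
  | zero =>
    have h : max 1 t = 1 := max_eq_left (by simpa using ht)
    simp [dickmanIter, h]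
  | succ n ih =>
    rw [dickmanIter, dickmanIter]
    congr 1
    refine intervalIntegral.integral_congr ?_
    intro s hs
    rw [Set.uIcc_of_le (le_max_left _ _)] at hs
    have h2 : s ≤ (n : ℝ) + 2 := by
      refine hs.2.trans (max_le ?_ ?_)
      · have : (0 : ℝ) ≤ n := Nat.cast_nonneg n
        linarith
      · push_cast at ht
        linarith
    simp only [ih (s - 1) (by linarith)]

theorem dickman_eq_dickmanIter (n : ℕ) (t : ℝ) (ht : t ≤ n) : dickman t = dickmanIter n t := by
  have hn : ⌈t⌉₊ ≤ n := Nat.ceil_le.mpr ht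
  induction n, hn using Nat.le_induction with
  | base => rfl
  | succ m hm ih =>
    have h1 : t ≤ m := Nat.ceil_le.mp hm
    rw [dickmanIter_succ_eq m t (by linarith), ih h1]

theorem dickman_of_le_one {t : ℝ} (ht : t ≤ 1) : dickman t = 1 := by
  rw [dickman_eq_dickmanIter 1 t (by simpa using ht)]
  simp [dickmanIter, max_eq_left ht]

theorem continuous_dickman : Continuous dickman := by
  rw [continuous_iff_continuousAt]
  intro t
  obtain ⟨n, hn⟩ := exists_nat_gt t
  refine (continuous_dickmanIter n).continuousAt.congr ?_
  filter_upwards [Iio_mem_nhds hn] with s hs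
  exact (dickman_eq_dickmanIter n s (le_of_lt hs)).symm

theorem hasDerivAt_dickman {t : ℝ} (ht : 1 < t) :
    HasDerivAt dickman (-dickman (t - 1) / t) t := by
  obtain ⟨n, hn⟩ := exists_nat_gt t
  have hcont : ContinuousOn (fun s : ℝ => dickmanIter n (s - 1) / s) (Set.Ioi 0) := by
    refine ContinuousOn.div ?_ continuousOn_id (fun s hs => (ne_of_gt hs))
    exact ((continuous_dickmanIter n).comp (continuous_id.sub continuous_const)).continuousOn
  have hsub : Set.uIcc 1 t ⊆ Set.Ioi 0 := by
    rw [Set.uIcc_of_le ht.le]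
    intro s hs
    exact lt_of_lt_of_le one_pos hs.1
  have h0 : (0 : ℝ) < t := by linarith
  have hd := (intervalIntegral.integral_hasDerivAt_right
    ((hcont.mono hsub).intervalIntegrable)
    (hcont.stronglyMeasurableAtFilter isOpen_Ioi t h0)
    (hcont.continuousAt (Ioi_mem_nhds h0))).const_sub 1
  rw [dickman_eq_dickmanIter n (t - 1) (by linarith), neg_div]
  refine hd.congr_of_eventuallyEq ?_
  filter_upwards [Iio_mem_nhds hn, Ioi_mem_nhds ht] with s hs hs1
  have hs' : s < n := hs
  have hs1' : 1 < s := hs1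
  rw [dickman_eq_dickmanIter (n + 1) s (by push_cast; linarith), dickmanIter,
    max_eq_right hs1'.le]

/-- `ξ(u)` for `u ≥ 1`: the largest solution `t ≥ 0` of `e ^ t = 1 + u t`, that is, `ξ(1) = 0` and,
for `u > 1`, the unique solution `t > 0`. -/
def xi (u : ℝ) : ℝ := sSup {t : ℝ | 0 ≤ t ∧ Real.exp t = 1 + u * t}

/-- `σ(x, y) = 1 - ξ(u) / log y` with `u = log x / log y`. -/
def sigma (x y : ℝ) : ℝ := 1 - xi (Real.log x / Real.log y) / Real.log y

/-- The partial zeta function `ζ(s, y) = ∏_{p ≤ y} (1 - p ^ (-s))⁻¹` at real `s`. -/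
def partialZeta (s y : ℝ) : ℝ :=
  ∏ p ∈ Nat.primesBelow (⌊y⌋₊ + 1), (1 - (p : ℝ) ^ (-s))⁻¹

/-- `α(x, y) = a`: the function `s ↦ ζ(s, y) x ^ s` on `s > 0` attains its minimum at `a`. -/
def IsSaddlePoint (x y a : ℝ) : Prop :=
  0 < a ∧ IsMinOn (fun s : ℝ => partialZeta s y * x ^ s) (Set.Ioi 0) a

/-- The supremum `Θ` of the real parts of the zeros of the Riemann zeta function. -/
def zetaTheta : ℝ := sSup {r : ℝ | ∃ s : ℂ, riemannZeta s = 0 ∧ s.re = r}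

/-- `h(y) = Ω₊(g(y))` as `y → ∞`. -/
def IsOmegaPlus (h g : ℝ → ℝ) : Prop := ∃ c > 0, ∃ᶠ y in atTop, c * g y ≤ h y

/-- `h(y) = Ω₋(g(y))` as `y → ∞`. -/
def IsOmegaMinus (h g : ℝ → ℝ) : Prop := ∃ c > 0, ∃ᶠ y in atTop, h y ≤ -(c * g y)

end

/-!
The Laplace transform of `ρ` gives `log (x ρ(u)) ≤ s log x + E((1 - s) log y) + O(log y)` for every
`s ≤ 1`, where `E(t) = ∫₀ᵗ (eᵛ - 1) / v dv`, with equality up to `O(y ^ β)` for every `β > 0` when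
`s = σ(x, y)`. Rankin's bound `Ψ(x, y) ≤ x ^ s ζ(s, y)` is nearly an equality at the saddle point
`s = α(x, y)`: there the Dirichlet series of `ζ(s, y)` concentrates around `x`, by a Chernoff bound.
Hence `log (Ψ(x, y) / (x ρ(u)))` is controlled by `log ζ(s, y) - E((1 - s) log y)`. The prime
powers up to `y` contribute to this difference an error that oscillates by Landau's theorem: a
one-sided bound of order `y ^ β` with `β < Θ - s` would continue `log ζ` analytically to a
half-plane containing a zero of `ζ`. The powers above `y` of primes up to `y` contribute the
positive term of order `y ^ (1 - 2s) / log y`.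
-/

section Landau

open MeasureTheory ProbabilityTheory Set

variable {Ω : Type*} {m : MeasurableSpace Ω} {X : Ω → ℝ} {μ : Measure Ω}

lemma mem_integrableExpSet_of_le (hXm : AEMeasurable X μ) (hX : 0 ≤ᵐ[μ] X) {s t : ℝ}
    (ht : t ∈ integrableExpSet X μ) (hst : s ≤ t) : s ∈ integrableExpSet X μ := by
  refine Integrable.mono' (g := fun ω => Real.exp (t * X ω)) ht (by fun_prop) ?_
  filter_upwards [hX] with ω hω
  rw [Real.norm_eq_abs, Real.abs_exp]
  exact Real.exp_le_exp.mpr (mul_le_mul_of_nonneg_right hst hω)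

lemma hasSum_pow_mul_exp_div_factorial (c h x : ℝ) :
    HasSum (fun n : ℕ => x ^ n * Real.exp (c * x) / n.factorial * h ^ n)
      (Real.exp ((c + h) * x)) := by
  have hexp := (NormedSpace.expSeries_div_hasSum_exp (𝔸 := ℝ) (h * x)).mul_left (Real.exp (c * x))
  rw [← Real.exp_eq_exp_ℝ, ← Real.exp_add, ← add_mul] at hexp
  exact hexp.congr_fun fun n => by rw [mul_pow]; ring

-- The terms of the Taylor series are nonnegative, so summation and integration commute.
lemma add_mem_integrableExpSet_of_summable (hX : 0 ≤ᵐ[μ] X) {c h : ℝ}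
    (hc : c ∈ interior (integrableExpSet X μ)) (hh : 0 ≤ h)
    (hs : Summable fun n : ℕ => (∫ ω, X ω ^ n * Real.exp (c * X ω) ∂μ) / n.factorial * h ^ n) :
    c + h ∈ integrableExpSet X μ := by
  have hXm : AEMeasurable X μ := aemeasurable_of_mem_interior_integrableExpSet hc
  have hmoment (n : ℕ) : 0 ≤ ∫ ω, X ω ^ n * Real.exp (c * X ω) ∂μ :=
    integral_nonneg_of_ae <| hX.mono fun ω hω => mul_nonneg (pow_nonneg hω n) (Real.exp_pos _).le
  have hterm (n : ℕ) :
      ∫⁻ ω, ENNReal.ofReal (X ω ^ n * Real.exp (c * X ω) / n.factorial * h ^ n) ∂μ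
        = ENNReal.ofReal ((∫ ω, X ω ^ n * Real.exp (c * X ω) ∂μ) / n.factorial * h ^ n) := by
    rw [← ofReal_integral_eq_lintegral_ofReal
      (((integrable_pow_mul_exp_of_mem_interior_integrableExpSet hc n).div_const _).mul_const _),
      integral_mul_const, integral_div]
    filter_upwards [hX] with ω (hω : 0 ≤ X ω)
    positivity
  refine ⟨by fun_prop, ?_⟩
  rw [hasFiniteIntegral_iff_norm]
  calc ∫⁻ ω, ENNReal.ofReal ‖Real.exp ((c + h) * X ω)‖ ∂μ
      = ∫⁻ ω, ∑' n : ℕ,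
          ENNReal.ofReal (X ω ^ n * Real.exp (c * X ω) / n.factorial * h ^ n) ∂μ := by
        refine lintegral_congr_ae ?_
        filter_upwards [hX] with ω (hω : 0 ≤ X ω)
        have hsum := hasSum_pow_mul_exp_div_factorial c h (X ω)
        rw [← ENNReal.ofReal_tsum_of_nonneg (fun n => by positivity) hsum.summable, hsum.tsum_eq,
          Real.norm_eq_abs, Real.abs_exp]
    _ = ∑' n : ℕ, ENNReal.ofReal
          ((∫ ω, X ω ^ n * Real.exp (c * X ω) ∂μ) / n.factorial * h ^ n) := by
        rw [lintegral_tsum fun n => by fun_prop]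
        simp_rw [hterm]
    _ < ⊤ := by
        rw [← ENNReal.ofReal_tsum_of_nonneg
          (fun n => mul_nonneg (div_nonneg (hmoment n) (Nat.cast_nonneg _)) (pow_nonneg hh n)) hs]
        exact ENNReal.ofReal_lt_top

-- The Taylor series at `c - δ`, for small `δ`, converges at `c + δ`.
lemma exists_gt_mem_integrableExpSet (hX : 0 ≤ᵐ[μ] X) {F : ℝ → ℝ} {c : ℝ}
    (hF : AnalyticAt ℝ F c) (hsub : Iio c ⊆ interior (integrableExpSet X μ))
    (hEq : EqOn (mgf X μ) F (Iio c)) : ∃ t > c, t ∈ integrableExpSet X μ := by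
  obtain ⟨p, r, hp⟩ := hF
  obtain ⟨ρ, hρ0, hρr⟩ := ENNReal.lt_iff_exists_nnreal_btwn.mp hp.r_pos
  set δ : NNReal := ρ / 4 with hδρ
  have hδ : (0 : ℝ) < δ := NNReal.coe_pos.mpr (div_pos (by exact_mod_cast hρ0) (by norm_num))
  have hnorm : (‖-(δ : ℝ)‖₊ : ENNReal) = δ := by simp
  have h3r : ((2 * δ : NNReal) : ENNReal) + δ < r := by
    refine lt_of_le_of_lt ?_ hρr
    have hle : 2 * δ + δ ≤ ρ := by
      rw [← NNReal.coe_le_coe, hδρ]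
      push_cast
      linarith [ρ.coe_nonneg]
    exact_mod_cast hle
  have hshift := hp.changeOrigin (y := -(δ : ℝ)) (by rw [hnorm]; exact lt_of_le_of_lt (by simp) h3r)
  have hmem : c + -(δ : ℝ) ∈ interior (integrableExpSet X μ) :=
    hsub (by rw [mem_Iio]; linarith [hδ])
  have hseries := (hshift.hasFPowerSeriesAt.congr (g := mgf X μ) (by
    filter_upwards [Iio_mem_nhds (show c + -(δ : ℝ) < c by linarith)] with t ht
    exact (hEq ht).symm)).eq_formalMultilinearSeries (hasFPowerSeriesAt_mgf hmem)
  have hball : ((2 * δ : NNReal) : ℝ) ∈ Metric.eball (0 : ℝ) (r - ‖-(δ : ℝ)‖₊) := by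
    rw [Metric.mem_eball, edist_zero_right, hnorm, Real.enorm_of_nonneg (2 * δ).coe_nonneg,
      ENNReal.ofReal_coe_nnreal]
    exact lt_tsub_iff_right.mpr h3r
  have hsum := (hshift.hasSum hball).summable
  rw [hseries] at hsum
  refine ⟨c + -(δ : ℝ) + (2 * δ : NNReal), by push_cast; linarith,
    add_mem_integrableExpSet_of_summable hX hmem (2 * δ).coe_nonneg (hsum.congr fun n => ?_)⟩
  simp [mul_comm]

-- Landau's theorem on the abscissa of convergence of a Laplace transform.
theorem Iio_subset_integrableExpSet_of_analyticOnNhd (hXm : AEMeasurable X μ) (hX : 0 ≤ᵐ[μ] X)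
    {F : ℝ → ℝ} {b t₁ : ℝ} (ht₁ : t₁ ∈ integrableExpSet X μ) (hF : AnalyticOnNhd ℝ F (Iio b))
    (hEq : EqOn (mgf X μ) F (Iio t₁)) : Iio b ⊆ integrableExpSet X μ := by
  by_contra hcon
  obtain ⟨t₀, ht₀b, ht₀⟩ := not_subset.mp hcon
  have hub (t : ℝ) (ht : t ∈ integrableExpSet X μ) : t ≤ t₀ := by
    by_contra! hlt
    exact ht₀ (mem_integrableExpSet_of_le hXm hX ht hlt.le)
  set c := sSup (integrableExpSet X μ)
  have hcb : c < b := (csSup_le ⟨t₁, ht₁⟩ hub).trans_lt ht₀b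
  have ht₁c : t₁ ≤ c := le_csSup ⟨t₀, hub⟩ ht₁
  have hsub : Iio c ⊆ interior (integrableExpSet X μ) := by
    refine interior_maximal (fun t ht => ?_) isOpen_Iio
    obtain ⟨t', ht', htt'⟩ := exists_lt_of_lt_csSup ⟨t₁, ht₁⟩ ht
    exact mem_integrableExpSet_of_le hXm hX ht' htt'.le
  have hEqc : EqOn (mgf X μ) F (Iio c) :=
    AnalyticOnNhd.eqOn_of_preconnected_of_eventuallyEq (z₀ := t₁ - 1)
      (analyticOnNhd_mgf.mono hsub) (hF.mono (Iio_subset_Iio hcb.le)) isPreconnected_Iio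
      (by rw [mem_Iio]; linarith) (hEq.eventuallyEq_of_mem (Iio_mem_nhds (sub_one_lt t₁)))
  obtain ⟨t, htc, ht⟩ := exists_gt_mem_integrableExpSet hX (hF c hcb) hsub hEqc
  exact htc.not_ge (le_csSup ⟨t₀, hub⟩ ht)

end Landau

section LaplaceTransform

open MeasureTheory ProbabilityTheory Set

/-- The measure on `(0, ∞)` whose density is the positive part of `w`: its moment generating
function at `-s` is the Laplace transform of the positive part of `w` at `s`. -/
noncomputable def laplaceMeasure (w : ℝ → ℝ) : Measure ℝ :=
  (volume.restrict (Ioi 0)).withDensity fun t => ENNReal.ofReal (w t)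

variable {w : ℝ → ℝ} {C K : ℝ}

lemma ae_nonneg_laplaceMeasure (hw : Measurable w) : ∀ᵐ t ∂laplaceMeasure w, 0 ≤ t := by
  rw [laplaceMeasure, ae_withDensity_iff (by fun_prop)]
  filter_upwards [ae_restrict_mem measurableSet_Ioi] with t ht _ using (mem_Ioi.mp ht).le

lemma mem_integrableExpSet_laplaceMeasure (hw : Measurable w) (τ : ℝ) :
    τ ∈ integrableExpSet id (laplaceMeasure w) ↔
      IntegrableOn (fun t => max (w t) 0 * Real.exp (τ * t)) (Ioi 0) := by
  simp only [integrableExpSet, mem_ofPred_eq, laplaceMeasure, id, IntegrableOn]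
  rw [integrable_withDensity_iff (by fun_prop) (ae_of_all _ fun _ => ENNReal.ofReal_lt_top)]
  simp only [ENNReal.toReal_ofReal', mul_comm]

lemma mgf_laplaceMeasure (hw : Measurable w) (τ : ℝ) :
    mgf id (laplaceMeasure w) τ = ∫ t in Ioi 0, max (w t) 0 * Real.exp (τ * t) := by
  simp only [mgf, laplaceMeasure, id]
  rw [integral_withDensity_eq_integral_toReal_smul (by fun_prop)
    (ae_of_all _ fun _ => ENNReal.ofReal_lt_top)]
  simp only [ENNReal.toReal_ofReal', smul_eq_mul]

lemma integrableOn_mul_exp_of_abs_le (hw : Measurable w)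
    (hb : ∀ t > 0, |w t| ≤ C * Real.exp (K * t)) {τ : ℝ} (hτ : K + τ < 0) :
    IntegrableOn (fun t => w t * Real.exp (τ * t)) (Ioi 0) := by
  refine Integrable.mono' (g := fun t => C * Real.exp ((K + τ) * t))
    ((integrableOn_exp_mul_Ioi hτ 0).const_mul C) (by fun_prop) ?_
  filter_upwards [ae_restrict_mem measurableSet_Ioi] with t ht
  rw [Real.norm_eq_abs, abs_mul, Real.abs_exp, add_mul, Real.exp_add, ← mul_assoc]
  exact mul_le_mul_of_nonneg_right (hb t ht) (Real.exp_pos _).le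

lemma abs_max_zero_le_abs (a : ℝ) : |max a 0| ≤ |a| := by
  simpa using abs_max_sub_max_le_abs a 0 0

lemma mem_integrableExpSet_laplaceMeasure_of_abs_le (hw : Measurable w)
    (hb : ∀ t > 0, |w t| ≤ C * Real.exp (K * t)) {τ : ℝ} (hτ : K + τ < 0) :
    τ ∈ integrableExpSet id (laplaceMeasure w) :=
  (mem_integrableExpSet_laplaceMeasure hw τ).mpr <| integrableOn_mul_exp_of_abs_le (by fun_prop)
    (fun t ht => (abs_max_zero_le_abs _).trans (hb t ht)) hτ

lemma integrableExpSet_laplaceMeasure_eq_univ (hw : Measurable w)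
    (hb : ∀ t > 0, |w t| ≤ C * Real.exp (K * t)) (hneg : ∀ᶠ t in atTop, w t ≤ 0) :
    integrableExpSet id (laplaceMeasure w) = univ := by
  obtain ⟨t₀, ht₀⟩ := eventually_atTop.mp hneg
  refine eq_univ_of_forall fun τ => (mem_integrableExpSet_laplaceMeasure hw τ).mpr ?_
  have hdom : IntegrableOn (fun t => C * Real.exp (K * t) * Real.exp (τ * t)) (Ioc 0 t₀) :=
    (Continuous.integrableOn_Icc (by fun_prop)).mono_set Ioc_subset_Icc_self
  refine Integrable.mono' (g := indicator (Ioc 0 t₀)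
    (fun t => C * Real.exp (K * t) * Real.exp (τ * t)))
    ((integrable_indicator_iff measurableSet_Ioc).mpr hdom).integrableOn (by fun_prop) ?_
  filter_upwards [ae_restrict_mem measurableSet_Ioi] with t ht
  by_cases htt : t ≤ t₀
  · rw [indicator_of_mem (show t ∈ Ioc 0 t₀ from ⟨ht, htt⟩), norm_mul, Real.norm_eq_abs,
      Real.norm_eq_abs, Real.abs_exp]
    exact mul_le_mul_of_nonneg_right ((abs_max_zero_le_abs _).trans (hb t ht)) (Real.exp_pos _).le
  · rw [indicator_of_notMem (fun h => htt h.2), max_eq_right (ht₀ t (not_le.mp htt).le), zero_mul,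
      norm_zero]

lemma mgf_laplaceMeasure_sub_mgf_laplaceMeasure_neg (hw : Measurable w)
    (hb : ∀ t > 0, |w t| ≤ C * Real.exp (K * t)) {τ : ℝ} (hτ : K + τ < 0) :
    mgf id (laplaceMeasure w) τ - mgf id (laplaceMeasure (-w)) τ
      = ∫ t in Ioi 0, w t * Real.exp (τ * t) := by
  have hb' : ∀ t > 0, |(-w) t| ≤ C * Real.exp (K * t) := by simpa only [Pi.neg_apply, abs_neg]
  rw [mgf_laplaceMeasure hw, mgf_laplaceMeasure hw.neg, ← integral_sub
    ((mem_integrableExpSet_laplaceMeasure hw τ).mp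
      (mem_integrableExpSet_laplaceMeasure_of_abs_le hw hb hτ))
    ((mem_integrableExpSet_laplaceMeasure hw.neg τ).mp
      (mem_integrableExpSet_laplaceMeasure_of_abs_le hw.neg hb' hτ))]
  simp only [← sub_mul, Pi.neg_apply, max_zero_sub_max_neg_zero_eq_self]

theorem exists_analyticOnNhd_eq_of_eventually_nonneg (hw : Measurable w)
    (hb : ∀ t > 0, |w t| ≤ C * Real.exp (K * t)) (hpos : ∀ᶠ t in atTop, 0 ≤ w t)
    {F : ℝ → ℝ} {β : ℝ} (hF : AnalyticOnNhd ℝ F (Ioi β))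
    (hEq : ∀ s > K, ∫ t in Ioi 0, w t * Real.exp (-s * t) = F s) :
    ∃ G : ℂ → ℂ, AnalyticOnNhd ℂ G {s | β < s.re} ∧ ∀ s : ℝ, K < s → G s = F s := by
  set μ := laplaceMeasure w
  set ν := laplaceMeasure (-w)
  have hν : integrableExpSet id ν = univ := integrableExpSet_laplaceMeasure_eq_univ hw.neg
    (by simpa only [Pi.neg_apply, abs_neg]) (hpos.mono fun t ht => neg_nonpos.mpr ht)
  have hsub (τ : ℝ) (hτ : K + τ < 0) : mgf id μ τ - mgf id ν τ = F (-τ) := by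
    rw [mgf_laplaceMeasure_sub_mgf_laplaceMeasure_neg hw hb hτ, ← hEq (-τ) (by linarith), neg_neg]
  have hμ : Iio (-β) ⊆ integrableExpSet id μ := by
    refine Iio_subset_integrableExpSet_of_analyticOnNhd (t₁ := -K - 1)
      (F := fun τ => F (-τ) + mgf id ν τ) aemeasurable_id (ae_nonneg_laplaceMeasure hw)
      (mem_integrableExpSet_laplaceMeasure_of_abs_le hw hb (by linarith)) (fun τ hτ => ?_)
      (fun τ hτ => ?_)
    · exact (AnalyticAt.fun_comp (hF (-τ) (lt_neg_of_lt_neg (mem_Iio.mp hτ))) (by fun_prop)).add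
        (analyticAt_mgf (by rw [hν, interior_univ]; trivial))
    · exact sub_eq_iff_eq_add.mp (hsub τ (by rw [mem_Iio] at hτ; linarith))
  refine ⟨fun s => complexMGF id μ (-s) - complexMGF id ν (-s), fun s hs => ?_, fun s hs => ?_⟩
  · refine AnalyticAt.sub (AnalyticAt.fun_comp (analyticAt_complexMGF ?_) (by fun_prop))
      (AnalyticAt.fun_comp (analyticAt_complexMGF ?_) (by fun_prop))
    · exact interior_maximal hμ isOpen_Iio (neg_lt_neg (mem_ofPred_eq ▸ hs))
    · rw [hν, interior_univ]
      trivial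
  · simp only [← Complex.ofReal_neg, complexMGF_ofReal, ← Complex.ofReal_sub,
      hsub (-s) (by linarith), neg_neg]

lemma integral_exp_neg_mul_Ioi_zero {s : ℝ} (hs : 0 < s) :
    ∫ t in Ioi 0, Real.exp (-s * t) = 1 / s := by
  rw [integral_exp_mul_Ioi (neg_lt_zero.mpr hs), mul_zero, Real.exp_zero, neg_div_neg_eq]

lemma integral_Ioi_one_mul_rpow_eq_integral_exp (g : ℝ → ℝ) (s : ℝ) :
    ∫ y in Ioi (1 : ℝ), g y * y ^ (-(s + 1))
      = ∫ t in Ioi (0 : ℝ), g (Real.exp t) * Real.exp (-s * t) := by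
  have hsubst := integral_comp_exp_Ioi (fun y => g y * y ^ (-(s + 1))) 0
  rw [Real.exp_zero] at hsubst
  rw [← hsubst]
  refine integral_congr_ae (ae_of_all _ fun t => ?_)
  simp only [smul_eq_mul]
  rw [← Real.exp_mul, mul_left_comm, ← Real.exp_add]
  ring_nf

end LaplaceTransform

section RealZeta

open MeasureTheory ProbabilityTheory Set

lemma LSeries_eq_mul_integral_exp (f : ℕ → ℝ) (hf : ∀ n, 0 ≤ f n) {r s : ℝ} (hr : 0 ≤ r)
    (hs : r < s) (hO : (fun n ↦ ∑ k ∈ Finset.Icc 1 n, f k) =O[atTop] fun n ↦ (n : ℝ) ^ r) :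
    LSeries (fun n ↦ (f n : ℂ)) s = ((s * ∫ t in Ioi (0 : ℝ),
      (∑ k ∈ Finset.Icc 1 ⌊Real.exp t⌋₊, f k) * Real.exp (-s * t) : ℝ) : ℂ) := by
  rw [LSeries_eq_mul_integral_of_nonneg f hr (by simpa using hs) hO hf,
    ← integral_Ioi_one_mul_rpow_eq_integral_exp (fun y => ∑ k ∈ Finset.Icc 1 ⌊y⌋₊, f k),
    Complex.ofReal_mul, ← integral_complex_ofReal]
  congr 1
  refine setIntegral_congr_fun measurableSet_Ioi fun y hy => ?_
  rw [Complex.ofReal_mul, Complex.ofReal_sum, Complex.ofReal_cpow (zero_le_one.trans (le_of_lt hy))]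
  push_cast
  rfl

lemma riemannZeta₁_eq {s : ℂ} (hs : s ≠ 1) : riemannZeta₁ s = (s - 1) * riemannZeta s := by
  rw [riemannZeta_eq_inv_sub_mul hs, ← mul_assoc, mul_inv_cancel₀ (sub_ne_zero.mpr hs), one_mul]

lemma riemannZeta₁_re_ofReal {s : ℝ} (hs : s ≠ 1) :
    (riemannZeta₁ s).re = (s - 1) * (riemannZeta s).re := by
  rw [riemannZeta₁_eq (by exact_mod_cast hs), ← Complex.ofReal_one, ← Complex.ofReal_sub,
    Complex.re_ofReal_mul]

lemma riemannZeta_re_eq_mul_integral_floor {s : ℝ} (hs : 1 < s) :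
    (riemannZeta s).re
      = s * ∫ t in Ioi (0 : ℝ), (⌊Real.exp t⌋₊ : ℝ) * Real.exp (-s * t) := by
  have hseries := LSeries_eq_mul_integral_exp (fun _ => 1) (fun _ => zero_le_one) (r := 1)
    zero_le_one hs (by simpa using Asymptotics.isBigO_refl _ _)
  simp only [Complex.ofReal_one, Finset.sum_const, Nat.card_Icc, add_tsub_cancel_right,
    nsmul_eq_mul, mul_one] at hseries
  rw [← LSeries_one_eq_riemannZeta (by simpa using hs), ← Complex.ofReal_re (s * _), ← hseries]
  rfl

lemma fract_exp_mul_exp (s t : ℝ) : Int.fract (Real.exp t) * Real.exp (-s * t)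
    = Real.exp (-(s - 1) * t) - (⌊Real.exp t⌋₊ : ℝ) * Real.exp (-s * t) := by
  rw [show -(s - 1) * t = t + -s * t by ring, Real.exp_add, ← sub_mul, ← Int.self_sub_floor,
    natCast_floor_eq_intCast_floor (Real.exp_pos t).le]

lemma riemannZeta₁_re_eq_of_one_lt {s : ℝ} (hs : 1 < s) :
    (riemannZeta₁ s).re =
      s * (1 - (s - 1) * ∫ t in Ioi (0 : ℝ), Int.fract (Real.exp t) * Real.exp (-s * t)) := by
  have hfloor : IntegrableOn (fun t : ℝ => (⌊Real.exp t⌋₊ : ℝ) * Real.exp (-s * t)) (Ioi 0) := by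
    refine integrableOn_mul_exp_of_abs_le (by fun_prop) (C := 1) (K := 1) (fun t _ => ?_)
      (by linarith)
    rw [abs_of_nonneg (by positivity), one_mul, one_mul]
    exact Nat.floor_le (Real.exp_pos t).le
  have hs1 : s - 1 ≠ 0 := by linarith
  have hfract : ∫ t in Ioi (0 : ℝ), Int.fract (Real.exp t) * Real.exp (-s * t)
      = 1 / (s - 1) - ∫ t in Ioi (0 : ℝ), (⌊Real.exp t⌋₊ : ℝ) * Real.exp (-s * t) := by
    simp_rw [fract_exp_mul_exp]
    rw [integral_sub (integrableOn_exp_mul_Ioi (by linarith) 0) hfloor,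
      integral_exp_neg_mul_Ioi_zero (by linarith)]
  rw [hfract, riemannZeta₁_re_ofReal hs.ne', riemannZeta_re_eq_mul_integral_floor hs]
  field_simp
  ring

lemma mgf_laplaceMeasure_fract_exp (τ : ℝ) :
    mgf id (laplaceMeasure fun t => Int.fract (Real.exp t)) τ
      = ∫ t in Ioi 0, Int.fract (Real.exp t) * Real.exp (τ * t) := by
  rw [mgf_laplaceMeasure (by fun_prop)]
  simp only [max_eq_left (Int.fract_nonneg _)]

lemma Iio_zero_subset_interior_integrableExpSet_fract_exp :
    Iio 0 ⊆ interior (integrableExpSet id (laplaceMeasure fun t => Int.fract (Real.exp t))) := by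
  refine interior_maximal (fun τ hτ => ?_) isOpen_Iio
  refine mem_integrableExpSet_laplaceMeasure_of_abs_le (by fun_prop) (C := 1) (K := 0)
    (fun t _ => ?_) (by simpa using hτ)
  rw [abs_of_nonneg (Int.fract_nonneg _), zero_mul, Real.exp_zero, one_mul]
  exact (Int.fract_lt_one _).le

lemma riemannZeta₁_re_eq {s : ℝ} (hs : 0 < s) :
    (riemannZeta₁ s).re =
      s * (1 - (s - 1) * mgf id (laplaceMeasure fun t => Int.fract (Real.exp t)) (-s)) := by
  set ν := laplaceMeasure fun t => Int.fract (Real.exp t)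
  suffices heq : EqOn (fun s : ℝ => (riemannZeta₁ s).re)
      (fun s : ℝ => s * (1 - (s - 1) * mgf id ν (-s))) (Ioi 0) from heq hs
  refine AnalyticOnNhd.eqOn_of_preconnected_of_eventuallyEq (𝕜 := ℝ) (z₀ := 2)
    (fun s _ => (differentiable_riemannZeta₁.analyticAt s).re_ofReal)
    (fun s hs => ?_) isPreconnected_Ioi (by simp) ?_
  · have hmgf : AnalyticAt ℝ (fun s => mgf id ν (-s)) s := AnalyticAt.fun_comp (analyticAt_mgf
      (Iio_zero_subset_interior_integrableExpSet_fract_exp (by simpa using hs))) (by fun_prop)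
    fun_prop
  · filter_upwards [Ioi_mem_nhds (show (1 : ℝ) < 2 by norm_num)] with s hs
    rw [riemannZeta₁_re_eq_of_one_lt hs, mgf_laplaceMeasure_fract_exp]

lemma riemannZeta₁_re_pos {s : ℝ} (hs : 0 < s) : 0 < (riemannZeta₁ s).re := by
  rcases lt_or_ge 1 s with h | h
  · rw [riemannZeta₁_re_ofReal h.ne']
    exact mul_pos (sub_pos.mpr h) (riemannZeta_re_pos_of_one_lt h)
  · rw [riemannZeta₁_re_eq hs]
    have hmgf := mul_nonneg (sub_nonneg.mpr h)
      (mgf_nonneg (X := id) (μ := laplaceMeasure fun t => Int.fract (Real.exp t)) (t := -s))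
    exact mul_pos hs (by linarith)

end RealZeta

section PrimePowers

open MeasureTheory Set
open ArithmeticFunction (vonMangoldt)

/-- The Dirichlet coefficients `Λ(n) / (n ^ a log n)` of `log ζ(s + a)`. -/
noncomputable def primePowCoeff (a : ℝ) (n : ℕ) : ℝ :=
  vonMangoldt n / Real.log n * (n : ℝ) ^ (-a)

/-- The summatory function `∑_{n ≤ y} Λ(n) / (n ^ a log n)`, which sums `p ^ (-ka) / k` over the
prime powers `p ^ k ≤ y`. -/
noncomputable def primePowSum (a y : ℝ) : ℝ := ∑ n ∈ Finset.Icc 1 ⌊y⌋₊, primePowCoeff a n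

lemma primePowCoeff_nonneg (a : ℝ) (n : ℕ) : 0 ≤ primePowCoeff a n :=
  mul_nonneg (div_nonneg ArithmeticFunction.vonMangoldt_nonneg (Real.log_natCast_nonneg n))
    (by positivity)

lemma primePowCoeff_le_one {a : ℝ} (ha : 0 ≤ a) (n : ℕ) : primePowCoeff a n ≤ 1 := by
  rcases n.eq_zero_or_pos with rfl | hn
  · simp [primePowCoeff]
  · exact mul_le_one₀
      (div_le_one_of_le₀ ArithmeticFunction.vonMangoldt_le_log (Real.log_natCast_nonneg n))
      (by positivity)
      (Real.rpow_le_one_of_one_le_of_nonpos (by exact_mod_cast hn) (neg_nonpos.mpr ha))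

lemma log_mul_primePowCoeff (a : ℝ) (n : ℕ) :
    Real.log n * primePowCoeff a n = vonMangoldt n * (n : ℝ) ^ (-a) := by
  rw [primePowCoeff, ← mul_assoc, mul_div_cancel_of_imp']
  intro hlog
  exact le_antisymm (hlog ▸ ArithmeticFunction.vonMangoldt_le_log)
    ArithmeticFunction.vonMangoldt_nonneg

lemma primePowSum_nonneg (a y : ℝ) : 0 ≤ primePowSum a y :=
  Finset.sum_nonneg fun n _ => primePowCoeff_nonneg a n

lemma primePowSum_le {a y : ℝ} (ha : 0 ≤ a) (hy : 0 ≤ y) : primePowSum a y ≤ y := by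
  refine (Finset.sum_le_card_nsmul _ _ 1 fun n _ => primePowCoeff_le_one ha n).trans ?_
  simpa using Nat.floor_le hy

lemma measurable_primePowSum (a : ℝ) : Measurable (primePowSum a) :=
  (measurable_from_top (f := fun n : ℕ => ∑ k ∈ Finset.Icc 1 n, primePowCoeff a k)).comp
    Nat.measurable_floor

lemma isBigO_sum_primePowCoeff {a : ℝ} (ha : 0 ≤ a) :
    (fun n ↦ ∑ k ∈ Finset.Icc 1 n, primePowCoeff a k) =O[atTop] fun n ↦ (n : ℝ) ^ (1 : ℝ) := by
  refine Asymptotics.IsBigO.of_bound 1 (Eventually.of_forall fun n => ?_)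
  rw [Real.norm_eq_abs, abs_of_nonneg (Finset.sum_nonneg fun n _ => primePowCoeff_nonneg a n)]
  simpa [primePowSum] using primePowSum_le (y := n) ha (by positivity)

lemma abscissaOfAbsConv_primePowCoeff_le {a : ℝ} (ha : 0 ≤ a) :
    LSeries.abscissaOfAbsConv (fun n => (primePowCoeff a n : ℂ)) ≤ 1 := by
  refine LSeries.abscissaOfAbsConv_le_of_forall_lt_LSeriesSummable' fun s hs => ?_
  refine LSeriesSummable_of_sum_norm_bigO (r := 1) ?_ zero_le_one (by exact_mod_cast hs)
  refine (isBigO_sum_primePowCoeff ha).congr_left fun n => Finset.sum_congr rfl fun k _ => ?_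
  rw [Complex.norm_real, Real.norm_eq_abs, abs_of_nonneg (primePowCoeff_nonneg a k)]

lemma LSeries_logMul_primePowCoeff (a : ℝ) (s : ℂ) :
    LSeries (LSeries.logMul fun n => (primePowCoeff a n : ℂ)) s
      = LSeries (fun n => (vonMangoldt n : ℂ)) (s + a) := by
  refine tsum_congr fun n => ?_
  rcases n.eq_zero_or_pos with rfl | hn
  · simp only [LSeries.term_zero]
  have hlog : Complex.log n * (primePowCoeff a n : ℂ) = vonMangoldt n / (n : ℂ) ^ (a : ℂ) := by
    rw [← Complex.natCast_log, ← Complex.ofReal_mul, log_mul_primePowCoeff,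
      Real.rpow_neg (Nat.cast_nonneg n), ← div_eq_mul_inv, Complex.ofReal_div,
      Complex.ofReal_cpow (Nat.cast_nonneg n), Complex.ofReal_natCast]
  rw [LSeries.term_of_ne_zero hn.ne', LSeries.term_of_ne_zero hn.ne', LSeries.logMul, hlog,
    Complex.cpow_add _ _ (by exact_mod_cast hn.ne'), div_div, mul_comm]

lemma hasDerivAt_re_LSeries_primePowCoeff {a s : ℝ} (ha : 0 ≤ a) (hs : 1 < s) :
    HasDerivAt (fun t : ℝ => (LSeries (fun n => (primePowCoeff a n : ℂ)) t).re)
      (deriv riemannZeta ((s + a : ℝ) : ℂ) / riemannZeta ((s + a : ℝ) : ℂ)).re s := by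
  have hderiv := LSeries_hasDerivAt (f := fun n => (primePowCoeff a n : ℂ)) (s := s)
    ((abscissaOfAbsConv_primePowCoeff_le ha).trans_lt (by exact_mod_cast hs))
  rw [LSeries_logMul_primePowCoeff, ← Complex.ofReal_add,
    ArithmeticFunction.LSeries_vonMangoldt_eq_deriv_riemannZeta_div
      (by rw [Complex.ofReal_re]; linarith), neg_div, neg_neg] at hderiv
  exact hderiv.real_of_complex

lemma hasDerivAt_log_re_riemannZeta {s : ℝ} (hs : 1 < s) :
    HasDerivAt (fun t : ℝ => Real.log (riemannZeta t).re)
      (deriv riemannZeta s / riemannZeta s).re s := by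
  have hzeta : HasDerivAt riemannZeta (deriv riemannZeta s) s :=
    (differentiableAt_riemannZeta (by exact_mod_cast hs.ne')).hasDerivAt
  convert! hzeta.real_of_complex.log (riemannZeta_re_pos_of_one_lt hs).ne' using 1
  have hre : riemannZeta s = ((riemannZeta s).re : ℂ) :=
    Complex.ext (by simp) (by rw [riemannZeta_im_eq_zero_of_one_lt hs, Complex.ofReal_im])
  rw [hre, Complex.div_ofReal_re, Complex.ofReal_re]

lemma exists_mul_integral_primePowSum_eq {a : ℝ} (ha : 0 ≤ a) : ∃ c₀ : ℝ, ∀ s > (1 : ℝ),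
    s * ∫ t in Ioi (0 : ℝ), primePowSum a (Real.exp t) * Real.exp (-s * t)
      = Real.log (riemannZeta ((s + a : ℝ) : ℂ)).re + c₀ := by
  have hderiv (s : ℝ) (hs : 1 < s) := (hasDerivAt_re_LSeries_primePowCoeff ha hs).fun_sub
    ((hasDerivAt_log_re_riemannZeta (show 1 < s + a by linarith)).comp_add_const s a)
  obtain ⟨c₀, hc₀⟩ := isOpen_Ioi.exists_is_const_of_deriv_eq_zero (s := Ioi (1 : ℝ))
    isPreconnected_Ioi
    (fun s hs => (hderiv s hs).differentiableAt.differentiableWithinAt)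
    (fun s hs => by rw [(hderiv s hs).deriv, sub_self]; rfl)
  refine ⟨c₀, fun s hs => ?_⟩
  have hconst := hc₀ s hs
  rw [LSeries_eq_mul_integral_exp _ (primePowCoeff_nonneg a) zero_le_one hs
    (isBigO_sum_primePowCoeff ha), Complex.ofReal_re] at hconst
  exact sub_eq_iff_eq_add'.mp hconst

end PrimePowers

section ExpQuot

open MeasureTheory Set

/-- The entire function `(e ^ t - 1) / t`, written as an integral so as to have the value `1` at
`0`. -/
noncomputable def expQuot (t : ℝ) : ℝ := ∫ r in (0 : ℝ)..1, Real.exp (r * t)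

/-- The primitive `∫_0^s (e ^ t - 1) / t dt`: at `s = (1 - a) log y` it is the smooth approximation
to `∑_{n ≤ y} Λ(n) / (n ^ a log n)`, and at `s = ξ(u)` it governs the size of `ρ(u)`. -/
noncomputable def expQuotInt (s : ℝ) : ℝ := ∫ t in (0 : ℝ)..s, expQuot t

lemma continuous_expQuot : Continuous expQuot :=
  intervalIntegral.continuous_parametric_intervalIntegral_of_continuous' (by fun_prop) 0 1

lemma mul_expQuot (t : ℝ) : t * expQuot t = Real.exp t - 1 := by
  rw [expQuot, intervalIntegral.mul_integral_comp_mul_right]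
  simp

lemma expQuot_zero : expQuot 0 = 1 := by simp [expQuot]

lemma monotone_expQuot : Monotone expQuot := fun s t hst =>
  intervalIntegral.integral_mono_on zero_le_one (Continuous.intervalIntegrable (by fun_prop) _ _)
    (Continuous.intervalIntegrable (by fun_prop) _ _) fun r hr =>
    Real.exp_le_exp.mpr (mul_le_mul_of_nonneg_left hst hr.1)

lemma one_le_expQuot {s : ℝ} (hs : 0 ≤ s) : 1 ≤ expQuot s := expQuot_zero ▸ monotone_expQuot hs

lemma expQuot_pos (s : ℝ) : 0 < expQuot s :=
  intervalIntegral.intervalIntegral_pos_of_pos (Continuous.intervalIntegrable (by fun_prop) _ _)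
    (fun _ => Real.exp_pos _) one_pos

lemma exp_sub_exp_le (x y : ℝ) : Real.exp x - Real.exp y ≤ (x - y) * Real.exp x := by
  have h := mul_le_mul_of_nonneg_left (Real.add_one_le_exp (y - x)) (Real.exp_pos x).le
  rw [← Real.exp_add, add_sub_cancel] at h
  linarith

lemma expQuot_sub_le {s h : ℝ} (hs : 0 ≤ s) (hh : 0 ≤ h) :
    expQuot (s + h) - expQuot s ≤ h * Real.exp (s + h) := by
  rw [expQuot, expQuot, ← intervalIntegral.integral_sub
    (Continuous.intervalIntegrable (by fun_prop) _ _)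
    (Continuous.intervalIntegrable (by fun_prop) _ _)]
  calc ∫ r in (0 : ℝ)..1, (Real.exp (r * (s + h)) - Real.exp (r * s))
      ≤ ∫ _ in (0 : ℝ)..1, h * Real.exp (s + h) := by
        refine intervalIntegral.integral_mono_on zero_le_one
          (Continuous.intervalIntegrable (by fun_prop) _ _)
          (Continuous.intervalIntegrable (by fun_prop) _ _) fun r hr => ?_
        refine (exp_sub_exp_le _ _).trans ?_
        rw [← mul_sub, add_sub_cancel_left]
        exact mul_le_mul (mul_le_of_le_one_left hh hr.2)
          (Real.exp_le_exp.mpr (mul_le_of_le_one_left (add_nonneg hs hh) hr.2))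
          (Real.exp_pos _).le hh
    _ = h * Real.exp (s + h) := by simp

lemma hasDerivAt_expQuotInt (s : ℝ) : HasDerivAt expQuotInt (expQuot s) s :=
  intervalIntegral.integral_hasDerivAt_right (continuous_expQuot.intervalIntegrable _ _)
    (continuous_expQuot.stronglyMeasurableAtFilter _ _) continuous_expQuot.continuousAt

lemma continuous_expQuotInt : Continuous expQuotInt :=
  continuous_iff_continuousAt.mpr fun s => (hasDerivAt_expQuotInt s).continuousAt

lemma expQuotInt_zero : expQuotInt 0 = 0 := by simp [expQuotInt]

lemma mul_expQuot_le_expQuotInt_sub (s t : ℝ) :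
    (t - s) * expQuot s ≤ expQuotInt t - expQuotInt s := by
  rw [expQuotInt, expQuotInt, intervalIntegral.integral_interval_sub_left
    (continuous_expQuot.intervalIntegrable _ _) (continuous_expQuot.intervalIntegrable _ _),
    ← smul_eq_mul, ← intervalIntegral.integral_const]
  rcases le_total s t with h | h
  · exact intervalIntegral.integral_mono_on h (by simp) (continuous_expQuot.intervalIntegrable _ _)
      fun r hr => monotone_expQuot hr.1
  · rw [intervalIntegral.integral_symm, intervalIntegral.integral_symm t s, neg_le_neg_iff]
    exact intervalIntegral.integral_mono_on h (continuous_expQuot.intervalIntegrable _ _) (by simp)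
      fun r hr => monotone_expQuot hr.2

lemma expQuotInt_nonneg {s : ℝ} (hs : 0 ≤ s) : 0 ≤ expQuotInt s :=
  intervalIntegral.integral_nonneg hs fun t _ => (expQuot_pos t).le

lemma expQuotInt_le_exp (s : ℝ) : expQuotInt s ≤ Real.exp s := by
  have htangent := mul_expQuot_le_expQuotInt_sub s 0
  rw [expQuotInt_zero, zero_sub, neg_mul, mul_expQuot] at htangent
  linarith

lemma expQuotInt_mul_eq (b t : ℝ) :
    expQuotInt (b * t) = ∫ r in (0 : ℝ)..b, t * expQuot (r * t) := by
  rw [intervalIntegral.integral_const_mul, intervalIntegral.mul_integral_comp_mul_right, zero_mul,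
    expQuotInt]

lemma mul_expQuot_mul_eq {r : ℝ} (hr : 0 < r) (t : ℝ) :
    t * expQuot (r * t) = 1 / r * (Real.exp (r * t) - 1) := by
  rw [← mul_expQuot, mul_assoc, ← mul_assoc, one_div_mul_cancel hr.ne', one_mul]

lemma integral_mul_expQuot_mul_exp {r s : ℝ} (hr : 0 < r) (hrs : r < s) :
    ∫ t in Ioi (0 : ℝ), t * expQuot (r * t) * Real.exp (-s * t) = 1 / s * (1 / (s - r)) := by
  have hsplit (t : ℝ) : t * expQuot (r * t) * Real.exp (-s * t)
      = 1 / r * (Real.exp (-(s - r) * t) - Real.exp (-s * t)) := by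
    rw [mul_expQuot_mul_eq hr, show -(s - r) * t = r * t + -s * t by ring, Real.exp_add]
    ring
  simp_rw [hsplit]
  rw [integral_const_mul, integral_sub (integrableOn_exp_mul_Ioi (by linarith) 0)
    (integrableOn_exp_mul_Ioi (by linarith) 0), integral_exp_neg_mul_Ioi_zero (by linarith),
    integral_exp_neg_mul_Ioi_zero (by linarith)]
  have hsr : s - r ≠ 0 := by linarith
  have hs : s ≠ 0 := by linarith
  field_simp
  ring

lemma integrable_mul_expQuot_mul_exp {b s : ℝ} (hb : 0 < b) (hbs : b < s) :
    Integrable (fun p : ℝ × ℝ => p.1 * expQuot (p.2 * p.1) * Real.exp (-s * p.1))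
      ((volume.restrict (Ioi 0)).prod (volume.restrict (Ioc 0 b))) := by
  have hdom : Integrable (fun t : ℝ => 1 / b * Real.exp ((b - s) * t)) (volume.restrict (Ioi 0)) :=
    (integrableOn_exp_mul_Ioi (by linarith) 0).const_mul _
  have hone : Integrable (fun _ : ℝ => (1 : ℝ)) (volume.restrict (Ioc 0 b)) := by simp
  have hcont := continuous_expQuot
  refine (hdom.mul_prod hone).mono' (Continuous.aestronglyMeasurable (by fun_prop)) ?_
  rw [Measure.prod_restrict]
  filter_upwards [ae_restrict_mem (measurableSet_Ioi.prod measurableSet_Ioc)] with p hp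
  obtain ⟨hp₁, -, hp₂⟩ : 0 < p.1 ∧ 0 < p.2 ∧ p.2 ≤ b := hp
  have hquot := expQuot_pos (p.2 * p.1)
  rw [Real.norm_eq_abs, abs_of_nonneg (by positivity), mul_one]
  calc p.1 * expQuot (p.2 * p.1) * Real.exp (-s * p.1)
      ≤ p.1 * expQuot (b * p.1) * Real.exp (-s * p.1) := by
        gcongr
        exact monotone_expQuot (mul_le_mul_of_nonneg_right hp₂ hp₁.le)
    _ ≤ 1 / b * Real.exp (b * p.1) * Real.exp (-s * p.1) := by
        rw [mul_expQuot_mul_eq hb]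
        gcongr
        linarith
    _ = 1 / b * Real.exp ((b - s) * p.1) := by
        rw [mul_assoc, ← Real.exp_add]
        ring_nf

lemma integral_expQuotInt_mul_exp {b s : ℝ} (hb : 0 < b) (hbs : b < s) :
    ∫ t in Ioi (0 : ℝ), expQuotInt (b * t) * Real.exp (-s * t)
      = 1 / s * (Real.log s - Real.log (s - b)) := by
  calc ∫ t in Ioi (0 : ℝ), expQuotInt (b * t) * Real.exp (-s * t)
      = ∫ t in Ioi (0 : ℝ), ∫ r in Ioc 0 b, t * expQuot (r * t) * Real.exp (-s * t) := by
        simp_rw [expQuotInt_mul_eq, intervalIntegral.integral_of_le hb.le, integral_mul_const]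
    _ = ∫ r in Ioc 0 b, 1 / s * (1 / (s - r)) := by
        rw [integral_integral_swap (integrable_mul_expQuot_mul_exp hb hbs)]
        exact setIntegral_congr_fun measurableSet_Ioc fun r hr =>
          integral_mul_expQuot_mul_exp hr.1 (hr.2.trans_lt hbs)
    _ = 1 / s * (Real.log s - Real.log (s - b)) := by
        rw [integral_const_mul, ← intervalIntegral.integral_of_le hb.le,
          intervalIntegral.integral_comp_sub_left (fun x => 1 / x) s, sub_zero,
          integral_one_div_of_pos (by linarith) (by linarith),
          Real.log_div (by linarith) (by linarith)]

end ExpQuot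

section Oscillation

open MeasureTheory Set

lemma zetaTheta_le_one : zetaTheta ≤ 1 := by
  refine csSup_le ⟨-2, -2, ?_, by simp⟩ ?_
  · simpa using riemannZeta_neg_two_mul_nat_add_one 0
  · rintro r ⟨s, hs, rfl⟩
    by_contra! h
    exact riemannZeta_ne_zero_of_one_le_re h.le hs

lemma exists_zero_of_lt_zetaTheta {r : ℝ} (hr : r < zetaTheta) :
    ∃ s : ℂ, riemannZeta s = 0 ∧ r < s.re := by
  have hne : {r : ℝ | ∃ s : ℂ, riemannZeta s = 0 ∧ s.re = r}.Nonempty :=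
    ⟨-2, -2, by simpa using riemannZeta_neg_two_mul_nat_add_one 0, by simp⟩
  obtain ⟨_, ⟨s, hs, rfl⟩, hrs⟩ := exists_lt_of_lt_csSup hne hr
  exact ⟨s, hs, hrs⟩

lemma riemannZeta₁_ofReal_of_one_lt {s : ℝ} (hs : 1 < s) :
    riemannZeta₁ s = ((riemannZeta₁ s).re : ℂ) := by
  refine Complex.ext (by simp) ?_
  rw [riemannZeta₁_eq (by exact_mod_cast hs.ne'), ← Complex.ofReal_one, ← Complex.ofReal_sub,
    Complex.im_ofReal_mul, riemannZeta_im_eq_zero_of_one_lt hs, mul_zero, Complex.ofReal_im]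

lemma eqOn_halfPlane_of_eq_ofReal {f g : ℂ → ℂ} {β K : ℝ}
    (hf : AnalyticOnNhd ℂ f {s | β < s.re}) (hg : AnalyticOnNhd ℂ g {s | β < s.re})
    (h : ∀ s : ℝ, K < s → f s = g s) : EqOn f g {s | β < s.re} := by
  obtain ⟨z, hz⟩ := exists_gt (max β K)
  obtain ⟨hzβ, hzK⟩ := max_lt_iff.mp hz
  refine hf.eqOn_of_preconnected_of_frequently_eq hg
    (convex_halfSpace_re_gt β).isPreconnected (z₀ := (z : ℂ)) (by simpa using hzβ) ?_
  have hcoe : Tendsto (fun t : ℝ => (t : ℂ)) (𝓝[≠] z) (𝓝[≠] (z : ℂ)) :=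
    (Complex.continuous_ofReal.tendsto z).inf
      (tendsto_principal_principal.mpr fun t ht => by simpa using ht)
  refine hcoe.frequently (Eventually.frequently ?_)
  filter_upwards [nhdsWithin_le_nhds (Ioi_mem_nhds hzK)] with t ht using h t ht

/-- The difference between `∑_{n ≤ y} Λ(n) / (n ^ a log n)` and its smooth approximation. -/
noncomputable def primePowError (a y : ℝ) : ℝ :=
  primePowSum a y - expQuotInt ((1 - a) * Real.log y)

lemma measurable_primePowError (a : ℝ) : Measurable (primePowError a) :=
  (measurable_primePowSum a).sub
    (continuous_expQuotInt.measurable.comp (Real.measurable_log.const_mul _))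

lemma abs_primePowSum_exp_le {a : ℝ} (ha : 0 ≤ a) (t : ℝ) :
    |primePowSum a (Real.exp t)| ≤ 1 * Real.exp (1 * t) := by
  rw [abs_of_nonneg (primePowSum_nonneg _ _), one_mul, one_mul]
  exact primePowSum_le ha (Real.exp_pos t).le

lemma abs_expQuotInt_mul_le {b t : ℝ} (hb₀ : 0 ≤ b) (hb₁ : b ≤ 1) (ht : 0 ≤ t) :
    |expQuotInt (b * t)| ≤ 1 * Real.exp (1 * t) := by
  rw [abs_of_nonneg (expQuotInt_nonneg (mul_nonneg hb₀ ht)), one_mul]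
  exact (expQuotInt_le_exp _).trans (Real.exp_le_exp.mpr (mul_le_mul_of_nonneg_right hb₁ ht))

lemma abs_primePowError_exp_le {a t : ℝ} (ha₀ : 0 ≤ a) (ha₁ : a ≤ 1) (ht : 0 ≤ t) :
    |primePowError a (Real.exp t)| ≤ 2 * Real.exp (1 * t) := by
  rw [primePowError, Real.log_exp]
  have h_int := abs_expQuotInt_mul_le (sub_nonneg.mpr ha₁) (sub_le_self 1 ha₀) ht
  linarith [abs_sub (primePowSum a (Real.exp t)) (expQuotInt ((1 - a) * t)),
    abs_primePowSum_exp_le ha₀ t]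

lemma abs_exp_mul_sub_mul_primePowError_le {a β t : ℝ} (ha₀ : 0 ≤ a) (ha₁ : a ≤ 1) (hβ : β ≤ 1)
    (ε : ℝ) (ht : 0 ≤ t) : |Real.exp (β * t) - ε * primePowError a (Real.exp t)|
      ≤ (1 + |ε| * 2) * Real.exp (1 * t) := by
  calc |Real.exp (β * t) - ε * primePowError a (Real.exp t)|
      ≤ |Real.exp (β * t)| + |ε * primePowError a (Real.exp t)| := abs_sub _ _
    _ ≤ Real.exp (1 * t) + |ε| * (2 * Real.exp (1 * t)) := by
        rw [Real.abs_exp, abs_mul]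
        gcongr
        exact abs_primePowError_exp_le ha₀ ha₁ ht
    _ = (1 + |ε| * 2) * Real.exp (1 * t) := by ring

lemma exists_integral_primePowError_eq {a : ℝ} (ha₀ : 0 ≤ a) (ha₁ : a < 1) :
    ∃ c₀ : ℝ, ∀ s > (1 : ℝ),
      ∫ t in Ioi (0 : ℝ), primePowError a (Real.exp t) * Real.exp (-s * t)
        = 1 / s * (Real.log (riemannZeta₁ ((s + a : ℝ) : ℂ)).re - Real.log s + c₀) := by
  obtain ⟨c₀, hc₀⟩ := exists_mul_integral_primePowSum_eq ha₀
  refine ⟨c₀, fun s hs => ?_⟩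
  have hsum := integrableOn_mul_exp_of_abs_le (w := fun t => primePowSum a (Real.exp t))
    ((measurable_primePowSum a).comp Real.measurable_exp)
    (fun t _ => abs_primePowSum_exp_le ha₀ t) (τ := -s) (by linarith)
  have h_int := integrableOn_mul_exp_of_abs_le (w := fun t => expQuotInt ((1 - a) * t))
    (continuous_expQuotInt.comp (by fun_prop)).measurable
    (fun t ht => abs_expQuotInt_mul_le (by linarith) (by linarith) (le_of_lt ht)) (τ := -s)
    (by linarith)
  have hzeta : Real.log (riemannZeta₁ ((s + a : ℝ) : ℂ)).re
      = Real.log (s - (1 - a)) + Real.log (riemannZeta ((s + a : ℝ) : ℂ)).re := by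
    rw [riemannZeta₁_re_ofReal (by linarith), Real.log_mul (by linarith)
      (riemannZeta_re_pos_of_one_lt (by linarith)).ne', show s + a - 1 = s - (1 - a) by ring]
  have hs₀ : s ≠ 0 := by linarith
  calc ∫ t in Ioi (0 : ℝ), primePowError a (Real.exp t) * Real.exp (-s * t)
      = (∫ t in Ioi (0 : ℝ), primePowSum a (Real.exp t) * Real.exp (-s * t))
        - ∫ t in Ioi (0 : ℝ), expQuotInt ((1 - a) * t) * Real.exp (-s * t) := by
        rw [← integral_sub hsum h_int]
        simp only [primePowError, Real.log_exp, ← sub_mul]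
    _ = 1 / s * (Real.log (riemannZeta₁ ((s + a : ℝ) : ℂ)).re - Real.log s + c₀) := by
        rw [integral_expQuotInt_mul_exp (by linarith) (by linarith), hzeta,
          eq_div_of_mul_eq hs₀ ((mul_comm _ _).trans (hc₀ s hs))]
        ring

lemma analyticAt_log_riemannZeta₁_re {s : ℝ} (hs : 0 < s) :
    AnalyticAt ℝ (fun s : ℝ => Real.log (riemannZeta₁ s).re) s :=
  (differentiable_riemannZeta₁.analyticAt _).re_ofReal.log (riemannZeta₁_re_pos hs)

-- By Landau's theorem a one-sided bound for the error continues its Laplace transform, hence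
-- `log ((s + a - 1) ζ(s + a))`, to `β < re s`.
lemma exists_analyticOnNhd_of_eventually_mul_primePowError_le {a β ε : ℝ} (ha₀ : 0 ≤ a)
    (ha₁ : a < 1) (hβ₀ : 0 < β) (hβ₁ : β ≤ 1)
    (h : ∀ᶠ y in atTop, ε * primePowError a y ≤ y ^ β) :
    ∃ G : ℂ → ℂ, ∃ c₀ : ℝ, AnalyticOnNhd ℂ G {s | β < s.re} ∧ ∀ s : ℝ, 1 < s →
      G s = ((1 / (s - β) - ε * (1 / s *
        (Real.log (riemannZeta₁ ((s + a : ℝ) : ℂ)).re - Real.log s + c₀)) : ℝ) : ℂ) := by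
  obtain ⟨c₀, hc₀⟩ := exists_integral_primePowError_eq ha₀ ha₁
  set w : ℝ → ℝ := fun t => Real.exp (β * t) - ε * primePowError a (Real.exp t) with hw
  have herr : Measurable fun t => primePowError a (Real.exp t) :=
    (measurable_primePowError a).comp Real.measurable_exp
  have hbound : ∀ t > 0, |w t| ≤ (1 + |ε| * 2) * Real.exp (1 * t) := fun t ht =>
    abs_exp_mul_sub_mul_primePowError_le ha₀ ha₁.le hβ₁ ε (le_of_lt ht)
  have hpos : ∀ᶠ t in atTop, 0 ≤ w t := by
    filter_upwards [Real.tendsto_exp_atTop.eventually h] with t ht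
    rw [← Real.exp_mul, mul_comm t β] at ht
    exact sub_nonneg.mpr ht
  set F : ℝ → ℝ := fun s => 1 / (s - β) - ε * (1 / s *
    (Real.log (riemannZeta₁ ((s + a : ℝ) : ℂ)).re - Real.log s + c₀))
  have hF : AnalyticOnNhd ℝ F (Ioi β) := fun s hs => by
    have hs₀ : 0 < s := hβ₀.trans hs
    have hsβ : s - β ≠ 0 := (sub_pos.mpr hs).ne'
    have hlog : AnalyticAt ℝ (fun s : ℝ => Real.log (riemannZeta₁ ((s + a : ℝ) : ℂ)).re) s :=
      AnalyticAt.fun_comp (g := fun s : ℝ => Real.log (riemannZeta₁ (s : ℂ)).re)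
        (analyticAt_log_riemannZeta₁_re (by linarith)) (by fun_prop)
    have _hlog := analyticAt_log hs₀
    have hs_ne := hs₀.ne'
    fun_prop (disch := assumption)
  have hw_eq : ∀ s > 1, ∫ t in Ioi 0, w t * Real.exp (-s * t) = F s := fun s hs => by
    have hsplit (t : ℝ) : w t * Real.exp (-s * t) = Real.exp (-(s - β) * t)
        - ε * (primePowError a (Real.exp t) * Real.exp (-s * t)) := by
      rw [show -(s - β) * t = β * t + -s * t by ring, Real.exp_add, hw]
      ring
    simp_rw [hsplit]
    rw [integral_sub (integrableOn_exp_mul_Ioi (by linarith) 0)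
      ((integrableOn_mul_exp_of_abs_le herr
        (fun t ht => abs_primePowError_exp_le ha₀ ha₁.le (le_of_lt ht)) (by linarith)).const_mul ε),
      integral_const_mul, integral_exp_neg_mul_Ioi_zero (by linarith), hc₀ s hs]
  obtain ⟨G, hG, hGF⟩ :=
    exists_analyticOnNhd_eq_of_eventually_nonneg (by fun_prop) hbound hpos hF hw_eq
  exact ⟨G, c₀, hG, hGF⟩

lemma exists_riemannZeta₁_eq_mul_cexp {a β ε : ℝ} (ha₀ : 0 ≤ a) (ha₁ : a < 1) (hβ₀ : 0 < β)
    (hβ₁ : β ≤ 1) (hε : ε ≠ 0) (h : ∀ᶠ y in atTop, ε * primePowError a y ≤ y ^ β) :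
    ∃ H : ℂ → ℂ, ∀ s : ℂ, β < s.re → riemannZeta₁ (s + a) = s * Complex.exp (H s) := by
  obtain ⟨G, c₀, hG, hGF⟩ :=
    exists_analyticOnNhd_of_eventually_mul_primePowError_le ha₀ ha₁ hβ₀ hβ₁ h
  refine ⟨fun s => s / ε * (1 / (s - β) - G s) - c₀,
    eqOn_halfPlane_of_eq_ofReal (K := 1) (fun s _ => ?_) (fun s hs => ?_) (fun s hs => ?_)⟩
  · exact AnalyticAt.fun_comp (differentiable_riemannZeta₁.analyticAt _) (by fun_prop)
  · have hGs := hG s hs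
    have hsβ : s - β ≠ 0 := fun h => by
      rw [mem_ofPred_eq, sub_eq_zero.mp h, Complex.ofReal_re] at hs
      exact lt_irrefl _ hs
    have _hε : (ε : ℂ) ≠ 0 := by exact_mod_cast hε
    fun_prop (disch := assumption)
  · have hs₀ : 0 < s := by linarith
    simp only [hGF s hs]
    rw [← Complex.ofReal_add, riemannZeta₁_ofReal_of_one_lt (by linarith)]
    norm_cast
    have hexponent : s / ε * (1 / (s - β) - (1 / (s - β) - ε * (1 / s *
        (Real.log (riemannZeta₁ ((s + a : ℝ) : ℂ)).re - Real.log s + c₀)))) - c₀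
        = Real.log (riemannZeta₁ ((s + a : ℝ) : ℂ)).re - Real.log s := by
      field_simp
      ring
    rw [hexponent, Real.exp_sub, Real.exp_log (riemannZeta₁_re_pos (by linarith)),
      Real.exp_log hs₀, mul_div_cancel₀ _ hs₀.ne']

theorem frequently_rpow_le_mul_primePowError {a β ε : ℝ} (ha₀ : 0 ≤ a) (ha₁ : a < 1) (hβ : 0 < β)
    (hε : ε ≠ 0) (hΘ : a + β < zetaTheta) :
    ∃ᶠ y in atTop, y ^ β ≤ ε * primePowError a y := by
  intro hcon
  obtain ⟨H, hH⟩ := exists_riemannZeta₁_eq_mul_cexp ha₀ ha₁ hβ (by linarith [zetaTheta_le_one]) hε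
    (hcon.mono fun y hy => (not_le.mp hy).le)
  obtain ⟨z, hz, hzre⟩ := exists_zero_of_lt_zetaTheta hΘ
  have hβz : β < (z - a).re := by
    rw [Complex.sub_re, Complex.ofReal_re]
    linarith
  have hzero := hH (z - a) hβz
  rw [sub_add_cancel, riemannZeta₁_eq (fun h => riemannZeta_one_ne_zero (h ▸ hz)), hz, mul_zero,
    eq_comm, mul_eq_zero] at hzero
  rcases hzero with hza | hexp
  · rw [hza, Complex.zero_re] at hβz
    exact hβz.not_gt hβ
  · exact Complex.exp_ne_zero _ hexp

end Oscillation

section Dickman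

open MeasureTheory ProbabilityTheory Set

lemma hasDerivAt_mul_dickman {t : ℝ} (ht : 1 < t) :
    HasDerivAt (fun t => t * dickman t) (dickman t - dickman (t - 1)) t := by
  refine ((hasDerivAt_id t).mul (hasDerivAt_dickman ht)).congr_deriv ?_
  rw [one_mul, id, mul_div_cancel₀ _ (zero_lt_one.trans ht).ne', ← sub_eq_add_neg]

lemma integral_dickman_of_le_one {t : ℝ} (ht : t ≤ 1) : ∫ s in 0..t, dickman s = t := by
  rw [intervalIntegral.integral_congr (g := fun _ => 1) fun s hs =>
    dickman_of_le_one (hs.2.trans (sup_le zero_le_one ht))]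
  simp

lemma mul_dickman_eq_integral {t : ℝ} (ht : 1 ≤ t) :
    t * dickman t = ∫ s in (t - 1)..t, dickman s := by
  have h_int (a b : ℝ) : IntervalIntegrable dickman volume a b :=
    continuous_dickman.intervalIntegrable a b
  have hshift : Continuous fun s => dickman (s - 1) := continuous_dickman.comp (by fun_prop)
  have hprim : t * dickman t - 1 = ∫ s in 1..t, (dickman s - dickman (s - 1)) := by
    rw [intervalIntegral.integral_eq_sub_of_hasDerivAt_of_le ht
      (continuous_id.mul continuous_dickman).continuousOn
      (fun s hs => hasDerivAt_mul_dickman hs.1)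
      ((continuous_dickman.sub hshift).intervalIntegrable _ _)]
    simp [dickman_of_le_one le_rfl]
  rw [intervalIntegral.integral_sub (h_int _ _) (hshift.intervalIntegrable _ _),
    intervalIntegral.integral_comp_sub_right dickman 1, sub_self,
    intervalIntegral.integral_interval_sub_interval_comm' (h_int _ _) (h_int _ _) (h_int _ _),
    integral_dickman_of_le_one le_rfl] at hprim
  linarith

lemma mul_dickman_eq_integral_max (t : ℝ) :
    t * dickman t = ∫ s in (max 0 (t - 1))..t, dickman s := by
  rcases le_total t 1 with h | h
  · rw [max_eq_left (by linarith), integral_dickman_of_le_one h, dickman_of_le_one h, mul_one]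
  · rw [max_eq_right (by linarith), mul_dickman_eq_integral h]

lemma dickman_pos (t : ℝ) : 0 < dickman t := by
  by_contra! hcon
  set A := {t : ℝ | dickman t ≤ 0}
  have hA : ∀ s ∈ A, 1 < s := fun s hs => by
    by_contra! h
    exact absurd (dickman_of_le_one h ▸ hs : (1 : ℝ) ≤ 0) (by norm_num)
  have hbdd : BddBelow A := ⟨1, fun s hs => (hA s hs).le⟩
  have hmem : sInf A ∈ A :=
    (isClosed_le continuous_dickman continuous_const).csInf_mem ⟨t, hcon⟩ hbdd
  have h_int : 0 < ∫ s in (sInf A - 1)..(sInf A), dickman s :=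
    intervalIntegral.intervalIntegral_pos_of_pos_on (continuous_dickman.intervalIntegrable _ _)
      (fun s hs => not_le.mp fun h => (csInf_le hbdd h).not_gt hs.2) (by linarith)
  rw [← mul_dickman_eq_integral (hA _ hmem).le] at h_int
  exact h_int.not_ge (mul_nonpos_of_nonneg_of_nonpos (by linarith [hA _ hmem]) hmem)

lemma antitone_dickman : Antitone dickman := by
  have hanti : AntitoneOn dickman (Ici 1) := by
    refine antitoneOn_of_hasDerivWithinAt_nonpos (f' := fun t => -dickman (t - 1) / t)
      (convex_Ici 1) continuous_dickman.continuousOn (fun t ht => ?_) (fun t ht => ?_)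
    all_goals rw [interior_Ici] at ht
    · exact (hasDerivAt_dickman ht).hasDerivWithinAt
    · exact div_nonpos_of_nonpos_of_nonneg (neg_nonpos.mpr (dickman_pos _).le)
        (zero_le_one.trans (le_of_lt ht))
  have hmax (t : ℝ) : dickman (max 1 t) = dickman t := by
    rcases le_total t 1 with h | h
    · rw [max_eq_left h, dickman_of_le_one le_rfl, dickman_of_le_one h]
    · rw [max_eq_right h]
  intro s t hst
  rw [← hmax s, ← hmax t]
  exact hanti (mem_Ici.mpr (le_max_left _ _)) (mem_Ici.mpr (le_max_left _ _))
    (max_le_max_left 1 hst)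

lemma dickman_le_one (t : ℝ) : dickman t ≤ 1 := by
  rw [← dickman_of_le_one (min_le_right t 1)]
  exact antitone_dickman (min_le_left t 1)

lemma integral_dickman_le {s t : ℝ} (hst : s ≤ t) :
    ∫ v in s..t, dickman v ≤ (t - s) * dickman s := by
  calc ∫ v in s..t, dickman v ≤ ∫ _ in s..t, dickman s :=
        intervalIntegral.integral_mono_on hst (continuous_dickman.intervalIntegrable _ _)
          (by simp) fun v hv => antitone_dickman hv.1
    _ = (t - s) * dickman s := by simp

lemma mul_dickman_le {t : ℝ} (ht : 1 ≤ t) : t * dickman t ≤ dickman (t - 1) := by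
  simpa [mul_dickman_eq_integral ht] using integral_dickman_le (sub_le_self t zero_le_one)

lemma exists_dickman_mul_exp_le (A : ℝ) : ∃ C, ∀ t ≥ 0, dickman t * Real.exp (A * t) ≤ C := by
  set T := Real.exp |A|
  have hT₁ : 1 ≤ T := Real.one_le_exp (abs_nonneg A)
  have hstep {t : ℝ} (ht : T ≤ t) :
      dickman t * Real.exp (A * t) ≤ dickman (t - 1) * Real.exp (A * (t - 1)) := by
    calc dickman t * Real.exp (A * t)
        = Real.exp A * dickman t * Real.exp (A * (t - 1)) := by
          rw [mul_sub_one, Real.exp_sub]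
          field_simp
      _ ≤ dickman (t - 1) * Real.exp (A * (t - 1)) := by
          have hA : Real.exp A ≤ t := (Real.exp_le_exp.mpr (le_abs_self A)).trans ht
          gcongr
          exact (mul_le_mul_of_nonneg_right hA (dickman_pos t).le).trans
            (mul_dickman_le (hT₁.trans ht))
  have hbound (n : ℕ) : ∀ t ≥ 0, t ≤ T + n → dickman t * Real.exp (A * t) ≤ Real.exp (|A| * T) := by
    induction n with
    | zero =>
      intro t ht htT
      rw [Nat.cast_zero, add_zero] at htT
      refine (mul_le_of_le_one_left (Real.exp_pos _).le (dickman_le_one t)).trans ?_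
      gcongr
      exact le_abs_self A
    | succ n ih =>
      intro t ht htn
      push_cast at htn
      rcases le_total t T with h | h
      · exact ih t ht (h.trans (le_add_of_nonneg_right n.cast_nonneg))
      · exact (hstep h).trans (ih (t - 1) (by linarith) (by linarith))
  refine ⟨Real.exp (|A| * T), fun t ht => ?_⟩
  obtain ⟨n, hn⟩ := exists_nat_ge (t - T)
  exact hbound n t ht (by linarith)

/-- The Laplace transform `∫_0^∞ ρ(v) e ^ (s v) dv` of the Dickman function. -/
noncomputable def dickmanLaplace (s : ℝ) : ℝ := ∫ v in Ioi (0 : ℝ), dickman v * Real.exp (s * v)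

lemma integrableOn_dickman_mul_exp (s : ℝ) :
    IntegrableOn (fun v => dickman v * Real.exp (s * v)) (Ioi 0) := by
  obtain ⟨C, hC⟩ := exists_dickman_mul_exp_le (s + 1)
  refine integrableOn_mul_exp_of_abs_le continuous_dickman.measurable (C := C) (K := -(s + 1))
    (fun t ht => ?_) (by linarith)
  rw [abs_of_pos (dickman_pos t), neg_mul, Real.exp_neg, ← div_eq_mul_inv,
    le_div_iff₀ (Real.exp_pos _)]
  exact hC t (le_of_lt ht)

lemma dickmanLaplace_pos (s : ℝ) : 0 < dickmanLaplace s := by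
  have hsupp : (Function.support fun v => dickman v * Real.exp (s * v)) = univ :=
    eq_univ_of_forall fun v => (mul_pos (dickman_pos v) (Real.exp_pos _)).ne'
  rw [dickmanLaplace, setIntegral_pos_iff_support_of_nonneg_ae
    (ae_of_all _ fun v => (mul_pos (dickman_pos v) (Real.exp_pos _)).le)
    (integrableOn_dickman_mul_exp s), hsupp, univ_inter]
  simp

lemma hasDerivAt_dickmanLaplace (s : ℝ) :
    HasDerivAt dickmanLaplace (∫ v in Ioi (0 : ℝ), v * (dickman v * Real.exp (s * v))) s := by
  have hm := continuous_dickman.measurable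
  have hmax (v : ℝ) : max (dickman v) 0 = dickman v := max_eq_left (dickman_pos v).le
  have huniv : integrableExpSet id (laplaceMeasure dickman) = univ := eq_univ_of_forall fun τ => by
    rw [mem_integrableExpSet_laplaceMeasure hm]
    simpa only [hmax] using integrableOn_dickman_mul_exp τ
  have hmgf : mgf id (laplaceMeasure dickman) = dickmanLaplace := funext fun τ => by
    simp only [mgf_laplaceMeasure hm, dickmanLaplace, hmax]
  have hderiv := hasDerivAt_mgf (X := id) (μ := laplaceMeasure dickman) (t := s)
    (by rw [huniv, interior_univ]; trivial)
  rw [hmgf, laplaceMeasure, integral_withDensity_eq_integral_toReal_smul (by fun_prop)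
    (ae_of_all _ fun _ => ENNReal.ofReal_lt_top)] at hderiv
  refine hderiv.congr_deriv (integral_congr_ae (ae_of_all _ fun v => ?_))
  simp only [ENNReal.toReal_ofReal', hmax, smul_eq_mul, id]
  ring

-- The kernel `e ^ (s r)` on `[0, 1)` turns the convolution into the integral over `(v - 1, v]` of
-- the delay equation.
lemma integral_mul_dickman_mul_exp (s : ℝ) :
    ∫ v in Ioi (0 : ℝ), v * (dickman v * Real.exp (s * v)) = dickmanLaplace s * expQuot s := by
  set f : ℝ → ℝ := (Ioi 0).indicator fun v => dickman v * Real.exp (s * v) with hf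
  set g : ℝ → ℝ := (Ico 0 1).indicator fun r => Real.exp (r * s) with hg
  have hf_int : Integrable f := (integrableOn_dickman_mul_exp s).integrable_indicator
    measurableSet_Ioi
  have hg_int : Integrable g := ((Continuous.integrableOn_Icc (by fun_prop)).mono_set
    Ico_subset_Icc_self).integrable_indicator measurableSet_Ico
  have hprod (v r : ℝ) : f r * g (v - r)
      = (Ioc (max 0 (v - 1)) v).indicator (fun r => dickman r * Real.exp (s * v)) r := by
    have hmem : r ∈ Ioc (max 0 (v - 1)) v ↔ r ∈ Ioi 0 ∧ v - r ∈ Ico 0 1 := by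
      simp only [mem_Ioc, max_lt_iff, mem_Ioi, mem_Ico, sub_nonneg, sub_lt_comm]
      tauto
    by_cases hr : r ∈ Ioc (max 0 (v - 1)) v
    · rw [indicator_of_mem hr, hf, hg, indicator_of_mem (hmem.mp hr).1,
        indicator_of_mem (hmem.mp hr).2, mul_assoc, ← Real.exp_add]
      ring_nf
    · rw [indicator_of_notMem hr, hf, hg]
      rcases not_and_or.mp (mt hmem.mpr hr) with h | h
      · rw [indicator_of_notMem h, zero_mul]
      · rw [indicator_of_notMem h, mul_zero]
  have hconv (v : ℝ) : ∫ r, f r * g (v - r)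
      = (Ioi 0).indicator (fun v => v * (dickman v * Real.exp (s * v))) v := by
    simp only [hprod]
    rw [integral_indicator measurableSet_Ioc, integral_mul_const]
    rcases le_or_gt v 0 with hv | hv
    · rw [indicator_of_notMem (notMem_Ioi.mpr hv),
        Ioc_eq_empty (not_lt.mpr (le_max_of_le_left hv)),
        setIntegral_empty, zero_mul]
    · rw [indicator_of_mem (mem_Ioi.mpr hv),
        ← intervalIntegral.integral_of_le (max_le hv.le (by linarith)),
        ← mul_dickman_eq_integral_max, mul_assoc]
  have hg_eq : ∫ r, g r = expQuot s := by
    rw [hg, integral_indicator measurableSet_Ico, expQuot,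
      intervalIntegral.integral_of_le zero_le_one, integral_Ico_eq_integral_Ioc]
  have hmain := integral_convolution (ContinuousLinearMap.mul ℝ ℝ) hf_int hg_int
  simp only [convolution, ContinuousLinearMap.mul_apply', hconv, hg_eq] at hmain
  rwa [hf, integral_indicator measurableSet_Ioi, integral_indicator measurableSet_Ioi] at hmain

lemma dickmanLaplace_eq (s : ℝ) :
    dickmanLaplace s = dickmanLaplace 0 * Real.exp (expQuotInt s) := by
  have hderiv (t : ℝ) :
      HasDerivAt (fun t => dickmanLaplace t * Real.exp (-expQuotInt t)) 0 t := by
    refine ((hasDerivAt_dickmanLaplace t).mul (hasDerivAt_expQuotInt t).neg.exp).congr_deriv ?_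
    rw [integral_mul_dickman_mul_exp, Pi.neg_apply]
    ring
  have hconst := is_const_of_deriv_eq_zero (fun t => (hderiv t).differentiableAt)
    (fun t => (hderiv t).deriv) s 0
  rw [expQuotInt_zero, neg_zero, Real.exp_zero, mul_one] at hconst
  rw [← hconst, mul_assoc, ← Real.exp_add, neg_add_cancel, Real.exp_zero, mul_one]

end Dickman

section DickmanBounds

open MeasureTheory Set

lemma dickman_mul_exp_pos (s v : ℝ) : 0 < dickman v * Real.exp (s * v) :=
  mul_pos (dickman_pos v) (Real.exp_pos _)

lemma setIntegral_dickman_mul_exp_le_dickmanLaplace (s : ℝ) {S : Set ℝ} (hS : S ⊆ Ioi 0) :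
    ∫ v in S, dickman v * Real.exp (s * v) ≤ dickmanLaplace s :=
  setIntegral_mono_set (integrableOn_dickman_mul_exp s)
    (ae_of_all _ fun v => (dickman_mul_exp_pos s v).le) hS.eventuallyLE

lemma dickman_mul_exp_le {u s : ℝ} (hu : 1 ≤ u) (hs : 0 ≤ s) :
    dickman u * Real.exp (s * (u - 1)) ≤ dickmanLaplace s := by
  have hsub : Ioc (u - 1) u ⊆ Ioi (0 : ℝ) := fun v hv => (sub_nonneg.mpr hu).trans_lt hv.1
  calc dickman u * Real.exp (s * (u - 1))
      = ∫ _ in Ioc (u - 1) u, dickman u * Real.exp (s * (u - 1)) := by simp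
    _ ≤ ∫ v in Ioc (u - 1) u, dickman v * Real.exp (s * v) := by
        refine setIntegral_mono_on (continuous_const.integrableOn_Icc.mono_set Ioc_subset_Icc_self)
          ((integrableOn_dickman_mul_exp s).mono_set hsub) measurableSet_Ioc fun v hv => ?_
        exact mul_le_mul (antitone_dickman hv.2)
          (Real.exp_le_exp.mpr (mul_le_mul_of_nonneg_left hv.1.le hs)) (Real.exp_pos _).le
          (dickman_pos v).le
    _ ≤ dickmanLaplace s := setIntegral_dickman_mul_exp_le_dickmanLaplace s hsub

lemma integral_dickman_mul_exp_le {s v K : ℝ}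
    (hK : ∀ w ∈ Icc (v - 1) (v - 1 / 2), dickman w * Real.exp (s * w) ≤ K) :
    (∫ w in (v - 1)..(v - 1 / 2), dickman w) * Real.exp (s * v) ≤ expQuot s * K := by
  have hK₀ : 0 ≤ K := (dickman_mul_exp_pos s _).le.trans (hK (v - 1) ⟨le_rfl, by linarith⟩)
  rw [← intervalIntegral.integral_mul_const]
  calc ∫ w in (v - 1)..(v - 1 / 2), dickman w * Real.exp (s * v)
      ≤ ∫ w in (v - 1)..(v - 1 / 2), K * Real.exp ((v - w) * s) := by
        refine intervalIntegral.integral_mono_on (by linarith)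
          ((continuous_dickman.intervalIntegrable _ _).mul_const _)
          (Continuous.intervalIntegrable (by fun_prop) _ _) fun w hw => ?_
        rw [show s * v = s * w + (v - w) * s by ring, Real.exp_add, ← mul_assoc]
        exact mul_le_mul_of_nonneg_right (hK w hw) (Real.exp_pos _).le
    _ = K * ∫ r in (1 / 2)..1, Real.exp (r * s) := by
        rw [intervalIntegral.integral_const_mul, intervalIntegral.integral_comp_sub_left
          (fun r => Real.exp (r * s)) v]
        congr 2 <;> ring
    _ ≤ K * expQuot s := by
        refine mul_le_mul_of_nonneg_left ?_ hK₀
        exact intervalIntegral.integral_mono_interval (by norm_num) (by norm_num) le_rfl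
          (ae_of_all _ fun r => (Real.exp_pos _).le)
          (Continuous.intervalIntegrable (by fun_prop) _ _)
    _ = expQuot s * K := mul_comm _ _

lemma mul_dickman_mul_exp_le {s v K : ℝ} (hv : 1 ≤ v)
    (hK : ∀ w ∈ Icc (v - 1) (v - 1 / 2), dickman w * Real.exp (s * w) ≤ K) :
    v * (dickman v * Real.exp (s * v)) ≤ (expQuot s + Real.exp (s / 2)) * K := by
  have hsplit : v * dickman v = (∫ w in (v - 1)..(v - 1 / 2), dickman w)
      + ∫ w in (v - 1 / 2)..v, dickman w := by
    rw [mul_dickman_eq_integral hv, intervalIntegral.integral_add_adjacent_intervals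
      (continuous_dickman.intervalIntegrable _ _) (continuous_dickman.intervalIntegrable _ _)]
  have hright : (∫ w in (v - 1 / 2)..v, dickman w) * Real.exp (s * v)
      ≤ Real.exp (s / 2) * K := by
    calc (∫ w in (v - 1 / 2)..v, dickman w) * Real.exp (s * v)
        ≤ dickman (v - 1 / 2) * Real.exp (s * v) := by
          refine mul_le_mul_of_nonneg_right ?_ (Real.exp_pos _).le
          refine (integral_dickman_le (by linarith)).trans
            (mul_le_of_le_one_left (dickman_pos _).le (by linarith))
      _ = Real.exp (s / 2) * (dickman (v - 1 / 2) * Real.exp (s * (v - 1 / 2))) := by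
          rw [show s * v = s / 2 + s * (v - 1 / 2) by ring, Real.exp_add]
          ring
      _ ≤ Real.exp (s / 2) * K :=
          mul_le_mul_of_nonneg_left (hK _ ⟨by linarith, le_rfl⟩) (Real.exp_pos _).le
  rw [← mul_assoc, hsplit, add_mul, add_mul]
  exact add_le_add (integral_dickman_mul_exp_le hK) hright

-- Iterating the delay equation, each half unit to the right of `u` costs a factor close to `1`.
lemma dickman_mul_exp_le_pow {s u : ℝ} (hs : 0 ≤ s) (hu : 1 ≤ u) (hus : u ≤ expQuot s) (j : ℕ) :
    ∀ v ≥ u, v ≤ u + 1 + j / 2 → dickman v * Real.exp (s * v)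
      ≤ ((expQuot s + Real.exp (s / 2)) / u) ^ j * (dickman u * Real.exp (s * (u + 1))) := by
  have hu₀ : 0 < u := zero_lt_one.trans_le hu
  set q := (expQuot s + Real.exp (s / 2)) / u with hq
  set K := dickman u * Real.exp (s * (u + 1))
  have hK : 0 ≤ K := (mul_pos (dickman_pos u) (Real.exp_pos _)).le
  induction j with
  | zero =>
    intro v hv hvj
    rw [Nat.cast_zero, zero_div, add_zero] at hvj
    rw [pow_zero, one_mul]
    exact mul_le_mul (antitone_dickman hv)
      (Real.exp_le_exp.mpr (mul_le_mul_of_nonneg_left hvj hs)) (Real.exp_pos _).le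
      (dickman_pos u).le
  | succ j ih =>
    intro v hv hvj
    push_cast at hvj
    rcases le_total v (u + 1 + j / 2) with h | h
    · have hq₁ : 1 ≤ q := (one_le_div hu₀).mpr (by linarith [Real.exp_pos (s / 2)])
      exact (ih v hv h).trans
        (mul_le_mul_of_nonneg_right (pow_le_pow_right₀ hq₁ (Nat.le_succ j)) hK)
    · have hj : (0 : ℝ) ≤ j / 2 := by positivity
      have hstep := mul_dickman_mul_exp_le (hu.trans hv) (s := s) (K := q ^ j * K)
        fun w hw => ih w (by linarith [hw.1]) (by linarith [hw.2])
      calc dickman v * Real.exp (s * v)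
          ≤ (expQuot s + Real.exp (s / 2)) * (q ^ j * K) / u := by
            rw [le_div_iff₀ hu₀, mul_comm]
            exact (mul_le_mul_of_nonneg_right hv (dickman_mul_exp_pos s v).le).trans hstep
        _ = q ^ (j + 1) * K := by
            rw [pow_succ, hq]
            ring

lemma setIntegral_dickman_mul_exp_le {s t c : ℝ} {S : Set ℝ} (hS : MeasurableSet S)
    (hS₀ : S ⊆ Ioi 0) (hc : ∀ v ∈ S, (s - t) * v ≤ c) :
    ∫ v in S, dickman v * Real.exp (s * v) ≤ Real.exp c * dickmanLaplace t := by
  calc ∫ v in S, dickman v * Real.exp (s * v)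
      ≤ ∫ v in S, Real.exp c * (dickman v * Real.exp (t * v)) := by
        refine setIntegral_mono_on ((integrableOn_dickman_mul_exp s).mono_set hS₀)
          (((integrableOn_dickman_mul_exp t).mono_set hS₀).const_mul _) hS fun v hv => ?_
        rw [show s * v = (s - t) * v + t * v by ring, Real.exp_add, mul_left_comm]
        exact mul_le_mul_of_nonneg_right (Real.exp_le_exp.mpr (hc v hv))
          (dickman_mul_exp_pos t v).le
    _ ≤ Real.exp c * dickmanLaplace t := by
        rw [integral_const_mul]
        exact mul_le_mul_of_nonneg_left (setIntegral_dickman_mul_exp_le_dickmanLaplace t hS₀)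
          (Real.exp_pos c).le

lemma four_le_exp_two : (4 : ℝ) ≤ Real.exp 2 := by
  rw [show (2 : ℝ) = 1 + 1 by norm_num, Real.exp_add]
  nlinarith [Real.add_one_le_exp (1 : ℝ)]

lemma exp_mul_dickmanLaplace_le {c s t : ℝ} (h : c + expQuotInt t + 2 ≤ expQuotInt s) :
    Real.exp c * dickmanLaplace t ≤ 1 / 4 * dickmanLaplace s := by
  have hmain : 4 * Real.exp (c + expQuotInt t) ≤ Real.exp (expQuotInt s) :=
    calc 4 * Real.exp (c + expQuotInt t) ≤ Real.exp 2 * Real.exp (c + expQuotInt t) :=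
        mul_le_mul_of_nonneg_right four_le_exp_two (Real.exp_pos _).le
      _ ≤ Real.exp (expQuotInt s) := by
          rw [← Real.exp_add]
          exact Real.exp_le_exp.mpr (by linarith)
  rw [Real.exp_add] at hmain
  rw [dickmanLaplace_eq t, dickmanLaplace_eq s]
  linarith [mul_le_mul_of_nonneg_left hmain (dickmanLaplace_pos 0).le]

lemma dickmanLaplace_eq_add_add (s : ℝ) {a b : ℝ} (ha : 0 ≤ a) (hab : a ≤ b) :
    dickmanLaplace s = (∫ v in Ioc 0 a, dickman v * Real.exp (s * v))
      + (∫ v in Ioc a b, dickman v * Real.exp (s * v))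
      + ∫ v in Ioi b, dickman v * Real.exp (s * v) := by
  have h_int := integrableOn_dickman_mul_exp s
  rw [dickmanLaplace, ← Ioc_union_Ioi_eq_Ioi (ha.trans hab), setIntegral_union
    Ioc_disjoint_Ioi_same measurableSet_Ioi (h_int.mono_set Ioc_subset_Ioi_self)
    (h_int.mono_set (Ioi_subset_Ioi (ha.trans hab))), ← Ioc_union_Ioc_eq_Ioc ha hab,
    setIntegral_union (Ioc_disjoint_Ioc_of_le le_rfl) measurableSet_Ioc
    (h_int.mono_set Ioc_subset_Ioi_self)
    (h_int.mono_set (Ioc_subset_Ioi_self.trans (Ioi_subset_Ioi ha)))]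

lemma dickmanLaplace_add_le_setIntegral {s δ V : ℝ} (hδ : 0 < δ)
    (hleft : 2 ≤ δ / 2 * (expQuot (s + δ / 2) - expQuot s))
    (hright : expQuot (s + 2 * δ) + 2 / δ ≤ V) :
    dickmanLaplace (s + δ)
      ≤ 2 * ∫ v in Ioc (expQuot s) V, dickman v * Real.exp ((s + δ) * v) := by
  have hu := (expQuot_pos s).le
  have huV : expQuot s ≤ V := by
    linarith [monotone_expQuot (show s ≤ s + 2 * δ by linarith), div_pos two_pos hδ]
  have htail_left : ∫ v in Ioc 0 (expQuot s), dickman v * Real.exp ((s + δ) * v)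
      ≤ 1 / 4 * dickmanLaplace (s + δ) := by
    refine (setIntegral_dickman_mul_exp_le (t := s + δ / 2) (c := δ / 2 * expQuot s)
      measurableSet_Ioc Ioc_subset_Ioi_self fun v hv => ?_).trans (exp_mul_dickmanLaplace_le ?_)
    · rw [show s + δ - (s + δ / 2) = δ / 2 by ring]
      exact mul_le_mul_of_nonneg_left hv.2 (by linarith)
    · linarith [mul_expQuot_le_expQuotInt_sub (s + δ / 2) (s + δ)]
  have htail_right : ∫ v in Ioi V, dickman v * Real.exp ((s + δ) * v)
      ≤ 1 / 4 * dickmanLaplace (s + δ) := by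
    refine (setIntegral_dickman_mul_exp_le (t := s + 2 * δ) (c := -(δ * V))
      measurableSet_Ioi (Ioi_subset_Ioi (hu.trans huV)) fun v hv => ?_).trans
      (exp_mul_dickmanLaplace_le ?_)
    · rw [show s + δ - (s + 2 * δ) = -δ by ring, neg_mul]
      exact neg_le_neg (mul_le_mul_of_nonneg_left (le_of_lt hv) hδ.le)
    · have hδV := mul_le_mul_of_nonneg_left hright hδ.le
      rw [mul_add, mul_div_cancel₀ _ hδ.ne'] at hδV
      linarith [mul_expQuot_le_expQuotInt_sub (s + 2 * δ) (s + δ)]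
  linarith [dickmanLaplace_eq_add_add (s + δ) hu huV]

lemma dickmanLaplace_mul_exp_le_mul_dickman {s δ : ℝ} {j : ℕ} (hs : 0 ≤ s) (hδ : 0 < δ)
    (hleft : 2 ≤ δ / 2 * (expQuot (s + δ / 2) - expQuot s))
    (hright : expQuot (s + 2 * δ) + 2 / δ ≤ expQuot s + 1 + j / 2) :
    dickmanLaplace 0 * Real.exp (expQuotInt s - expQuot s * s) ≤
      2 * ((1 + j / 2) * ((expQuot (s + δ) + Real.exp ((s + δ) / 2)) / expQuot s) ^ j
        * Real.exp (s + δ) * dickman (expQuot s)) := by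
  set u := expQuot s with hu
  set V := u + 1 + (j : ℝ) / 2 with hV
  set q := (expQuot (s + δ) + Real.exp ((s + δ) / 2)) / u
  have huV : 0 ≤ V - u := by
    rw [hV, add_assoc, add_sub_cancel_left]
    positivity
  have hmid : ∫ v in Ioc u V, dickman v * Real.exp ((s + δ) * v)
      ≤ (V - u) * (q ^ j * (dickman u * Real.exp ((s + δ) * (u + 1)))) := by
    calc ∫ v in Ioc u V, dickman v * Real.exp ((s + δ) * v)
        ≤ ∫ _ in Ioc u V, q ^ j * (dickman u * Real.exp ((s + δ) * (u + 1))) := by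
          refine setIntegral_mono_on
            ((integrableOn_dickman_mul_exp _).mono_set
              (Ioc_subset_Ioi_self.trans (Ioi_subset_Ioi (expQuot_pos s).le)))
            (continuous_const.integrableOn_Icc.mono_set Ioc_subset_Icc_self)
            measurableSet_Ioc fun v hv => ?_
          exact dickman_mul_exp_le_pow (by linarith) (one_le_expQuot hs)
            (monotone_expQuot (by linarith)) j v hv.1.le hv.2
      _ = (V - u) * (q ^ j * (dickman u * Real.exp ((s + δ) * (u + 1)))) := by
          rw [setIntegral_const, Real.volume_real_Ioc, max_eq_left huV, smul_eq_mul]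
  have htangent := mul_expQuot_le_expQuotInt_sub s (s + δ)
  rw [add_sub_cancel_left, ← hu] at htangent
  calc dickmanLaplace 0 * Real.exp (expQuotInt s - u * s)
      ≤ dickmanLaplace 0 * Real.exp (expQuotInt (s + δ) - (s + δ) * u) :=
        mul_le_mul_of_nonneg_left (Real.exp_le_exp.mpr (by linarith)) (dickmanLaplace_pos 0).le
    _ = dickmanLaplace (s + δ) * Real.exp (-((s + δ) * u)) := by
        rw [dickmanLaplace_eq (s + δ), sub_eq_add_neg, Real.exp_add, mul_assoc]
    _ ≤ 2 * ((V - u) * (q ^ j * (dickman u * Real.exp ((s + δ) * (u + 1)))))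
        * Real.exp (-((s + δ) * u)) := by
        refine mul_le_mul_of_nonneg_right ?_ (Real.exp_pos _).le
        exact (dickmanLaplace_add_le_setIntegral hδ hleft hright).trans (by linarith)
    _ = 2 * ((1 + j / 2) * q ^ j * Real.exp (s + δ) * dickman u) := by
        rw [mul_add_one, Real.exp_add, Real.exp_neg, hV]
        field_simp
        ring

lemma exp_add_le {s h : ℝ} (hh : h ≤ 1) : Real.exp (s + h) ≤ 3 * Real.exp s := by
  rw [Real.exp_add, mul_comm]
  exact mul_le_mul_of_nonneg_right
    ((Real.exp_le_exp.mpr hh).trans Real.exp_one_lt_three.le) (Real.exp_pos s).le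

lemma expQuot_add_le {s h : ℝ} (hs : 0 ≤ s) (hh₀ : 0 ≤ h) (hh₁ : h ≤ 1) :
    expQuot (s + h) ≤ expQuot s + 3 * (h * Real.exp s) := by
  linarith [expQuot_sub_le hs hh₀, mul_le_mul_of_nonneg_left (exp_add_le (s := s) hh₁) hh₀]

lemma le_expQuot_sub {s h : ℝ} (hs : 6 ≤ s) (hh₀ : 0 ≤ h) (hh₁ : h ≤ 1) :
    h * Real.exp s / (2 * s) ≤ expQuot (s + h) - expQuot s := by
  have hexp : Real.exp s * (1 + h) ≤ Real.exp (s + h) := by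
    rw [Real.exp_add]
    exact mul_le_mul_of_nonneg_left (by linarith [Real.add_one_le_exp h]) (Real.exp_pos s).le
  have hquot : expQuot (s + h) ≤ Real.exp s / 2 := by
    have hmul : 6 * expQuot (s + h) ≤ (s + h) * expQuot (s + h) :=
      mul_le_mul_of_nonneg_right (by linarith) (expQuot_pos _).le
    linarith [mul_expQuot (s + h), exp_add_le (s := s) hh₁]
  rw [div_le_iff₀ (by linarith)]
  linarith [mul_expQuot s, mul_expQuot (s + h), mul_le_mul_of_nonneg_left hquot hh₀]

lemma expQuot_add_exp_div_le {s δ : ℝ} (hs : 1 ≤ s) (hδ₀ : 0 ≤ δ) (hδ₁ : δ ≤ 1)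
    (hδs : Real.exp (s / 2) ≤ δ * Real.exp s) :
    (expQuot (s + δ) + Real.exp ((s + δ) / 2)) / expQuot s ≤ Real.exp (12 * s * δ) := by
  have hu := expQuot_pos s
  have hhalf : Real.exp ((s + δ) / 2) ≤ 3 * (δ * Real.exp s) := by
    rw [add_div]
    exact (exp_add_le (by linarith)).trans (mul_le_mul_of_nonneg_left hδs zero_le_three)
  have hexp : Real.exp s ≤ 2 * (s * expQuot s) := by
    linarith [mul_expQuot s, Real.add_one_le_exp s]
  calc (expQuot (s + δ) + Real.exp ((s + δ) / 2)) / expQuot s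
      ≤ 12 * s * δ + 1 := by
        rw [div_le_iff₀ hu]
        linarith [expQuot_add_le (zero_le_one.trans hs) hδ₀ hδ₁,
          mul_le_mul_of_nonneg_left hexp hδ₀]
    _ ≤ Real.exp (12 * s * δ) := Real.add_one_le_exp _

lemma mul_le_exp_of_ten_le {s : ℝ} (hs : 10 ≤ s) : 64 * s ≤ Real.exp s := by
  have hpow : (10 : ℝ) ^ 4 ≤ s ^ 4 := by gcongr
  have hfactorial : s ^ 5 / 120 ≤ Real.exp s := by
    simpa [Nat.factorial] using Real.pow_div_factorial_le_exp (x := s) (by linarith) 5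
  calc 64 * s ≤ 10 ^ 4 * s / 120 := by linarith
    _ ≤ s ^ 4 * s / 120 := by gcongr
    _ ≤ Real.exp s := hfactorial

-- The shift `δ` balances the tails, which need `δ ^ 2 * exp s` large compared with `s`, against
-- the loss `exp (O (s * δ ^ 2 * exp s))` of the iterated delay equation.
lemma exists_sq_mul_exp_eq {s : ℝ} (hs : 10 ≤ s) :
    ∃ δ, 0 < δ ∧ δ ≤ 1 / 2 ∧ δ ^ 2 * Real.exp s = 16 * s := by
  have hexp := Real.exp_pos s
  refine ⟨√(16 * s / Real.exp s), Real.sqrt_pos.mpr (by positivity), ?_, ?_⟩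
  · rw [Real.sqrt_le_left (by norm_num), div_le_iff₀ hexp]
    linarith [mul_le_exp_of_ten_le hs]
  · rw [Real.sq_sqrt (by positivity), div_mul_cancel₀ _ hexp.ne']

lemma mul_exp_pow_mul_exp_le {s δ : ℝ} {j : ℕ} (hs : 10 ≤ s) (hδ₀ : 0 < δ) (hδ₁ : δ ≤ 1 / 2)
    (hδ : δ ^ 2 * Real.exp s = 16 * s) (hj : j ≤ 17 * (δ * Real.exp s)) :
    2 * ((1 + j / 2) * Real.exp (12 * s * δ) ^ j * Real.exp (s + δ))
      ≤ Real.exp (3300 * s ^ 2) := by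
  have hexp := Real.exp_pos s
  have hpow : Real.exp (12 * s * δ) ^ j ≤ Real.exp (3264 * s ^ 2) := by
    rw [← Real.exp_nat_mul, Real.exp_le_exp]
    calc j * (12 * s * δ) ≤ 17 * (δ * Real.exp s) * (12 * s * δ) := by gcongr
      _ = 204 * s * (δ ^ 2 * Real.exp s) := by ring
      _ = 3264 * s ^ 2 := by rw [hδ]; ring
  have hfactor : 1 + (j : ℝ) / 2 ≤ 10 * Real.exp s := by
    linarith [mul_le_mul_of_nonneg_right hδ₁ hexp.le, mul_le_exp_of_ten_le hs]
  have hshift : Real.exp (s + δ) ≤ 3 * Real.exp s := exp_add_le (by linarith)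
  calc 2 * ((1 + j / 2) * Real.exp (12 * s * δ) ^ j * Real.exp (s + δ))
      ≤ 2 * (10 * Real.exp s * Real.exp (3264 * s ^ 2) * (3 * Real.exp s)) := by gcongr
    _ = 60 * (Real.exp s * Real.exp s * Real.exp (3264 * s ^ 2)) := by ring
    _ ≤ Real.exp s * (Real.exp s * Real.exp s * Real.exp (3264 * s ^ 2)) := by
        gcongr
        linarith [mul_le_exp_of_ten_le hs]
    _ = Real.exp (s + (s + s + 3264 * s ^ 2)) := by simp only [Real.exp_add]
    _ ≤ Real.exp (3300 * s ^ 2) := Real.exp_le_exp.mpr (by nlinarith)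

lemma dickmanLaplace_mul_exp_le_dickman {s : ℝ} (hs : 10 ≤ s) :
    dickmanLaplace 0 * Real.exp (expQuotInt s - expQuot s * s)
      ≤ Real.exp (3300 * s ^ 2) * dickman (expQuot s) := by
  obtain ⟨δ, hδ₀, hδ₁, hδ⟩ := exists_sq_mul_exp_eq hs
  have hinv : 1 / δ ≤ δ * Real.exp s := by
    rw [div_le_iff₀ hδ₀]
    linarith
  have hone : 1 ≤ 1 / δ := by
    rw [le_div_iff₀ hδ₀]
    linarith
  have hhalf : Real.exp (s / 2) ≤ δ * Real.exp s := by
    refine le_of_sq_le_sq ?_ (by positivity)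
    rw [← Real.exp_nat_mul, mul_pow, sq (Real.exp s), ← mul_assoc, hδ]
    push_cast
    rw [mul_div_cancel₀ s two_ne_zero]
    exact le_mul_of_one_le_left (Real.exp_pos s).le (by linarith)
  have hleft : 2 ≤ δ / 2 * (expQuot (s + δ / 2) - expQuot s) := by
    calc 2 = δ / 2 * (δ / 2 * Real.exp s / (2 * s)) := by
          field_simp
          linarith
      _ ≤ _ := by
          gcongr
          exact le_expQuot_sub (by linarith) (by linarith) (by linarith)
  have hceil := Nat.ceil_lt_add_one (show 0 ≤ 16 * (δ * Real.exp s) by positivity)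
  have hright : expQuot (s + 2 * δ) + 2 / δ
      ≤ expQuot s + 1 + (⌈16 * (δ * Real.exp s)⌉₊ : ℝ) / 2 := by
    rw [show 2 / δ = 2 * (1 / δ) by ring]
    linarith [expQuot_add_le (s := s) (h := 2 * δ) (by linarith) (by linarith) (by linarith),
      Nat.le_ceil (16 * (δ * Real.exp s))]
  refine (dickmanLaplace_mul_exp_le_mul_dickman (by linarith) hδ₀ hleft hright).trans ?_
  rw [← mul_assoc]
  refine mul_le_mul_of_nonneg_right ?_ (dickman_pos _).le
  have hratio := expQuot_add_exp_div_le (by linarith) hδ₀.le (by linarith) hhalf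
  have hratio₀ : 0 ≤ (expQuot (s + δ) + Real.exp ((s + δ) / 2)) / expQuot s :=
    div_nonneg (by linarith [expQuot_pos (s + δ), Real.exp_pos ((s + δ) / 2)]) (expQuot_pos s).le
  refine le_trans ?_ (mul_exp_pow_mul_exp_le hs hδ₀ hδ₁ hδ (by linarith))
  gcongr

theorem eventually_exp_le_dickman {η : ℝ} (hη : 0 < η) : ∀ᶠ s in atTop,
    Real.exp (expQuotInt s - expQuot s * s - Real.exp (η * s)) ≤ dickman (expQuot s) := by
  have hL := dickmanLaplace_pos 0
  filter_upwards [eventually_ge_atTop 10, eventually_ge_atTop (-Real.log (dickmanLaplace 0)),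
    (isLittleO_pow_exp_pos_mul_atTop 2 hη).bound (show (0 : ℝ) < 1 / 3301 by norm_num)]
    with s hs hlog hpow
  rw [Real.norm_of_nonneg (sq_nonneg s), Real.norm_of_nonneg (Real.exp_pos _).le] at hpow
  have hbound : 3300 * s ^ 2 - Real.log (dickmanLaplace 0) ≤ Real.exp (η * s) := by
    have hs_sq : s ≤ s ^ 2 := le_self_pow₀ (by linarith) two_ne_zero
    linarith
  calc Real.exp (expQuotInt s - expQuot s * s - Real.exp (η * s))
      ≤ Real.exp (-(3300 * s ^ 2) + (Real.log (dickmanLaplace 0)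
          + (expQuotInt s - expQuot s * s))) := Real.exp_le_exp.mpr (by linarith)
    _ = Real.exp (-(3300 * s ^ 2))
          * (dickmanLaplace 0 * Real.exp (expQuotInt s - expQuot s * s)) := by
        rw [Real.exp_add, Real.exp_add, Real.exp_log hL]
    _ ≤ dickman (expQuot s) := by
        rw [Real.exp_neg, inv_mul_le_iff₀ (Real.exp_pos _)]
        exact dickmanLaplace_mul_exp_le_dickman hs

end DickmanBounds

section PartialZeta

open Set

/-- The finite set of primes `p ≤ y`, over which `partialZeta` is a product. -/
noncomputable def primesUpTo (y : ℝ) : Finset ℕ := Nat.primesBelow (⌊y⌋₊ + 1)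

/-- The logarithm `log ζ(s, y)` of the partial zeta function, as a sum over primes. -/
noncomputable def logPartialZeta (s y : ℝ) : ℝ :=
  ∑ p ∈ primesUpTo y, -Real.log (1 - (p : ℝ) ^ (-s))

/-- The negative logarithmic derivative `-(ζ'/ζ)(s, y)` of the partial zeta function: the mean of
`log n` over `y`-friable integers `n` weighted by `n ^ (-s)`. -/
noncomputable def meanLog (s y : ℝ) : ℝ :=
  ∑ p ∈ primesUpTo y, Real.log p / ((p : ℝ) ^ s - 1)

lemma mem_primesUpTo {y : ℝ} {p : ℕ} (hy : 0 ≤ y) : p ∈ primesUpTo y ↔ p.Prime ∧ (p : ℝ) ≤ y := by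
  rw [primesUpTo, Nat.mem_primesBelow, Nat.lt_succ_iff, Nat.le_floor_iff hy, and_comm]

lemma prime_of_mem_primesUpTo {y : ℝ} {p : ℕ} (hp : p ∈ primesUpTo y) : p.Prime :=
  (Nat.mem_primesBelow.mp hp).2

lemma one_lt_prime_rpow {p : ℕ} (hp : p.Prime) {s : ℝ} (hs : 0 < s) : 1 < (p : ℝ) ^ s :=
  Real.one_lt_rpow (Nat.one_lt_cast.mpr hp.one_lt) hs

lemma prime_rpow_neg_lt_one {p : ℕ} (hp : p.Prime) {s : ℝ} (hs : 0 < s) : (p : ℝ) ^ (-s) < 1 :=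
  Real.rpow_lt_one_of_one_lt_of_neg (Nat.one_lt_cast.mpr hp.one_lt) (neg_lt_zero.mpr hs)

lemma partialZeta_eq_exp {s : ℝ} (hs : 0 < s) (y : ℝ) :
    partialZeta s y = Real.exp (logPartialZeta s y) := by
  rw [partialZeta, logPartialZeta, Real.exp_sum, primesUpTo]
  refine Finset.prod_congr rfl fun p hp => ?_
  rw [Real.exp_neg,
    Real.exp_log (sub_pos.mpr (prime_rpow_neg_lt_one (Nat.mem_primesBelow.mp hp).2 hs))]

lemma rpow_mul_partialZeta {s v : ℝ} (hs : 0 < s) (hv : 0 < v) (c y : ℝ) :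
    v ^ c * partialZeta s y = Real.exp (c * Real.log v + logPartialZeta s y) := by
  rw [partialZeta_eq_exp hs, Real.rpow_def_of_pos hv, ← Real.exp_add, mul_comm c]

lemma log_one_sub_rpow_neg_sub_le {n s t : ℝ} (hn : 1 < n) (hs : 0 < s) (ht : 0 < t) :
    Real.log (1 - n ^ (-t)) - Real.log (1 - n ^ (-s)) ≤ (t - s) * (Real.log n / (n ^ s - 1)) := by
  have hn₀ : 0 < n := zero_lt_one.trans hn
  have hs₁ : 0 < 1 - n ^ (-s) := sub_pos.mpr (Real.rpow_lt_one_of_one_lt_of_neg hn (by linarith))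
  have ht₁ : 0 < 1 - n ^ (-t) := sub_pos.mpr (Real.rpow_lt_one_of_one_lt_of_neg hn (by linarith))
  have hs₂ : 0 < n ^ s - 1 := sub_pos.mpr (Real.one_lt_rpow hn hs)
  have hmul : n ^ s * n ^ (-s) = 1 := by
    rw [← Real.rpow_add hn₀, add_neg_cancel, Real.rpow_zero]
  have hts : n ^ (-t) = n ^ (-s) * n ^ (-(t - s)) := by
    rw [← Real.rpow_add hn₀]
    ring_nf
  have hratio : (1 - n ^ (-t)) / (1 - n ^ (-s)) - 1 = (1 - n ^ (-(t - s))) / (n ^ s - 1) := by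
    rw [hts]
    field_simp
    linear_combination (1 - n ^ (-(t - s))) * hmul
  have hexp : 1 - n ^ (-(t - s)) ≤ (t - s) * Real.log n := by
    rw [Real.rpow_def_of_pos hn₀]
    linarith [Real.add_one_le_exp (Real.log n * -(t - s))]
  calc Real.log (1 - n ^ (-t)) - Real.log (1 - n ^ (-s))
      ≤ (1 - n ^ (-t)) / (1 - n ^ (-s)) - 1 := by
        rw [← Real.log_div ht₁.ne' hs₁.ne']
        exact Real.log_le_sub_one_of_pos (div_pos ht₁ hs₁)
    _ = (1 - n ^ (-(t - s))) / (n ^ s - 1) := hratio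
    _ ≤ (t - s) * Real.log n / (n ^ s - 1) := by gcongr
    _ = (t - s) * (Real.log n / (n ^ s - 1)) := mul_div_assoc _ _ _

-- Convexity of `log ζ(s, y)` in `s`.
lemma logPartialZeta_sub_le {s t : ℝ} (hs : 0 < s) (ht : 0 < t) (y : ℝ) :
    logPartialZeta s y - logPartialZeta t y ≤ (t - s) * meanLog s y := by
  rw [logPartialZeta, logPartialZeta, meanLog, ← Finset.sum_sub_distrib, Finset.mul_sum]
  refine Finset.sum_le_sum fun p hp => ?_
  rw [neg_sub_neg]
  exact log_one_sub_rpow_neg_sub_le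
    (Nat.one_lt_cast.mpr (prime_of_mem_primesUpTo hp).one_lt) hs ht

lemma continuousAt_meanLog {s : ℝ} (hs : 0 < s) (y : ℝ) :
    ContinuousAt (fun s => meanLog s y) s := by
  unfold meanLog
  refine tendsto_finsetSum _ fun p hp => ?_
  have hp' := prime_of_mem_primesUpTo hp
  exact continuousAt_const.div
    ((Real.continuousAt_const_rpow (Nat.cast_ne_zero.mpr hp'.ne_zero)).sub continuousAt_const)
    (sub_pos.mpr (one_lt_prime_rpow hp' hs)).ne'

theorem isSaddlePoint_iff {x y a : ℝ} (hx : 0 < x) (ha : 0 < a) :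
    IsSaddlePoint x y a ↔ Real.log x = meanLog a y := by
  have hmin : IsSaddlePoint x y a ↔ ∀ t > 0, a * Real.log x + logPartialZeta a y
      ≤ t * Real.log x + logPartialZeta t y := by
    simp only [IsSaddlePoint, ha, true_and, isMinOn_iff, mem_Ioi]
    refine forall₂_congr fun t ht => ?_
    rw [mul_comm, mul_comm (partialZeta t y), rpow_mul_partialZeta ha hx,
      rpow_mul_partialZeta ht hx, Real.exp_le_exp]
  rw [hmin]
  constructor
  · intro h
    have hcont := continuousAt_meanLog ha y
    have hslope (t : ℝ) (ht : 0 < t) : (a - t) * Real.log x ≤ (a - t) * meanLog t y := by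
      linarith [h t ht, logPartialZeta_sub_le ht ha y]
    apply le_antisymm
    · refine ge_of_tendsto (hcont.mono_left (nhdsWithin_le_nhds (s := Iio a))) ?_
      filter_upwards [self_mem_nhdsWithin, nhdsWithin_le_nhds (Ioi_mem_nhds ha)] with t ht ht₀
      exact le_of_mul_le_mul_left (hslope t ht₀) (sub_pos.mpr ht)
    · refine le_of_tendsto (hcont.mono_left (nhdsWithin_le_nhds (s := Ioi a))) ?_
      filter_upwards [self_mem_nhdsWithin, nhdsWithin_le_nhds (Ioi_mem_nhds ha)] with t ht ht₀
      exact (mul_le_mul_left_of_neg (sub_neg.mpr ht)).mp (hslope t ht₀)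
  · intro h t ht
    rw [h]
    linarith [logPartialZeta_sub_le ha ht y]

theorem existsUnique_isSaddlePoint {a : ℝ} (ha : 0 < a) (y : ℝ) :
    ∃! x, 0 < x ∧ IsSaddlePoint x y a := by
  refine ⟨Real.exp (meanLog a y), ⟨Real.exp_pos _, ?_⟩, fun x ⟨hx, hsaddle⟩ => ?_⟩
  · rw [isSaddlePoint_iff (Real.exp_pos _) ha, Real.log_exp]
  · rw [← (isSaddlePoint_iff hx ha).mp hsaddle, Real.exp_log hx]

end PartialZeta

section Friable

open Set

/-- The map `n ↦ n ^ (-s)` as a monoid homomorphism, the form in which the Euler product of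
`partialZeta` takes it. -/
noncomputable def rpowNegHom (s : ℝ) : ℕ →* ℝ where
  toFun n := (n : ℝ) ^ (-s)
  map_one' := by simp
  map_mul' m n := by rw [Nat.cast_mul, Real.mul_rpow m.cast_nonneg n.cast_nonneg]

/-- The finite set of `y`-friable integers in `(z, x]`. -/
noncomputable def friableWindow (z x y : ℝ) : Finset ℕ :=
  (Nat.smoothNumbersUpTo ⌊x⌋₊ (⌊y⌋₊ + 1)).filter fun n : ℕ => z < n

/-- The sum of `n ^ (-s)` over the `y`-friable integers `n` in `(z, x]`, the part of the Dirichlet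
series of `partialZeta s y` carried by this window. -/
noncomputable def windowSum (s z x y : ℝ) : ℝ :=
  ∑ n ∈ friableWindow z x y, (n : ℝ) ^ (-s)

lemma natCast_pos_of_mem_smoothNumbers {N n : ℕ} (hn : n ∈ Nat.smoothNumbers N) : (0 : ℝ) < n :=
  Nat.cast_pos.mpr (Nat.pos_of_ne_zero (Nat.ne_zero_of_mem_smoothNumbers hn))

lemma mem_friableWindow {z x y : ℝ} (hx : 0 ≤ x) {n : ℕ} : n ∈ friableWindow z x y ↔
    n ∈ Nat.smoothNumbers (⌊y⌋₊ + 1) ∧ z < n ∧ (n : ℝ) ≤ x := by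
  rw [friableWindow, Finset.mem_filter, Nat.mem_smoothNumbersUpTo, Nat.le_floor_iff hx]
  tauto

theorem hasSum_partialZeta {s : ℝ} (hs : 0 < s) (y : ℝ) :
    HasSum (indicator (Nat.smoothNumbers (⌊y⌋₊ + 1)) fun n : ℕ => (n : ℝ) ^ (-s))
      (partialZeta s y) := by
  have hEuler := (EulerProduct.summable_and_hasSum_smoothNumbers_prod_primesBelow_geometric
    (f := rpowNegHom s) (fun {p} hp => by
      simpa only [rpowNegHom, MonoidHom.coe_mk, OneHom.coe_mk,
        Real.norm_of_nonneg (Real.rpow_nonneg p.cast_nonneg (-s))]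
        using prime_rpow_neg_lt_one hp hs) (⌊y⌋₊ + 1)).2
  rw [← hasSum_subtype_iff_indicator]
  exact hEuler

theorem friableCount_pos {x : ℝ} (hx : 1 ≤ x) (y : ℝ) : 0 < friableCount x y :=
  Finset.card_pos.mpr ⟨1, Nat.mem_smoothNumbersUpTo.mpr
    ⟨Nat.le_floor (by rwa [Nat.cast_one]), by simp [Nat.mem_smoothNumbers]⟩⟩

-- Rankin's bound.
theorem friableCount_le {s x : ℝ} (hs : 0 < s) (hx : 0 < x) (y : ℝ) :
    (friableCount x y : ℝ) ≤ x ^ s * partialZeta s y := by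
  have hcount : (friableCount x y : ℝ) * x ^ (-s)
      ≤ ∑ n ∈ Nat.smoothNumbersUpTo ⌊x⌋₊ (⌊y⌋₊ + 1),
        indicator (Nat.smoothNumbers (⌊y⌋₊ + 1)) (fun n : ℕ => (n : ℝ) ^ (-s)) n := by
    rw [friableCount, ← nsmul_eq_mul]
    refine Finset.card_nsmul_le_sum _ _ _ fun n hn => ?_
    rw [Nat.mem_smoothNumbersUpTo, Nat.le_floor_iff hx.le] at hn
    rw [indicator_of_mem hn.2]
    exact Real.rpow_le_rpow_of_nonpos (natCast_pos_of_mem_smoothNumbers hn.2) hn.1 (by linarith)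
  have hsum := hcount.trans (sum_le_hasSum _
    (fun n _ => indicator_nonneg (fun n _ => Real.rpow_nonneg n.cast_nonneg (-s)) n)
    (hasSum_partialZeta hs y))
  rwa [Real.rpow_neg hx.le, ← div_eq_mul_inv, div_le_iff₀' (Real.rpow_pos_of_pos hx s)] at hsum

lemma windowSum_nonneg (s z x y : ℝ) : 0 ≤ windowSum s z x y :=
  Finset.sum_nonneg fun n _ => Real.rpow_nonneg n.cast_nonneg (-s)

lemma windowSum_le {s z x y : ℝ} (hs : 0 ≤ s) (hz : 0 < z) :
    windowSum s z x y ≤ friableCount x y * z ^ (-s) := by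
  calc windowSum s z x y ≤ (friableWindow z x y).card • z ^ (-s) :=
        Finset.sum_le_card_nsmul _ _ _ fun n hn =>
          Real.rpow_le_rpow_of_nonpos hz (Finset.mem_filter.mp hn).2.le (by linarith)
    _ ≤ friableCount x y * z ^ (-s) := by
        rw [nsmul_eq_mul]
        refine mul_le_mul_of_nonneg_right ?_ (Real.rpow_pos_of_pos hz _).le
        exact_mod_cast Finset.card_le_card (Finset.filter_subset _ _)

lemma windowSum_le_add {s z w x y : ℝ} (hw : 0 ≤ w) (hx : 0 ≤ x) :
    windowSum s z x y ≤ windowSum s z w y + windowSum s w x y := by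
  classical
  have hsub : friableWindow z x y ⊆ friableWindow z w y ∪ friableWindow w x y := by
    intro n hn
    rw [Finset.mem_union, mem_friableWindow hx, mem_friableWindow hw]
    rw [mem_friableWindow hx] at hn
    rcases le_or_gt (n : ℝ) w with hnw | hnw
    · exact Or.inl ⟨hn.1, hn.2.1, hnw⟩
    · exact Or.inr ⟨hn.1, hnw, hn.2.2⟩
  have hnonneg (n : ℕ) : 0 ≤ (n : ℝ) ^ (-s) := Real.rpow_nonneg n.cast_nonneg (-s)
  rw [windowSum, windowSum, windowSum, ← Finset.sum_union_inter]
  exact (Finset.sum_le_sum_of_subset_of_nonneg hsub fun n _ _ => hnonneg n).trans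
    (le_add_of_nonneg_right (Finset.sum_nonneg fun n _ => hnonneg n))

lemma rpow_neg_le_of_le {n z δ : ℝ} (hn : 0 < n) (hnz : n ≤ z) (hδ : 0 ≤ δ) (s : ℝ) :
    n ^ (-s) ≤ z ^ δ * n ^ (-(s + δ)) := by
  calc n ^ (-s) = n ^ δ * n ^ (-(s + δ)) := by
        rw [← Real.rpow_add hn]
        ring_nf
    _ ≤ z ^ δ * n ^ (-(s + δ)) := by gcongr

lemma rpow_neg_le_of_ge {n x δ : ℝ} (hx : 0 < x) (hxn : x ≤ n) (hδ : 0 ≤ δ) (s : ℝ) :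
    n ^ (-s) ≤ x ^ (-δ) * n ^ (-(s - δ)) := by
  have hn := hx.trans_le hxn
  calc n ^ (-s) = n ^ (-δ) * n ^ (-(s - δ)) := by
        rw [← Real.rpow_add hn]
        ring_nf
    _ ≤ x ^ (-δ) * n ^ (-(s - δ)) := by
        refine mul_le_mul_of_nonneg_right ?_ (Real.rpow_pos_of_pos hn _).le
        exact Real.rpow_le_rpow_of_nonpos hx hxn (by linarith)

lemma hasSum_windowSum (s z x y : ℝ) :
    HasSum (fun n : ℕ => if n ∈ friableWindow z x y then (n : ℝ) ^ (-s) else 0)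
      (windowSum s z x y) := by
  rw [windowSum, ← Finset.sum_congr rfl fun n hn => if_pos hn]
  exact hasSum_sum_of_ne_finset_zero fun n hn => if_neg hn

-- Rankin's bound, applied to both tails outside the window.
lemma partialZeta_le_windowSum_add {s δ₁ δ₂ z x y : ℝ} (hs : 0 < s - δ₁) (hδ₁ : 0 ≤ δ₁)
    (hδ₂ : 0 ≤ δ₂) (hz : 0 < z) (hx : 0 < x) :
    partialZeta s y ≤ windowSum s z x y + x ^ (-δ₁) * partialZeta (s - δ₁) y
      + z ^ δ₂ * partialZeta (s + δ₂) y := by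
  refine hasSum_le (fun n => ?_) (hasSum_partialZeta (by linarith) y)
    (((hasSum_windowSum s z x y).add ((hasSum_partialZeta hs y).mul_left _)).add
      ((hasSum_partialZeta (by linarith) y).mul_left _))
  have hwindow : 0 ≤ (if n ∈ friableWindow z x y then (n : ℝ) ^ (-s) else 0) := by
    split_ifs <;> positivity
  by_cases hn : n ∈ Nat.smoothNumbers (⌊y⌋₊ + 1)
  · have hn₀ := natCast_pos_of_mem_smoothNumbers hn
    have hright : 0 ≤ x ^ (-δ₁) * (n : ℝ) ^ (-(s - δ₁)) := by positivity
    have hleft : 0 ≤ z ^ δ₂ * (n : ℝ) ^ (-(s + δ₂)) := by positivity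
    simp only [indicator_of_mem hn]
    rcases le_or_gt (n : ℝ) z with hnz | hzn
    · linarith [rpow_neg_le_of_le hn₀ hnz hδ₂ s]
    rcases le_or_gt (n : ℝ) x with hnx | hxn
    · rw [if_pos ((mem_friableWindow hx.le).mpr ⟨hn, hzn, hnx⟩)]
      linarith
    · linarith [rpow_neg_le_of_ge hx hxn.le hδ₁ s]
  · simpa only [indicator_of_notMem hn, mul_zero, add_zero] using hwindow

lemma sum_log_prime_dvd_le (Q : Finset ℕ) (hQ : ∀ p ∈ Q, p.Prime) {m : ℕ} (hm : m ≠ 0) :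
    ∑ p ∈ Q with p ∣ m, Real.log p ≤ Real.log m := by
  rw [← ArithmeticFunction.vonMangoldt_sum, ← Finset.sum_congr rfl fun p hp =>
    ArithmeticFunction.vonMangoldt_apply_prime (hQ p (Finset.mem_filter.mp hp).1)]
  exact Finset.sum_le_sum_of_subset_of_nonneg
    (fun p hp => Nat.mem_divisors.mpr ⟨(Finset.mem_filter.mp hp).2, hm⟩)
    fun _ _ _ => ArithmeticFunction.vonMangoldt_nonneg

lemma rpow_neg_mul_windowSum_le {s z w x y : ℝ} {p : ℕ} (hp : p.Prime) (hx : 0 ≤ x) (hy : 0 < y)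
    (hw : 0 < w) (hwp : w < p) (hpy : (p : ℝ) ≤ y) :
    (p : ℝ) ^ (-s) * windowSum s z (x / y) y
      ≤ ∑ m ∈ friableWindow (z * w) x y with p ∣ m, (m : ℝ) ^ (-s) := by
  have himage : (p : ℝ) ^ (-s) * windowSum s z (x / y) y
      = ∑ m ∈ (friableWindow z (x / y) y).image (p * ·), (m : ℝ) ^ (-s) := by
    rw [windowSum, Finset.mul_sum,
      Finset.sum_image fun n _ n' _ h => Nat.eq_of_mul_eq_mul_left hp.pos h]
    refine Finset.sum_congr rfl fun n _ => ?_
    rw [Nat.cast_mul, Real.mul_rpow p.cast_nonneg n.cast_nonneg]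
  rw [himage]
  refine Finset.sum_le_sum_of_subset_of_nonneg (fun m hm => ?_) fun m _ _ => by positivity
  obtain ⟨n, hn, rfl⟩ := Finset.mem_image.mp hm
  rw [mem_friableWindow (by positivity), le_div_iff₀ hy] at hn
  rw [Finset.mem_filter, mem_friableWindow hx, Nat.cast_mul]
  have hn₀ := natCast_pos_of_mem_smoothNumbers hn.1
  refine ⟨⟨Nat.mul_mem_smoothNumbers ?_ hn.1, ?_, ?_⟩, dvd_mul_right p n⟩
  · exact Nat.mem_smoothNumbers_of_lt hp.pos (Nat.lt_succ_of_le (Nat.le_floor hpy))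
  · linarith [mul_lt_mul_of_pos_right hn.2.1 hw, mul_lt_mul_of_pos_right hwp hn₀]
  · linarith [hn.2.2, mul_le_mul_of_nonneg_right hpy hn₀.le]

-- Multiplying the integers of the smaller window by the primes in `(w, y]`.
lemma mul_windowSum_le {s z w x y : ℝ} (hx : 0 ≤ x) (hy : 0 < y) (hw : 0 < w)
    (Q : Finset ℕ) (hQ : ∀ p ∈ Q, p.Prime ∧ w < p ∧ (p : ℝ) ≤ y) :
    (∑ p ∈ Q, Real.log p * (p : ℝ) ^ (-s)) * windowSum s z (x / y) y
      ≤ Real.log x * windowSum s (z * w) x y := by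
  calc (∑ p ∈ Q, Real.log p * (p : ℝ) ^ (-s)) * windowSum s z (x / y) y
      ≤ ∑ p ∈ Q, ∑ m ∈ friableWindow (z * w) x y with p ∣ m, Real.log p * (m : ℝ) ^ (-s) := by
        rw [Finset.sum_mul]
        refine Finset.sum_le_sum fun p hp => ?_
        obtain ⟨hp_prime, hwp, hpy⟩ := hQ p hp
        rw [mul_assoc, ← Finset.mul_sum]
        exact mul_le_mul_of_nonneg_left
          (rpow_neg_mul_windowSum_le hp_prime hx hy hw hwp hpy) (Real.log_natCast_nonneg p)
    _ = ∑ m ∈ friableWindow (z * w) x y, (∑ p ∈ Q with p ∣ m, Real.log p) * (m : ℝ) ^ (-s) := by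
        simp only [Finset.sum_filter, Finset.sum_mul, ite_mul, zero_mul]
        exact Finset.sum_comm
    _ ≤ Real.log x * windowSum s (z * w) x y := by
        rw [windowSum, Finset.mul_sum]
        refine Finset.sum_le_sum fun m hm => ?_
        rw [mem_friableWindow hx] at hm
        refine mul_le_mul_of_nonneg_right ?_ (Real.rpow_nonneg m.cast_nonneg _)
        exact (sum_log_prime_dvd_le Q (fun p hp => (hQ p hp).1)
          (Nat.ne_zero_of_mem_smoothNumbers hm.1)).trans
          (Real.log_le_log (natCast_pos_of_mem_smoothNumbers hm.1) hm.2.2)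

lemma windowSum_le_pow {s x y w r : ℝ} (hx : 0 ≤ x) (hy : 0 < y) (hw : 0 < w)
    (Q : Finset ℕ) (hQ : ∀ p ∈ Q, p.Prime ∧ w < p ∧ (p : ℝ) ≤ y)
    (hB : 0 < ∑ p ∈ Q, Real.log p * (p : ℝ) ^ (-s)) (hr : 1 ≤ r)
    (hrB : Real.log x ≤ r * ∑ p ∈ Q, Real.log p * (p : ℝ) ^ (-s)) (j : ℕ) :
    windowSum s (x / (y * w ^ j)) x y ≤ (j + 1) * r ^ j * windowSum s (x / y) x y := by
  induction j with
  | zero => simp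
  | succ j ih =>
    set z := x / (y * w ^ (j + 1)) with hz
    have hzw : z * w = x / (y * w ^ j) := by
      rw [hz, pow_succ]
      field_simp
    have hshift : windowSum s z (x / y) y ≤ r * windowSum s (x / (y * w ^ j)) x y := by
      refine le_of_mul_le_mul_left ?_ hB
      rw [← mul_assoc, mul_comm _ r, ← hzw]
      exact (mul_windowSum_le hx hy hw Q hQ).trans
        (mul_le_mul_of_nonneg_right hrB (windowSum_nonneg _ _ _ _))
    have htop : windowSum s (x / y) x y ≤ r ^ (j + 1) * windowSum s (x / y) x y :=
      le_mul_of_one_le_left (windowSum_nonneg _ _ _ _) (one_le_pow₀ hr)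
    calc windowSum s z x y ≤ windowSum s z (x / y) y + windowSum s (x / y) x y :=
          windowSum_le_add (by positivity) hx
      _ ≤ r * ((j + 1) * r ^ j * windowSum s (x / y) x y)
          + r ^ (j + 1) * windowSum s (x / y) x y :=
          add_le_add (hshift.trans (mul_le_mul_of_nonneg_left ih (by linarith))) htop
      _ = (↑(j + 1) + 1) * r ^ (j + 1) * windowSum s (x / y) x y := by
          push_cast
          ring

lemma rpow_mul_partialZeta_le {s t v c y : ℝ} (hs : 0 < s) (ht : 0 < t) (hv : 0 < v)
    (h : c * Real.log v + (t - s) * meanLog s y + 2 ≤ 0) :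
    v ^ c * partialZeta s y ≤ 1 / 4 * partialZeta t y := by
  rw [rpow_mul_partialZeta hs hv]
  have hexp : Real.exp 2 * Real.exp (c * Real.log v + logPartialZeta s y) ≤ partialZeta t y := by
    rw [← Real.exp_add, partialZeta_eq_exp ht, Real.exp_le_exp]
    linarith [logPartialZeta_sub_le hs ht y]
  linarith [mul_le_mul_of_nonneg_right four_le_exp_two
    (Real.exp_pos (c * Real.log v + logPartialZeta s y)).le]

lemma partialZeta_le_two_mul_windowSum {a δ x y z : ℝ} (ha : 0 < a) (hδ : 0 < δ)
    (hx : 0 < x) (hz : 0 < z) (hsaddle : Real.log x = meanLog a y)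
    (hright : 2 ≤ δ / 2 * (meanLog a y - meanLog (a + δ / 2) y))
    (hleft : Real.log z ≤ meanLog (a + 2 * δ) y - 2 / δ) :
    partialZeta (a + δ) y ≤ 2 * windowSum (a + δ) z x y := by
  have htail_right : x ^ (-(δ / 2)) * partialZeta (a + δ - δ / 2) y
      ≤ 1 / 4 * partialZeta (a + δ) y := by
    refine rpow_mul_partialZeta_le (by linarith) (by linarith) hx ?_
    rw [show a + δ - δ / 2 = a + δ / 2 by ring, hsaddle]
    linarith
  have htail_left : z ^ δ * partialZeta (a + δ + δ) y ≤ 1 / 4 * partialZeta (a + δ) y := by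
    refine rpow_mul_partialZeta_le (by linarith) (by linarith) hz ?_
    have hmul := mul_le_mul_of_nonneg_left hleft hδ.le
    rw [mul_sub, mul_div_cancel₀ _ hδ.ne'] at hmul
    rw [show a + δ + δ = a + 2 * δ by ring]
    linarith
  linarith [partialZeta_le_windowSum_add (s := a + δ) (δ₁ := δ / 2) (δ₂ := δ) (y := y)
    (by linarith) (by linarith) hδ.le hz hx]

theorem partialZeta_mul_rpow_le_friableCount {a δ x y w r : ℝ} {j : ℕ} (ha : 0 < a) (hδ : 0 < δ)
    (hx : 0 < x) (hy : 0 < y) (hw : 0 < w) (hsaddle : Real.log x = meanLog a y)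
    (hright : 2 ≤ δ / 2 * (meanLog a y - meanLog (a + δ / 2) y))
    (hleft : meanLog a y - Real.log y - j * Real.log w ≤ meanLog (a + 2 * δ) y - 2 / δ)
    (Q : Finset ℕ) (hQ : ∀ p ∈ Q, p.Prime ∧ w < p ∧ (p : ℝ) ≤ y)
    (hB : 0 < ∑ p ∈ Q, Real.log p * (p : ℝ) ^ (-(a + δ))) (hr : 1 ≤ r)
    (hrB : Real.log x ≤ r * ∑ p ∈ Q, Real.log p * (p : ℝ) ^ (-(a + δ))) :
    x ^ a * partialZeta a y ≤ 2 * ((j + 1) * r ^ j * y ^ (a + δ) * friableCount x y) := by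
  have hxδ := Real.rpow_pos_of_pos hx (a + δ)
  have hlog : Real.log (x / (y * w ^ j)) = meanLog a y - Real.log y - j * Real.log w := by
    rw [Real.log_div hx.ne' (by positivity), Real.log_mul hy.ne' (by positivity), Real.log_pow,
      hsaddle, sub_sub]
  have hwindow : partialZeta (a + δ) y
      ≤ 2 * ((j + 1) * r ^ j * (friableCount x y * (x / y) ^ (-(a + δ)))) := by
    refine (partialZeta_le_two_mul_windowSum ha hδ hx (z := x / (y * w ^ j)) (by positivity)
      hsaddle hright (hlog ▸ hleft)).trans (mul_le_mul_of_nonneg_left ?_ zero_le_two)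
    refine (windowSum_le_pow hx.le hy hw Q hQ hB hr hrB j).trans ?_
    gcongr
    exact windowSum_le (by linarith) (by positivity)
  have hmin : x ^ a * partialZeta a y ≤ x ^ (a + δ) * partialZeta (a + δ) y := by
    have hδa : 0 < a + δ := by linarith
    rw [mul_comm, mul_comm (x ^ (a + δ))]
    exact isMinOn_iff.mp ((isSaddlePoint_iff hx ha).mpr hsaddle).2 _ hδa
  have hxy : x ^ (a + δ) * (x / y) ^ (-(a + δ)) = y ^ (a + δ) := by
    rw [Real.rpow_neg (by positivity), Real.div_rpow hx.le hy.le]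
    field_simp
  calc x ^ a * partialZeta a y
      ≤ x ^ (a + δ) * (2 * ((j + 1) * r ^ j * (friableCount x y * (x / y) ^ (-(a + δ))))) :=
        hmin.trans (mul_le_mul_of_nonneg_left hwindow hxδ.le)
    _ = 2 * ((j + 1) * r ^ j * (x ^ (a + δ) * (x / y) ^ (-(a + δ))) * friableCount x y) := by ring
    _ = 2 * ((j + 1) * r ^ j * y ^ (a + δ) * friableCount x y) := by rw [hxy]

end Friable

section PrimeSums

/-- The primes in `(√y, y]`. -/
noncomputable def largePrimes (y : ℝ) : Finset ℕ :=
  (primesUpTo y).filter fun p : ℕ => √y < p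

/-- The Euler factor of `ζ(a)` at `2`; it bounds `(1 - n ^ (-b))⁻¹` for all `n ≥ 2` and
`b ≥ a`. -/
noncomputable def eulerFactorTwo (a : ℝ) : ℝ := (1 - 2 ^ (-a))⁻¹

lemma one_le_eulerFactorTwo {a : ℝ} (ha : 0 < a) : 1 ≤ eulerFactorTwo a := by
  have htwo : (2 : ℝ) ^ (-a) < 1 := Real.rpow_lt_one_of_one_lt_of_neg one_lt_two (by linarith)
  exact (one_le_inv₀ (sub_pos.mpr htwo)).mpr (sub_le_self 1 (by positivity))

lemma eventually_const_mul_log_pow_le_rpow (C : ℝ) (k : ℕ) {b : ℝ} (hb : 0 < b) :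
    ∀ᶠ y : ℝ in atTop, C * (1 + Real.log y) ^ k ≤ y ^ b := by
  have hlittle := (isLittleO_log_rpow_rpow_atTop (s := b) (k : ℝ) hb).bound
    (c := 1 / ((|C| + 1) * 2 ^ k)) (by positivity)
  filter_upwards [hlittle, eventually_ge_atTop (Real.exp 1)] with y hy hexp
  have hy₀ : 0 < y := (Real.exp_pos 1).trans_le hexp
  have hlog : 1 ≤ Real.log y := (Real.le_log_iff_exp_le hy₀).mpr hexp
  rw [Real.rpow_natCast, Real.norm_of_nonneg (pow_nonneg (zero_le_one.trans hlog) k),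
    Real.norm_of_nonneg (Real.rpow_nonneg hy₀.le b), one_div, inv_mul_eq_div,
    le_div_iff₀ (by positivity)] at hy
  calc C * (1 + Real.log y) ^ k ≤ (|C| + 1) * (2 * Real.log y) ^ k := by
        gcongr <;> linarith [le_abs_self C]
    _ = Real.log y ^ k * ((|C| + 1) * 2 ^ k) := by rw [mul_pow]; ring
    _ ≤ y ^ b := hy

lemma mem_largePrimes {y : ℝ} (hy : 0 ≤ y) {p : ℕ} :
    p ∈ largePrimes y ↔ p.Prime ∧ √y < p ∧ (p : ℝ) ≤ y := by
  rw [largePrimes, Finset.mem_filter, mem_primesUpTo hy]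
  tauto

lemma largePrimes_subset (y : ℝ) : largePrimes y ⊆ primesUpTo y := Finset.filter_subset _ _

lemma sum_primesUpTo_eq {y : ℝ} (hy : 1 ≤ y) (f : ℕ → ℝ) :
    ∑ p ∈ primesUpTo y, f p = ∑ p ∈ largePrimes y, f p + ∑ p ∈ primesUpTo (√y), f p := by
  have hsqrt : √y ≤ y := Real.sqrt_le_iff.mpr ⟨by linarith, by nlinarith⟩
  have hsmall : (primesUpTo y).filter (fun p : ℕ => ¬ √y < p) = primesUpTo (√y) := by
    ext p
    rw [Finset.mem_filter, mem_primesUpTo (by linarith), mem_primesUpTo (Real.sqrt_nonneg y),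
      not_lt]
    exact ⟨fun h => ⟨h.1.1, h.2⟩, fun h => ⟨⟨h.1, h.2.trans hsqrt⟩, h.2⟩⟩
  rw [← Finset.sum_filter_add_sum_filter_not _ (fun p : ℕ => √y < p), hsmall, largePrimes]

lemma sum_log_largePrimes {y : ℝ} (hy : 1 ≤ y) :
    ∑ p ∈ largePrimes y, Real.log p = Chebyshev.theta y - Chebyshev.theta (√y) := by
  have hsum := sum_primesUpTo_eq hy fun p => Real.log p
  rw [Chebyshev.theta_eq_sum_primesLE, Chebyshev.theta_eq_sum_primesLE]
  exact eq_sub_of_add_eq hsum.symm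

lemma eventually_half_le_sum_log_largePrimes :
    ∀ᶠ y : ℝ in atTop, y / 2 ≤ ∑ p ∈ largePrimes y, Real.log p := by
  filter_upwards [eventually_ge_atTop 2,
    eventually_const_mul_log_pow_le_rpow 100 1 (b := 1 / 2) (by norm_num)] with y hy hlog
  rw [pow_one, ← Real.sqrt_eq_rpow] at hlog
  have hy₀ : 0 < y := by linarith
  have hlog₀ : 0 ≤ Real.log y := Real.log_nonneg (by linarith)
  have hsq : √y * √y = y := Real.mul_self_sqrt hy₀.le
  have hsqrt : 100 * √y ≤ y := by nlinarith
  have hsqrtlog : 100 * (√y * Real.log y) ≤ y := by nlinarith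
  have hlogadd : Real.log (y + 2) ≤ 2 * Real.log y := by
    rw [two_mul, ← Real.log_mul hy₀.ne' hy₀.ne']
    exact Real.log_le_log (by linarith) (by nlinarith)
  have hlogfour : Real.log 4 = 2 * Real.log 2 := by
    rw [show (4 : ℝ) = 2 ^ 2 by norm_num, Real.log_pow, Nat.cast_ofNat]
  have hsmall := Chebyshev.theta_le_log4_mul_x (Real.sqrt_nonneg y)
  rw [sum_log_largePrimes (by linarith)]
  nlinarith [hsqrtlog, Chebyshev.theta_ge' (x := y) (by linarith),
    Real.log_two_gt_d9, Real.log_two_lt_d9]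

lemma sum_primes_rpow_le {z : ℝ} (hz : 1 ≤ z) (b : ℝ) :
    ∑ p ∈ primesUpTo z, (p : ℝ) ^ (-b) ≤ z ^ max (1 - b) 0 * (1 + Real.log z) := by
  have hz₀ : 0 ≤ z := by linarith
  have hterm (p : ℕ) (hp : p ∈ primesUpTo z) :
      (p : ℝ) ^ (-b) ≤ z ^ max (1 - b) 0 * (p : ℝ)⁻¹ := by
    rw [mem_primesUpTo hz₀] at hp
    have hp₁ : (1 : ℝ) ≤ p := by exact_mod_cast hp.1.one_le
    calc (p : ℝ) ^ (-b) = (p : ℝ) ^ (1 - b) * (p : ℝ)⁻¹ := by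
          rw [← Real.rpow_neg_one, ← Real.rpow_add (by linarith)]
          ring_nf
      _ ≤ (p : ℝ) ^ max (1 - b) 0 * (p : ℝ)⁻¹ := by
          gcongr
          exact le_max_left _ _
      _ ≤ z ^ max (1 - b) 0 * (p : ℝ)⁻¹ := by
          gcongr
          exact hp.2
  have hharmonic : ∑ p ∈ primesUpTo z, (p : ℝ)⁻¹ ≤ 1 + Real.log z := by
    refine le_trans ?_ (harmonic_floor_le_one_add_log z hz)
    rw [harmonic_eq_sum_Icc, Rat.cast_sum]
    simp only [Rat.cast_inv, Rat.cast_natCast]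
    refine Finset.sum_le_sum_of_subset_of_nonneg (fun p hp => ?_) fun p _ _ => by positivity
    rw [mem_primesUpTo hz₀] at hp
    exact Finset.mem_Icc.mpr ⟨hp.1.one_le, Nat.le_floor hp.2⟩
  refine (Finset.sum_le_sum hterm).trans ?_
  rw [← Finset.mul_sum]
  gcongr

lemma rpow_div_two_le_sum_largePrimes {y b : ℝ} (hy : 0 < y) (hb : 0 ≤ b)
    (hlarge : y / 2 ≤ ∑ p ∈ largePrimes y, Real.log p) :
    y ^ (1 - b) / 2 ≤ ∑ p ∈ largePrimes y, Real.log p * (p : ℝ) ^ (-b) := by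
  calc y ^ (1 - b) / 2 = y / 2 * y ^ (-b) := by
        rw [sub_eq_add_neg, Real.rpow_add hy, Real.rpow_one]
        ring
    _ ≤ (∑ p ∈ largePrimes y, Real.log p) * y ^ (-b) := by gcongr
    _ ≤ ∑ p ∈ largePrimes y, Real.log p * (p : ℝ) ^ (-b) := by
        rw [Finset.sum_mul]
        refine Finset.sum_le_sum fun p hp => ?_
        rw [mem_largePrimes hy.le] at hp
        refine mul_le_mul_of_nonneg_left ?_ (Real.log_natCast_nonneg p)
        exact Real.rpow_le_rpow_of_nonpos (by exact_mod_cast hp.1.pos) hp.2.2 (by linarith)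

end PrimeSums

section MeanLog

lemma inv_one_sub_rpow_neg_le {n a b : ℝ} (hn : 2 ≤ n) (ha : 0 < a) (hab : a ≤ b) :
    (1 - n ^ (-b))⁻¹ ≤ eulerFactorTwo a := by
  have htwo : (2 : ℝ) ^ (-a) < 1 := Real.rpow_lt_one_of_one_lt_of_neg one_lt_two (by linarith)
  refine inv_anti₀ (sub_pos.mpr htwo) (sub_le_sub_left ?_ 1)
  calc n ^ (-b) ≤ n ^ (-a) := Real.rpow_le_rpow_of_exponent_le (by linarith) (by linarith)
    _ ≤ 2 ^ (-a) := Real.rpow_le_rpow_of_nonpos two_pos hn (by linarith)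

lemma inv_rpow_sub_one_eq {n b : ℝ} (hn : 0 < n) :
    (n ^ b - 1)⁻¹ = (1 - n ^ (-b))⁻¹ * n ^ (-b) := by
  have hne : n ^ b ≠ 0 := by positivity
  rw [Real.rpow_neg hn.le, ← mul_inv, sub_mul, one_mul, inv_mul_cancel₀ hne]

lemma inv_rpow_sub_one_le {n a b : ℝ} (hn : 2 ≤ n) (ha : 0 < a) (hab : a ≤ b) :
    (n ^ b - 1)⁻¹ ≤ eulerFactorTwo a * n ^ (-b) := by
  rw [inv_rpow_sub_one_eq (by linarith)]
  gcongr
  exact inv_one_sub_rpow_neg_le hn ha hab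

lemma inv_rpow_sub_one_le_add {n a b : ℝ} (hn : 2 ≤ n) (ha : 0 < a) (hab : a ≤ b) :
    (n ^ b - 1)⁻¹ ≤ n ^ (-b) + eulerFactorTwo a * n ^ (-(2 * a)) := by
  have hone : 1 < n ^ b := Real.one_lt_rpow (by linarith) (by linarith)
  have hneg : n ^ (-b) = (n ^ b)⁻¹ := Real.rpow_neg (by linarith) b
  calc (n ^ b - 1)⁻¹ = n ^ (-b) + (n ^ b - 1)⁻¹ * n ^ (-b) := by
        rw [hneg]
        have : n ^ b - 1 ≠ 0 := by linarith
        field_simp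
        ring
    _ ≤ n ^ (-b) + eulerFactorTwo a * n ^ (-b) * n ^ (-b) := by
        gcongr
        exact inv_rpow_sub_one_le hn ha hab
    _ = n ^ (-b) + eulerFactorTwo a * n ^ (-(2 * b)) := by
        rw [mul_assoc, ← Real.rpow_add (by linarith)]
        ring_nf
    _ ≤ n ^ (-b) + eulerFactorTwo a * n ^ (-(2 * a)) := by
        gcongr
        · exact zero_le_one.trans (one_le_eulerFactorTwo ha)
        · linarith

lemma inv_rpow_sub_one_sub_eq {n a b : ℝ} (hn : 1 < n) (ha : 0 < a) (hb : 0 < b) :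
    (n ^ a - 1)⁻¹ - (n ^ b - 1)⁻¹ = (n ^ b - n ^ a) * ((n ^ a - 1)⁻¹ * (n ^ b - 1)⁻¹) := by
  rw [inv_sub_inv (sub_pos.mpr (Real.one_lt_rpow hn ha)).ne'
    (sub_pos.mpr (Real.one_lt_rpow hn hb)).ne', sub_sub_sub_cancel_right, div_eq_mul_inv, mul_inv]

lemma mul_log_mul_rpow_neg_le {n a h : ℝ} (hn : 1 < n) (ha : 0 < a) (hh : 0 ≤ h) :
    h * Real.log n * n ^ (-(a + h)) ≤ (n ^ a - 1)⁻¹ - (n ^ (a + h) - 1)⁻¹ := by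
  have hn₀ : 0 < n := by linarith
  have hone (t : ℝ) (ht : 0 < t) : 1 < n ^ t := Real.one_lt_rpow hn ht
  have hinv (t : ℝ) (ht : 0 < t) : n ^ (-t) ≤ (n ^ t - 1)⁻¹ := by
    rw [Real.rpow_neg hn₀.le]
    exact inv_anti₀ (sub_pos.mpr (hone t ht)) (by linarith)
  have hdiff : h * Real.log n * n ^ a ≤ n ^ (a + h) - n ^ a := by
    have hexp : h * Real.log n + 1 ≤ n ^ h := by
      rw [Real.rpow_def_of_pos hn₀, mul_comm]
      exact Real.add_one_le_exp _
    rw [Real.rpow_add hn₀]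
    nlinarith [hone a ha]
  rw [inv_rpow_sub_one_sub_eq hn ha (by linarith)]
  calc h * Real.log n * n ^ (-(a + h))
      = h * Real.log n * n ^ a * (n ^ (-a) * n ^ (-(a + h))) := by
        rw [mul_assoc _ (n ^ a), ← mul_assoc (n ^ a), ← Real.rpow_add hn₀, add_neg_cancel,
          Real.rpow_zero, one_mul]
    _ ≤ (n ^ (a + h) - n ^ a) * ((n ^ a - 1)⁻¹ * (n ^ (a + h) - 1)⁻¹) := by
        have hlog := Real.log_pos hn
        gcongr
        · exact le_trans (by positivity) hdiff
        · exact inv_nonneg.mpr (sub_nonneg.mpr (hone a ha).le)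
        · exact hinv a ha
        · exact hinv (a + h) (by linarith)

lemma inv_rpow_sub_one_sub_le {n a h : ℝ} (hn : 2 ≤ n) (ha : 0 < a) (hh : 0 ≤ h) :
    (n ^ a - 1)⁻¹ - (n ^ (a + h) - 1)⁻¹
      ≤ eulerFactorTwo a ^ 2 * h * Real.log n * n ^ (-a) := by
  have hn₀ : 0 < n := by linarith
  have hE := one_le_eulerFactorTwo ha
  have hlog := Real.log_nonneg (show 1 ≤ n by linarith)
  have hinv (t : ℝ) (ht : a ≤ t) : 0 ≤ (n ^ t - 1)⁻¹ :=
    inv_nonneg.mpr (sub_nonneg.mpr (Real.one_le_rpow (by linarith) (by linarith)))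
  have hdiff : n ^ (a + h) - n ^ a ≤ h * Real.log n * n ^ (a + h) := by
    have hexp : -h * Real.log n + 1 ≤ n ^ (-h) := by
      rw [Real.rpow_def_of_pos hn₀, mul_comm]
      exact Real.add_one_le_exp _
    have hmul : n ^ a = n ^ (a + h) * n ^ (-h) := by
      rw [← Real.rpow_add hn₀, add_neg_cancel_right]
    have hpos : 0 < n ^ (a + h) := by positivity
    nlinarith
  rw [inv_rpow_sub_one_sub_eq (by linarith) ha (by linarith)]
  calc (n ^ (a + h) - n ^ a) * ((n ^ a - 1)⁻¹ * (n ^ (a + h) - 1)⁻¹)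
      ≤ h * Real.log n * n ^ (a + h)
        * ((eulerFactorTwo a * n ^ (-a)) * (eulerFactorTwo a * n ^ (-(a + h)))) := by
        gcongr
        · exact mul_nonneg (hinv a le_rfl) (hinv (a + h) (by linarith))
        · exact hinv (a + h) (by linarith)
        · exact inv_rpow_sub_one_le hn ha le_rfl
        · exact inv_rpow_sub_one_le hn ha (by linarith)
    _ = eulerFactorTwo a ^ 2 * h * Real.log n * n ^ (-a) * (n ^ (a + h) * n ^ (-(a + h))) := by
        ring
    _ = eulerFactorTwo a ^ 2 * h * Real.log n * n ^ (-a) := by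
        rw [← Real.rpow_add hn₀, add_neg_cancel, Real.rpow_zero, mul_one]

lemma meanLog_nonneg {a : ℝ} (ha : 0 < a) (y : ℝ) : 0 ≤ meanLog a y :=
  Finset.sum_nonneg fun p hp => div_nonneg (Real.log_natCast_nonneg p)
    (sub_nonneg.mpr (one_lt_prime_rpow (prime_of_mem_primesUpTo hp) ha).le)

lemma sum_largePrimes_le_meanLog {a : ℝ} (ha : 0 < a) (y : ℝ) :
    ∑ p ∈ largePrimes y, Real.log p * (p : ℝ) ^ (-a) ≤ meanLog a y := by
  refine le_trans (Finset.sum_le_sum_of_subset_of_nonneg (largePrimes_subset y)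
    fun p _ _ => mul_nonneg (Real.log_natCast_nonneg p) (by positivity)) ?_
  refine Finset.sum_le_sum fun p hp => ?_
  have hone := one_lt_prime_rpow (prime_of_mem_primesUpTo hp) ha
  rw [Real.rpow_neg (Nat.cast_nonneg p), ← div_eq_mul_inv]
  exact div_le_div_of_nonneg_left (Real.log_natCast_nonneg p) (sub_pos.mpr hone) (by linarith)

lemma meanLog_sub_eq (a b y : ℝ) : meanLog a y - meanLog b y
    = ∑ p ∈ primesUpTo y, Real.log p * (((p : ℝ) ^ a - 1)⁻¹ - ((p : ℝ) ^ b - 1)⁻¹) := by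
  rw [meanLog, meanLog, ← Finset.sum_sub_distrib]
  exact Finset.sum_congr rfl fun p _ => by rw [mul_sub, ← div_eq_mul_inv, ← div_eq_mul_inv]

lemma mul_log_mul_rpow_le_meanLog_sub {a h y : ℝ} (ha : 0 < a) (hh : 0 ≤ h) (hy : 1 ≤ y)
    (hlarge : y / 2 ≤ ∑ p ∈ largePrimes y, Real.log p) :
    h * (Real.log y / 2) * (y ^ (1 - (a + h)) / 2) ≤ meanLog a y - meanLog (a + h) y := by
  have hlog := Real.log_nonneg hy
  calc h * (Real.log y / 2) * (y ^ (1 - (a + h)) / 2)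
      ≤ h * (Real.log y / 2) * ∑ p ∈ largePrimes y, Real.log p * (p : ℝ) ^ (-(a + h)) := by
        gcongr
        exact rpow_div_two_le_sum_largePrimes (by linarith) (by linarith) hlarge
    _ ≤ ∑ p ∈ largePrimes y, Real.log p * (h * Real.log p * (p : ℝ) ^ (-(a + h))) := by
        rw [Finset.mul_sum]
        refine Finset.sum_le_sum fun p hp => ?_
        rw [mem_largePrimes (by linarith)] at hp
        have hhalf : Real.log y / 2 ≤ Real.log p := by
          rw [← Real.log_sqrt (by linarith)]
          exact Real.log_le_log (Real.sqrt_pos.mpr (by linarith)) hp.2.1.le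
        have hterm : 0 ≤ h * (Real.log p * (p : ℝ) ^ (-(a + h))) :=
          mul_nonneg hh (mul_nonneg (Real.log_natCast_nonneg p) (by positivity))
        linarith [mul_le_mul_of_nonneg_left hhalf hterm]
    _ ≤ ∑ p ∈ primesUpTo y, Real.log p * (h * Real.log p * (p : ℝ) ^ (-(a + h))) :=
        Finset.sum_le_sum_of_subset_of_nonneg (largePrimes_subset y) fun p _ _ => by positivity
    _ ≤ meanLog a y - meanLog (a + h) y := by
        rw [meanLog_sub_eq]
        refine Finset.sum_le_sum fun p hp => ?_
        have hp₁ : (1 : ℝ) < p := by exact_mod_cast (prime_of_mem_primesUpTo hp).one_lt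
        gcongr
        exact mul_log_mul_rpow_neg_le hp₁ ha hh

lemma meanLog_sub_le {a h y : ℝ} (ha : 0 < a) (hh : 0 ≤ h) (hy : 1 ≤ y) :
    meanLog a y - meanLog (a + h) y
      ≤ eulerFactorTwo a ^ 2 * h * (1 + Real.log y) ^ 3 * y ^ max (1 - a) 0 := by
  have hlog := Real.log_nonneg hy
  have hterm (p : ℕ) (hp : p ∈ primesUpTo y) :
      Real.log p * (((p : ℝ) ^ a - 1)⁻¹ - ((p : ℝ) ^ (a + h) - 1)⁻¹)
        ≤ eulerFactorTwo a ^ 2 * h * (1 + Real.log y) ^ 2 * (p : ℝ) ^ (-a) := by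
    rw [mem_primesUpTo (by linarith)] at hp
    have hp₂ : (2 : ℝ) ≤ p := by exact_mod_cast hp.1.two_le
    have hlogle : Real.log p ≤ 1 + Real.log y := by
      linarith [Real.log_le_log (by linarith) hp.2]
    calc Real.log p * (((p : ℝ) ^ a - 1)⁻¹ - ((p : ℝ) ^ (a + h) - 1)⁻¹)
        ≤ Real.log p * (eulerFactorTwo a ^ 2 * h * Real.log p * (p : ℝ) ^ (-a)) := by
          gcongr
          exact inv_rpow_sub_one_sub_le hp₂ ha hh
      _ = eulerFactorTwo a ^ 2 * h * Real.log p ^ 2 * (p : ℝ) ^ (-a) := by ring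
      _ ≤ eulerFactorTwo a ^ 2 * h * (1 + Real.log y) ^ 2 * (p : ℝ) ^ (-a) := by gcongr
  rw [meanLog_sub_eq]
  refine (Finset.sum_le_sum hterm).trans ?_
  rw [← Finset.mul_sum]
  calc eulerFactorTwo a ^ 2 * h * (1 + Real.log y) ^ 2 * ∑ p ∈ primesUpTo y, (p : ℝ) ^ (-a)
      ≤ eulerFactorTwo a ^ 2 * h * (1 + Real.log y) ^ 2
        * (y ^ max (1 - a) 0 * (1 + Real.log y)) := by
        gcongr
        exact sum_primes_rpow_le hy a
    _ = eulerFactorTwo a ^ 2 * h * (1 + Real.log y) ^ 3 * y ^ max (1 - a) 0 := by ring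

lemma sum_largePrimes_div_le {a b y : ℝ} (ha : 0 < a) (hab : a ≤ b) (hy : 1 ≤ y) :
    ∑ p ∈ largePrimes y, Real.log p / ((p : ℝ) ^ b - 1)
      ≤ ∑ p ∈ largePrimes y, Real.log p * (p : ℝ) ^ (-b)
        + eulerFactorTwo a * (1 + Real.log y) ^ 2 * y ^ max (1 - 2 * a) 0 := by
  have hE : 0 ≤ eulerFactorTwo a := zero_le_one.trans (one_le_eulerFactorTwo ha)
  have hlog := Real.log_nonneg hy
  have hterm (p : ℕ) (hp : p ∈ largePrimes y) : Real.log p / ((p : ℝ) ^ b - 1)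
      ≤ Real.log p * (p : ℝ) ^ (-b)
        + eulerFactorTwo a * (1 + Real.log y) * (p : ℝ) ^ (-(2 * a)) := by
    rw [mem_largePrimes (by linarith)] at hp
    have hp₂ : (2 : ℝ) ≤ p := by exact_mod_cast hp.1.two_le
    have hlogle : Real.log p ≤ 1 + Real.log y := by
      linarith [Real.log_le_log (by linarith) hp.2.2]
    calc Real.log p / ((p : ℝ) ^ b - 1)
        ≤ Real.log p * ((p : ℝ) ^ (-b) + eulerFactorTwo a * (p : ℝ) ^ (-(2 * a))) := by
          rw [div_eq_mul_inv]
          gcongr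
          exact inv_rpow_sub_one_le_add hp₂ ha hab
      _ = Real.log p * (p : ℝ) ^ (-b)
          + eulerFactorTwo a * Real.log p * (p : ℝ) ^ (-(2 * a)) := by ring
      _ ≤ Real.log p * (p : ℝ) ^ (-b)
          + eulerFactorTwo a * (1 + Real.log y) * (p : ℝ) ^ (-(2 * a)) := by gcongr
  have hsum : ∑ p ∈ largePrimes y, (p : ℝ) ^ (-(2 * a))
      ≤ y ^ max (1 - 2 * a) 0 * (1 + Real.log y) :=
    (Finset.sum_le_sum_of_subset_of_nonneg (largePrimes_subset y)
      fun p _ _ => by positivity).trans (sum_primes_rpow_le hy (2 * a))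
  refine (Finset.sum_le_sum hterm).trans ?_
  rw [Finset.sum_add_distrib, ← Finset.mul_sum]
  refine add_le_add_right ?_ _
  calc eulerFactorTwo a * (1 + Real.log y) * ∑ p ∈ largePrimes y, (p : ℝ) ^ (-(2 * a))
      ≤ eulerFactorTwo a * (1 + Real.log y)
        * (y ^ max (1 - 2 * a) 0 * (1 + Real.log y)) := by gcongr
    _ = eulerFactorTwo a * (1 + Real.log y) ^ 2 * y ^ max (1 - 2 * a) 0 := by ring

lemma meanLog_le {a b y : ℝ} (ha : 0 < a) (hab : a ≤ b) (hy : 1 ≤ y) :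
    meanLog b y ≤ eulerFactorTwo a * (1 + Real.log y) ^ 2 * y ^ max (1 - a) 0 := by
  have hE : 0 ≤ eulerFactorTwo a := zero_le_one.trans (one_le_eulerFactorTwo ha)
  have hlog := Real.log_nonneg hy
  have hterm (p : ℕ) (hp : p ∈ primesUpTo y) : Real.log p / ((p : ℝ) ^ b - 1)
      ≤ eulerFactorTwo a * (1 + Real.log y) * (p : ℝ) ^ (-a) := by
    rw [mem_primesUpTo (by linarith)] at hp
    have hp₂ : (2 : ℝ) ≤ p := by exact_mod_cast hp.1.two_le
    calc Real.log p / ((p : ℝ) ^ b - 1)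
        ≤ (1 + Real.log y) * (eulerFactorTwo a * (p : ℝ) ^ (-b)) := by
          rw [div_eq_mul_inv]
          gcongr
          · exact inv_nonneg.mpr (sub_nonneg.mpr (one_lt_prime_rpow hp.1 (by linarith)).le)
          · linarith [Real.log_le_log (by linarith) hp.2]
          · exact inv_rpow_sub_one_le hp₂ ha hab
      _ ≤ (1 + Real.log y) * (eulerFactorTwo a * (p : ℝ) ^ (-a)) := by
          gcongr
          linarith
      _ = eulerFactorTwo a * (1 + Real.log y) * (p : ℝ) ^ (-a) := by ring
  refine (Finset.sum_le_sum hterm).trans ?_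
  rw [← Finset.mul_sum]
  calc eulerFactorTwo a * (1 + Real.log y) * ∑ p ∈ primesUpTo y, (p : ℝ) ^ (-a)
      ≤ eulerFactorTwo a * (1 + Real.log y) * (y ^ max (1 - a) 0 * (1 + Real.log y)) := by
        gcongr
        exact sum_primes_rpow_le hy a
    _ = eulerFactorTwo a * (1 + Real.log y) ^ 2 * y ^ max (1 - a) 0 := by ring

lemma meanLog_le_sum_largePrimes_add {a b y : ℝ} (ha : 0 < a) (hab : a ≤ b) (hy : 1 ≤ y) :
    meanLog b y ≤ ∑ p ∈ largePrimes y, Real.log p * (p : ℝ) ^ (-b)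
      + eulerFactorTwo a * (1 + Real.log y) ^ 2
        * (y ^ (max (1 - a) 0 / 2) + y ^ max (1 - 2 * a) 0) := by
  have hE : 0 ≤ eulerFactorTwo a := zero_le_one.trans (one_le_eulerFactorTwo ha)
  have hlog := Real.log_nonneg hy
  have hsmall : meanLog b (√y)
      ≤ eulerFactorTwo a * (1 + Real.log y) ^ 2 * y ^ (max (1 - a) 0 / 2) := by
    refine (meanLog_le ha hab (Real.one_le_sqrt.mpr hy)).trans ?_
    rw [Real.log_sqrt (by linarith), Real.sqrt_eq_rpow, ← Real.rpow_mul (by linarith),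
      one_div_mul_eq_div]
    gcongr
    linarith
  have hsplit := sum_primesUpTo_eq hy fun p => Real.log p / ((p : ℝ) ^ b - 1)
  rw [← meanLog, ← meanLog] at hsplit
  linarith [sum_largePrimes_div_le ha hab hy]

end MeanLog

section SaddlePointLowerBound

/-- The product of powers of `log y` and constants that is lost when sums over the primes up to `y`
are compared with powers of `y`. -/
noncomputable def logFactor (a y : ℝ) : ℝ := eulerFactorTwo a ^ 2 * (1 + Real.log y) ^ 3

lemma one_add_log_le_logFactor {a y : ℝ} (ha : 0 < a) (hy : 1 ≤ y) :
    1 + Real.log y ≤ logFactor a y := by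
  have hlog := Real.log_nonneg hy
  calc 1 + Real.log y ≤ (1 + Real.log y) ^ 3 := le_self_pow₀ (by linarith) (by norm_num)
    _ ≤ logFactor a y :=
        le_mul_of_one_le_left (by positivity) (one_le_pow₀ (one_le_eulerFactorTwo ha))

lemma one_le_logFactor {a y : ℝ} (ha : 0 < a) (hy : 1 ≤ y) : 1 ≤ logFactor a y :=
  (le_add_of_nonneg_right (Real.log_nonneg hy)).trans (one_add_log_le_logFactor ha hy)

lemma rpow_le_two {y h : ℝ} (hy : 0 < y) (hh : h * Real.log y ≤ 1 / 2) : y ^ h ≤ 2 := by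
  rw [Real.rpow_def_of_pos hy, mul_comm]
  have hsq : Real.exp (1 / 2) * Real.exp (1 / 2) = Real.exp 1 := by
    rw [← Real.exp_add]
    norm_num
  have hhalf : Real.exp (1 / 2) ≤ 2 := by
    nlinarith [hsq, Real.exp_one_lt_d9, Real.exp_pos (1 / 2 : ℝ)]
  exact (Real.exp_le_exp.mpr hh).trans hhalf

lemma rpow_div_two_le_rpow {y h : ℝ} (hy : 0 < y) (hh : h * Real.log y ≤ 1 / 2) (a : ℝ) :
    y ^ (1 - a) / 2 ≤ y ^ (1 - (a + h)) := by
  rw [div_le_iff₀ two_pos]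
  calc y ^ (1 - a) = y ^ (1 - (a + h)) * y ^ h := by
        rw [← Real.rpow_add hy]
        ring_nf
    _ ≤ y ^ (1 - (a + h)) * 2 := by
        gcongr
        exact rpow_le_two hy hh

lemma two_le_mul_meanLog_sub {a δ y : ℝ} (ha : 0 < a) (hδ : 0 < δ) (hlog : 2 ≤ Real.log y)
    (hy : 1 ≤ y) (hδlog : δ * Real.log y ≤ 1 / 2) (hδy : 32 ≤ δ ^ 2 * y ^ (1 - a))
    (hlarge : y / 2 ≤ ∑ p ∈ largePrimes y, Real.log p) :
    2 ≤ δ / 2 * (meanLog a y - meanLog (a + δ / 2) y) := by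
  have hhalf : δ / 2 * Real.log y ≤ 1 / 2 := by nlinarith
  calc (2 : ℝ) ≤ δ / 2 * (δ / 2 * (2 / 2) * (y ^ (1 - a) / 2 / 2)) := by linarith
    _ ≤ δ / 2 * (δ / 2 * (Real.log y / 2) * (y ^ (1 - (a + δ / 2)) / 2)) := by
        gcongr
        exact rpow_div_two_le_rpow (by linarith) hhalf a
    _ ≤ δ / 2 * (meanLog a y - meanLog (a + δ / 2) y) := by
        gcongr
        exact mul_log_mul_rpow_le_meanLog_sub ha (by positivity) hy hlarge

lemma meanLog_sub_le_logFactor {a h y : ℝ} (ha₀ : 0 < a) (ha₁ : a ≤ 1) (hh : 0 ≤ h)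
    (hy : 1 ≤ y) : meanLog a y - meanLog (a + h) y ≤ logFactor a y * (h * y ^ (1 - a)) := by
  refine (meanLog_sub_le ha₀ hh hy).trans_eq ?_
  rw [max_eq_left (by linarith), logFactor]
  ring

lemma ceil_meanLog_sub_add_le {a δ y : ℝ} (ha₀ : 0 < a) (ha₁ : a ≤ 1) (hδ₀ : 0 < δ)
    (hδ₁ : δ ≤ 1) (hy : 1 ≤ y) (hδy : 1 ≤ δ ^ 2 * y ^ (1 - a)) :
    (⌈meanLog a y - (meanLog (a + 2 * δ) y - 2 / δ)⌉₊ : ℝ)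
      ≤ 5 * logFactor a y * (δ * y ^ (1 - a)) := by
  have hinv : 1 / δ ≤ δ * y ^ (1 - a) := by
    rw [div_le_iff₀ hδ₀]
    linarith
  have hone : 1 ≤ δ * y ^ (1 - a) := ((one_le_div hδ₀).mpr hδ₁).trans hinv
  have hfactor : δ * y ^ (1 - a) ≤ logFactor a y * (δ * y ^ (1 - a)) :=
    le_mul_of_one_le_left (by positivity) (one_le_logFactor ha₀ hy)
  have htwo : 2 / δ = 2 * (1 / δ) := by ring
  have hle : meanLog a y - (meanLog (a + 2 * δ) y - 2 / δ)
      ≤ 4 * (logFactor a y * (δ * y ^ (1 - a))) := by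
    linarith [meanLog_sub_le_logFactor ha₀ ha₁ (h := 2 * δ) (by positivity) hy]
  have hceil := Nat.ceil_lt_add_one
    (show 0 ≤ 4 * (logFactor a y * (δ * y ^ (1 - a))) by linarith)
  linarith [Nat.cast_le (α := ℝ).mpr (Nat.ceil_le_ceil hle)]

lemma meanLog_le_mul_sum_largePrimes {a δ y : ℝ} (ha₀ : 0 < a) (ha₁ : a ≤ 1) (hδ : 0 < δ)
    (hy : 1 ≤ y) (hδlog : δ * Real.log y ≤ 1 / 2) (hδy : 1 ≤ δ ^ 2 * y ^ (1 - a))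
    (hlarge : y / 2 ≤ ∑ p ∈ largePrimes y, Real.log p) :
    meanLog a y ≤ (1 + 8 * logFactor a y * (δ + y ^ max (1 - 2 * a) 0 / y ^ (1 - a)))
      * ∑ p ∈ largePrimes y, Real.log p * (p : ℝ) ^ (-(a + δ)) := by
  set B := ∑ p ∈ largePrimes y, Real.log p * (p : ℝ) ^ (-(a + δ))
  set N := y ^ max (1 - 2 * a) 0
  have hlog := Real.log_nonneg hy
  have hE := one_le_eulerFactorTwo ha₀
  have hK := one_le_logFactor ha₀ hy
  have hsqrt : y ^ (max (1 - a) 0 / 2) ≤ δ * y ^ (1 - a) := by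
    have hsq : y ^ (1 - a) = y ^ ((1 - a) / 2) * y ^ ((1 - a) / 2) := by
      rw [← Real.rpow_add (by linarith), add_halves]
    have hone : 1 ≤ δ * y ^ ((1 - a) / 2) := by
      rw [hsq] at hδy
      exact (one_le_sq_iff₀ (by positivity)).mp (by linarith)
    rw [max_eq_left (by linarith), hsq, ← mul_assoc]
    exact le_mul_of_one_le_left (by positivity) hone
  have hB : y ^ (1 - a) / 4 ≤ B := by
    linarith [rpow_div_two_le_sum_largePrimes (by linarith) (by linarith : 0 ≤ a + δ) hlarge,
      rpow_div_two_le_rpow (by linarith) hδlog a]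
  calc meanLog a y ≤ meanLog (a + δ) y + logFactor a y * (δ * y ^ (1 - a)) := by
        linarith [meanLog_sub_le_logFactor ha₀ ha₁ hδ.le hy]
    _ ≤ B + logFactor a y * (δ * y ^ (1 - a) + N) + logFactor a y * (δ * y ^ (1 - a)) := by
        gcongr
        refine (meanLog_le_sum_largePrimes_add ha₀ (by linarith) hy).trans ?_
        rw [logFactor]
        gcongr
        · exact le_self_pow₀ hE two_ne_zero
        · linarith
        · norm_num
    _ ≤ B + 8 * logFactor a y * (δ + N / y ^ (1 - a)) * (y ^ (1 - a) / 4) := by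
        have hdiv : N / y ^ (1 - a) * y ^ (1 - a) = N := div_mul_cancel₀ _ (by positivity)
        have hKN : 0 ≤ logFactor a y * N := by positivity
        linear_combination hKN - 2 * logFactor a y * hdiv
    _ ≤ (1 + 8 * logFactor a y * (δ + N / y ^ (1 - a))) * B := by
        rw [one_add_mul]
        gcongr

lemma one_add_pow_le_exp {c d : ℝ} (hc : 0 ≤ c) {j : ℕ} (hj : j ≤ d) :
    (1 + c) ^ j ≤ Real.exp (d * c) := by
  calc (1 + c) ^ j ≤ Real.exp c ^ j := by
        gcongr
        rw [add_comm]
        exact Real.add_one_le_exp c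
    _ = Real.exp (j * c) := (Real.exp_nat_mul c j).symm
    _ ≤ Real.exp (d * c) := by gcongr

lemma mul_mul_sq_le_exp {K y : ℝ} (hK : 1 ≤ K) (hy : 0 < y) (hlog : Real.log y ≤ K) :
    24 * K * y ^ 2 ≤ Real.exp (27 * K) := by
  have hy_exp : y ≤ Real.exp K := (Real.log_le_iff_le_exp hy).mp hlog
  calc 24 * K * y ^ 2 ≤ Real.exp 24 * Real.exp K * Real.exp K ^ 2 := by
        gcongr
        · linarith [Real.add_one_le_exp (24 : ℝ)]
        · linarith [Real.add_one_le_exp K]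
    _ = Real.exp (24 + K + (2 : ℕ) * K) := by rw [Real.exp_add, Real.exp_add, Real.exp_nat_mul]
    _ ≤ Real.exp (27 * K) := by
        gcongr
        push_cast
        linarith

lemma two_mul_add_one_mul_rpow_le_exp {a δ y K j : ℝ} (ha : a ≤ 1) (hy : 1 ≤ y)
    (hδ : δ * Real.log y ≤ 1 / 2) (hK : 1 ≤ K) (hlog : Real.log y ≤ K) (hj : j ≤ 5 * K * y) :
    2 * (j + 1) * y ^ (a + δ) ≤ Real.exp (27 * K) := by
  have hy₀ : 0 < y := by linarith
  have hone : 1 ≤ K * y := one_le_mul_of_one_le_of_one_le hK hy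
  calc 2 * (j + 1) * y ^ (a + δ) ≤ 2 * (6 * K * y) * (y * 2) := by
        rw [Real.rpow_add hy₀]
        gcongr
        · linarith
        · exact Real.rpow_le_self_of_one_le hy ha
        · exact rpow_le_two hy₀ hδ
    _ = 24 * K * y ^ 2 := by ring
    _ ≤ Real.exp (27 * K) := mul_mul_sq_le_exp hK hy₀ hlog

lemma sub_log_sub_ceil_mul_log_sqrt_le {y : ℝ} (hy : 0 ≤ y) (hlog : 2 ≤ Real.log y) (m b : ℝ) :
    m - Real.log y - ⌈m - b⌉₊ * Real.log (√y) ≤ b := by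
  have hceil := Nat.le_ceil (m - b)
  rw [Real.log_sqrt hy]
  nlinarith

lemma rpow_mul_partialZeta_le_exp_mul_friableCount {a δ x y : ℝ} (ha₀ : 0 < a) (ha₁ : a ≤ 1)
    (hδ : 0 < δ) (hx : 0 < x) (hy : 1 ≤ y) (hlog : 2 ≤ Real.log y)
    (hδlog : δ * Real.log y ≤ 1 / 2) (hδy : 32 ≤ δ ^ 2 * y ^ (1 - a))
    (hlarge : y / 2 ≤ ∑ p ∈ largePrimes y, Real.log p) (hsaddle : Real.log x = meanLog a y) :
    x ^ a * partialZeta a y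
      ≤ Real.exp (80 * logFactor a y ^ 2 * (δ ^ 2 * y ^ (1 - a) + δ * y ^ max (1 - 2 * a) 0))
        * friableCount x y := by
  have hy₀ : 0 < y := by linarith
  have hδ₁ : δ ≤ 1 := by nlinarith
  have hK := one_le_logFactor ha₀ hy
  set K := logFactor a y
  set M := y ^ (1 - a)
  set N := y ^ max (1 - 2 * a) 0
  have hM : 0 < M := by positivity
  have hMy : M ≤ y := Real.rpow_le_self_of_one_le hy (by linarith)
  set r := 1 + 8 * K * (δ + N / M)
  set j := ⌈meanLog a y - (meanLog (a + 2 * δ) y - 2 / δ)⌉₊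
  have hj : (j : ℝ) ≤ 5 * K * (δ * M) :=
    ceil_meanLog_sub_add_le ha₀ ha₁ hδ hδ₁ hy (by linarith)
  have hB : 0 < ∑ p ∈ largePrimes y, Real.log p * (p : ℝ) ^ (-(a + δ)) :=
    lt_of_lt_of_le (by positivity)
      (rpow_div_two_le_sum_largePrimes hy₀ (by linarith : 0 ≤ a + δ) hlarge)
  have hpow : r ^ j ≤ Real.exp (40 * K ^ 2 * (δ ^ 2 * M + δ * N)) := by
    refine (one_add_pow_le_exp (by positivity) hj).trans_eq (congrArg Real.exp ?_)
    field_simp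
    ring
  have hrest : 2 * (j + 1) * y ^ (a + δ) ≤ Real.exp (40 * K ^ 2 * (δ ^ 2 * M + δ * N)) := by
    have hδM : δ * M ≤ y := (mul_le_of_le_one_left hM.le hδ₁).trans hMy
    have hlogK : Real.log y ≤ K := by linarith [one_add_log_le_logFactor ha₀ hy]
    refine (two_mul_add_one_mul_rpow_le_exp ha₁ hy hδlog hK hlogK (hj.trans ?_)).trans ?_
    · gcongr
    · refine Real.exp_le_exp.mpr ?_
      calc 27 * K ≤ 40 * K ^ 2 * 1 := by nlinarith
        _ ≤ 40 * K ^ 2 * (δ ^ 2 * M + δ * N) := by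
          gcongr
          linarith [show 0 ≤ δ * N by positivity]
  calc x ^ a * partialZeta a y
      ≤ 2 * ((j + 1) * r ^ j * y ^ (a + δ) * friableCount x y) :=
        partialZeta_mul_rpow_le_friableCount ha₀ hδ hx hy₀ (Real.sqrt_pos.mpr hy₀) hsaddle
          (two_le_mul_meanLog_sub ha₀ hδ hlog hy hδlog hδy hlarge)
          (sub_log_sub_ceil_mul_log_sqrt_le hy₀.le hlog _ _) (largePrimes y)
          (fun p hp => (mem_largePrimes hy₀.le).mp hp) hB (le_add_of_nonneg_right (by positivity))
          (hsaddle.trans_le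
            (meanLog_le_mul_sum_largePrimes ha₀ ha₁ hδ hy hδlog (by linarith) hlarge))
    _ = 2 * (j + 1) * y ^ (a + δ) * r ^ j * friableCount x y := by ring
    _ ≤ Real.exp (40 * K ^ 2 * (δ ^ 2 * M + δ * N))
        * Real.exp (40 * K ^ 2 * (δ ^ 2 * M + δ * N)) * friableCount x y := by gcongr
    _ = Real.exp (80 * K ^ 2 * (δ ^ 2 * M + δ * N)) * friableCount x y := by
        rw [← Real.exp_add]
        ring_nf

lemma eventually_rpow_mul_partialZeta_le {a η : ℝ} (ha₀ : 0 < a) (ha₁ : a < 1) (hη : 0 < η) :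
    ∀ᶠ y : ℝ in atTop, ∀ x, 0 < x → Real.log x = meanLog a y → x ^ a * partialZeta a y
      ≤ Real.exp (y ^ η * (1 + y ^ (max (1 - 2 * a) 0 - (1 - a) / 2))) * friableCount x y := by
  set θ := min (η / 4) ((1 - a) / 4)
  have hθ : 0 < θ := lt_min (by linarith) (by linarith)
  have hθη : θ ≤ η / 4 := min_le_left _ _
  have hθa : θ ≤ (1 - a) / 4 := min_le_right _ _
  filter_upwards [eventually_half_le_sum_log_largePrimes, eventually_ge_atTop 1,
    Real.tendsto_log_atTop.eventually_ge_atTop 2,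
    eventually_const_mul_log_pow_le_rpow (80 * eulerFactorTwo a ^ 4) 6 (half_pos hη),
    eventually_const_mul_log_pow_le_rpow 2 1 (b := (1 - a) / 4) (by linarith),
    eventually_const_mul_log_pow_le_rpow 32 0 (b := 2 * θ) (by linarith)]
    with y hlarge hy hlog hfactor hlogle hconst x hx hsaddle
  have hy₀ : 0 < y := by linarith
  set δ := y ^ (θ - (1 - a) / 2)
  have hδlog : δ * Real.log y ≤ 1 / 2 := by
    calc δ * Real.log y ≤ y ^ (-((1 - a) / 4)) * (1 / 2 * y ^ ((1 - a) / 4)) := by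
          gcongr
          · exact Real.rpow_le_rpow_of_exponent_le hy (by linarith)
          · linarith
      _ = 1 / 2 := by
          rw [mul_left_comm, ← Real.rpow_add hy₀, neg_add_cancel, Real.rpow_zero, mul_one]
  have hδsq : δ ^ 2 * y ^ (1 - a) = y ^ (2 * θ) := by
    rw [← Real.rpow_mul_natCast hy₀.le, ← Real.rpow_add hy₀]
    push_cast
    ring_nf
  have hδN : δ * y ^ max (1 - 2 * a) 0 = y ^ (θ + (max (1 - 2 * a) 0 - (1 - a) / 2)) := by
    rw [← Real.rpow_add hy₀]
    ring_nf
  refine (rpow_mul_partialZeta_le_exp_mul_friableCount ha₀ ha₁.le (by positivity) hx hy hlog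
    hδlog (by linarith) hlarge hsaddle).trans ?_
  rw [hδsq, hδN]
  refine mul_le_mul_of_nonneg_right (Real.exp_le_exp.mpr ?_) (Nat.cast_nonneg _)
  calc 80 * logFactor a y ^ 2 * (y ^ (2 * θ) + y ^ (θ + (max (1 - 2 * a) 0 - (1 - a) / 2)))
      ≤ y ^ (η / 2) * (y ^ (η / 2) + y ^ (η / 2 + (max (1 - 2 * a) 0 - (1 - a) / 2))) := by
        gcongr
        · refine le_trans (le_of_eq ?_) hfactor
          rw [logFactor]
          ring
        all_goals linarith
    _ = y ^ η * (1 + y ^ (max (1 - 2 * a) 0 - (1 - a) / 2)) := by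
        rw [Real.rpow_add hy₀, ← mul_one_add, ← mul_assoc, ← Real.rpow_add hy₀, add_halves]

end SaddlePointLowerBound

section LogPartialZeta

lemma primePowCoeff_pow {p k : ℕ} (hp : p.Prime) (hk : k ≠ 0) (a : ℝ) :
    primePowCoeff a (p ^ k) = ((p : ℝ) ^ (-a)) ^ k / k := by
  have hlog : Real.log p ≠ 0 := (Real.log_pos (by exact_mod_cast hp.one_lt)).ne'
  rw [primePowCoeff, ArithmeticFunction.vonMangoldt_apply_pow hk,
    ArithmeticFunction.vonMangoldt_apply_prime hp, Nat.cast_pow, Real.log_pow,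
    ← Real.rpow_pow_comm (Nat.cast_nonneg p)]
  field_simp

lemma primePowCoeff_eq_zero {n : ℕ} (hn : ¬IsPrimePow n) (a : ℝ) : primePowCoeff a n = 0 := by
  rw [primePowCoeff, ArithmeticFunction.vonMangoldt_eq_zero_iff.mpr hn, zero_div, zero_mul]

lemma primePowSum_eq_sum_sum {y : ℝ} (hy : 0 ≤ y) {N : ℕ}
    (hN : ⌊Real.log y / Real.log 2⌋₊ ≤ N) (a : ℝ) :
    primePowSum a y = ∑ k ∈ Finset.Icc 1 N, ∑ p ∈ primesUpTo (y ^ ((1 : ℝ) / k)),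
      ((p : ℝ) ^ (-a)) ^ k / k := by
  have hprime (z : ℝ) : (Finset.Ioc 0 ⌊z⌋₊).filter Nat.Prime = primesUpTo z := by
    ext p
    rw [Finset.mem_filter, Finset.mem_Ioc, primesUpTo, Nat.mem_primesBelow, Nat.lt_succ_iff]
    exact ⟨fun h => ⟨h.1.2, h.2⟩, fun h => ⟨⟨h.2.pos, h.1⟩, h.2⟩⟩
  have hfilter : ∑ n ∈ (Finset.Ioc 0 ⌊y⌋₊).filter IsPrimePow, primePowCoeff a n
      = primePowSum a y :=
    Finset.sum_filter_of_ne fun n _ hn => not_imp_comm.mp (primePowCoeff_eq_zero · a) hn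
  rw [← hfilter, Chebyshev.sum_PrimePow_eq_sum_sum' _ hy hN]
  refine Finset.sum_congr rfl fun k hk => ?_
  rw [hprime]
  refine Finset.sum_congr rfl fun p hp => primePowCoeff_pow (prime_of_mem_primesUpTo hp) ?_ a
  exact Nat.one_le_iff_ne_zero.mp (Finset.mem_Icc.mp hk).1

lemma sum_primes_le_primePowSum (a : ℝ) {y : ℝ} (hy : 0 ≤ y) :
    ∑ p ∈ primesUpTo y, (p : ℝ) ^ (-a) ≤ primePowSum a y := by
  have hcoeff : ∑ p ∈ primesUpTo y, (p : ℝ) ^ (-a) = ∑ p ∈ primesUpTo y, primePowCoeff a p := by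
    refine Finset.sum_congr rfl fun p hp => ?_
    have hpow := primePowCoeff_pow (prime_of_mem_primesUpTo hp) one_ne_zero a
    rwa [pow_one, pow_one, Nat.cast_one, div_one, eq_comm] at hpow
  rw [hcoeff]
  refine Finset.sum_le_sum_of_subset_of_nonneg (fun p hp => ?_) fun n _ _ =>
    primePowCoeff_nonneg a n
  rw [mem_primesUpTo hy] at hp
  exact Finset.mem_Icc.mpr ⟨hp.1.one_le, Nat.le_floor hp.2⟩

lemma neg_log_one_sub_le {t : ℝ} (ht : t < 1) :
    -Real.log (1 - t) ≤ t + (1 - t)⁻¹ * (t * t) := by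
  have hpos : 0 < 1 - t := by linarith
  calc -Real.log (1 - t) = Real.log (1 - t)⁻¹ := (Real.log_inv _).symm
    _ ≤ (1 - t)⁻¹ - 1 := Real.log_le_sub_one_of_pos (inv_pos.mpr hpos)
    _ = t + (1 - t)⁻¹ * (t * t) := by
        field_simp
        ring

lemma logPartialZeta_le_primePowSum_add {a y : ℝ} (ha : 0 < a) (hy : 1 ≤ y) :
    logPartialZeta a y
      ≤ primePowSum a y + eulerFactorTwo a * (y ^ max (1 - 2 * a) 0 * (1 + Real.log y)) := by
  have hE : 0 ≤ eulerFactorTwo a := zero_le_one.trans (one_le_eulerFactorTwo ha)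
  have hterm (p : ℕ) (hp : p ∈ primesUpTo y) : -Real.log (1 - (p : ℝ) ^ (-a))
      ≤ (p : ℝ) ^ (-a) + eulerFactorTwo a * (p : ℝ) ^ (-(2 * a)) := by
    have hp' := prime_of_mem_primesUpTo hp
    refine (neg_log_one_sub_le (prime_rpow_neg_lt_one hp' ha)).trans ?_
    rw [← Real.rpow_add (by exact_mod_cast hp'.pos), ← two_mul, mul_neg]
    gcongr
    exact inv_one_sub_rpow_neg_le (by exact_mod_cast hp'.two_le) ha le_rfl
  refine (Finset.sum_le_sum hterm).trans ?_
  rw [Finset.sum_add_distrib, ← Finset.mul_sum]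
  gcongr
  · exact sum_primes_le_primePowSum a (by linarith)
  · exact sum_primes_rpow_le hy (2 * a)

lemma sum_sum_pow_div_le_logPartialZeta {a : ℝ} (ha : 0 < a) (y : ℝ) (N : ℕ) :
    ∑ k ∈ Finset.Icc 1 N, ∑ p ∈ primesUpTo y, ((p : ℝ) ^ (-a)) ^ k / k ≤ logPartialZeta a y := by
  rw [Finset.sum_comm, logPartialZeta]
  refine Finset.sum_le_sum fun p hp => ?_
  have hlt := prime_rpow_neg_lt_one (prime_of_mem_primesUpTo hp) ha
  have hseries := Real.hasSum_pow_div_log_of_abs_lt_one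
    (by rwa [abs_of_nonneg (Real.rpow_nonneg (Nat.cast_nonneg p) _)])
  refine (sum_le_hasSum (Finset.range N) (fun k _ => by positivity) hseries).trans_eq' ?_
  have hshift := Finset.sum_Ico_add' (fun k : ℕ => ((p : ℝ) ^ (-a)) ^ k / (k : ℝ)) 0 N 1
  simp only [Nat.cast_add, Nat.cast_one, zero_add] at hshift
  rw [Finset.range_eq_Ico, hshift]
  rfl

lemma primePowSum_add_le_logPartialZeta {a y : ℝ} (ha : 0 < a) (hy : 1 ≤ y) :
    primePowSum a y + 1 / 2 * ∑ p ∈ largePrimes y, (p : ℝ) ^ (-(2 * a))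
      ≤ logPartialZeta a y := by
  set N := max 2 ⌊Real.log y / Real.log 2⌋₊
  set F : ℝ → ℕ → ℝ := fun z k => ∑ p ∈ primesUpTo z, ((p : ℝ) ^ (-a)) ^ k / k
  have hroot (k : ℕ) (hk : k ∈ Finset.Icc 1 N) : 0 ≤ F y k - F (y ^ ((1 : ℝ) / k)) k := by
    have hk₁ : (1 : ℝ) ≤ k := by exact_mod_cast (Finset.mem_Icc.mp hk).1
    refine sub_nonneg.mpr (Finset.sum_le_sum_of_subset_of_nonneg (fun p hp => ?_)
      fun p _ _ => by positivity)
    rw [mem_primesUpTo (by positivity)] at hp ⊢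
    exact ⟨hp.1, hp.2.trans (Real.rpow_le_self_of_one_le hy ((div_le_one (by linarith)).mpr hk₁))⟩
  have hsquare : 1 / 2 * ∑ p ∈ largePrimes y, (p : ℝ) ^ (-(2 * a))
      = F y 2 - F (y ^ ((1 : ℝ) / (2 : ℕ))) 2 := by
    have hsplit := sum_primesUpTo_eq hy fun p => ((p : ℝ) ^ (-a)) ^ 2 / (2 : ℕ)
    rw [Nat.cast_ofNat, ← Real.sqrt_eq_rpow]
    refine Eq.trans ?_ (eq_sub_of_add_eq hsplit.symm)
    rw [Finset.mul_sum]
    refine Finset.sum_congr rfl fun p _ => ?_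
    rw [← Real.rpow_mul_natCast (Nat.cast_nonneg p), one_div_mul_eq_div, neg_mul, mul_comm a,
      Nat.cast_ofNat]
  have hle : 1 / 2 * ∑ p ∈ largePrimes y, (p : ℝ) ^ (-(2 * a))
      ≤ ∑ k ∈ Finset.Icc 1 N, (F y k - F (y ^ ((1 : ℝ) / k)) k) := by
    rw [hsquare]
    exact Finset.single_le_sum hroot (Finset.mem_Icc.mpr ⟨one_le_two, le_max_left _ _⟩)
  rw [Finset.sum_sub_distrib, ← primePowSum_eq_sum_sum (by linarith) (le_max_right _ _)] at hle
  linarith [sum_sum_pow_div_le_logPartialZeta ha y N]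

lemma rpow_div_log_le_sum_largePrimes {b y : ℝ} (hb : 0 ≤ b) (hy : 1 < y)
    (hlarge : y / 2 ≤ ∑ p ∈ largePrimes y, Real.log p) :
    y ^ (1 - b) / (2 * Real.log y) ≤ ∑ p ∈ largePrimes y, (p : ℝ) ^ (-b) := by
  have hy₀ : 0 < y := by linarith
  rw [← div_div, div_le_iff₀ (Real.log_pos hy), Finset.sum_mul]
  refine (rpow_div_two_le_sum_largePrimes hy₀ hb hlarge).trans (Finset.sum_le_sum fun p hp => ?_)
  rw [mem_largePrimes hy₀.le] at hp
  rw [mul_comm]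
  gcongr
  · exact_mod_cast hp.1.pos
  · exact hp.2.2

end LogPartialZeta

section Xi

lemma strictMono_expQuot : StrictMono expQuot := fun s t hst =>
  intervalIntegral.integral_lt_integral_of_continuousOn_of_le_of_exists_lt one_pos
    (by fun_prop) (by fun_prop)
    (fun r hr => Real.exp_le_exp.mpr (mul_le_mul_of_nonneg_left hst.le hr.1.le))
    ⟨1, ⟨zero_le_one, le_rfl⟩, Real.exp_lt_exp.mpr (by linarith)⟩

lemma xi_expQuot {s : ℝ} (hs : 0 ≤ s) : xi (expQuot s) = s := by
  refine IsGreatest.csSup_eq ⟨⟨hs, by linarith [mul_expQuot s]⟩, fun t ht => ?_⟩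
  by_contra! hst
  have hmul := mul_expQuot t
  rw [ht.2, add_sub_cancel_left, mul_comm] at hmul
  exact (strictMono_expQuot hst).ne' (mul_right_cancel₀ (hs.trans_lt hst).ne' hmul)

lemma exists_expQuot_eq {u : ℝ} (hu : 1 ≤ u) : ∃ s, 0 ≤ s ∧ expQuot s = u := by
  have hupper : u ≤ expQuot (2 * u) := by
    have hquad := Real.quadratic_le_exp_of_nonneg (show 0 ≤ 2 * u by linarith)
    refine le_of_mul_le_mul_left ?_ (show 0 < 2 * u by linarith)
    nlinarith [hquad, mul_expQuot (2 * u)]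
  obtain ⟨s, hs, hsu⟩ := intermediate_value_Icc (show 0 ≤ 2 * u by linarith)
    continuous_expQuot.continuousOn ⟨by rwa [expQuot_zero], hupper⟩
  exact ⟨s, hs.1, hsu⟩

lemma sigma_eq_iff {a x y : ℝ} (ha : a < 1) (hy : 1 < y) (hx : 0 < x) :
    y ≤ x ∧ sigma x y = a ↔ Real.log x = expQuot ((1 - a) * Real.log y) * Real.log y := by
  have hlog := Real.log_pos hy
  have hs : 0 ≤ (1 - a) * Real.log y := mul_nonneg (by linarith) hlog.le
  constructor
  · rintro ⟨hxy, hsigma⟩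
    have hu : 1 ≤ Real.log x / Real.log y := by
      rw [one_le_div hlog]
      exact Real.log_le_log (by linarith) hxy
    obtain ⟨t, ht, htu⟩ := exists_expQuot_eq hu
    rw [sigma, ← htu, xi_expQuot ht] at hsigma
    have hst : (1 - a) * Real.log y = t := by
      rw [← hsigma]
      field_simp
      ring
    rw [hst, htu, div_mul_cancel₀ _ hlog.ne']
  · intro hlogx
    constructor
    · rw [← Real.log_le_log_iff (by linarith) hx, hlogx]
      exact le_mul_of_one_le_left hlog.le (one_le_expQuot hs)
    · rw [sigma, hlogx, mul_div_cancel_right₀ _ hlog.ne', xi_expQuot hs,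
        mul_div_cancel_right₀ _ hlog.ne']
      ring

lemma existsUnique_sigma_eq {a y : ℝ} (ha : a < 1) (hy : 1 < y) :
    ∃! x, y ≤ x ∧ sigma x y = a := by
  refine ⟨Real.exp (expQuot ((1 - a) * Real.log y) * Real.log y),
    (sigma_eq_iff ha hy (Real.exp_pos _)).mpr (Real.log_exp _), fun x hx => ?_⟩
  have hx₀ : 0 < x := by linarith [hx.1]
  rw [← (sigma_eq_iff ha hy hx₀).mp hx, Real.exp_log hx₀]

end Xi

section Comparison

/-- The logarithm of the ratio of `Ψ(x, y)` to its Dickman approximation `x ρ(u)`. -/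
noncomputable def logFriableRatio (x y : ℝ) : ℝ :=
  Real.log (friableCount x y / (x * dickman (Real.log x / Real.log y)))

lemma friableCount_eq_mul_exp {x : ℝ} (hx : 1 ≤ x) (y : ℝ) : (friableCount x y : ℝ)
    = x * dickman (Real.log x / Real.log y) * Real.exp (logFriableRatio x y) := by
  have hΨ : (0 : ℝ) < friableCount x y := by exact_mod_cast friableCount_pos hx y
  have hρ : 0 < x * dickman (Real.log x / Real.log y) := mul_pos (by linarith) (dickman_pos _)
  rw [logFriableRatio, Real.exp_log (div_pos hΨ hρ), mul_div_cancel₀ _ hρ.ne']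

lemma logFriableRatio_eq {x : ℝ} (hx : 1 ≤ x) (y : ℝ) : logFriableRatio x y
    = Real.log (friableCount x y) - Real.log x - Real.log (dickman (Real.log x / Real.log y)) := by
  have hΨ : (0 : ℝ) < friableCount x y := by exact_mod_cast friableCount_pos hx y
  have hρ := dickman_pos (Real.log x / Real.log y)
  rw [logFriableRatio, Real.log_div hΨ.ne' (by positivity), Real.log_mul (by linarith) hρ.ne',
    sub_sub]

lemma log_friableCount_le {a x : ℝ} (ha : 0 < a) (hx : 1 ≤ x) (y : ℝ) :
    Real.log (friableCount x y) ≤ a * Real.log x + logPartialZeta a y := by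
  have hx₀ : 0 < x := by linarith
  rw [Real.log_le_iff_le_exp (by exact_mod_cast friableCount_pos hx y),
    ← rpow_mul_partialZeta ha hx₀]
  exact friableCount_le ha hx₀ y

lemma eventually_const_mul_log_pow_mul_rpow_le (C : ℝ) (k : ℕ) {b β : ℝ} (hbβ : b < β) :
    ∀ᶠ y : ℝ in atTop, C * (1 + Real.log y) ^ k * y ^ b ≤ y ^ β := by
  filter_upwards [eventually_const_mul_log_pow_le_rpow C k (sub_pos.mpr hbβ),
    eventually_gt_atTop 0] with y hlog hy
  calc C * (1 + Real.log y) ^ k * y ^ b ≤ y ^ (β - b) * y ^ b := by gcongr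
    _ = y ^ β := by rw [← Real.rpow_add hy, sub_add_cancel]

lemma eventually_le_log_dickman {a β : ℝ} (ha : a < 1) (hβ : 0 < β) :
    ∀ᶠ y : ℝ in atTop, expQuotInt ((1 - a) * Real.log y)
        - expQuot ((1 - a) * Real.log y) * ((1 - a) * Real.log y) - y ^ β
      ≤ Real.log (dickman (expQuot ((1 - a) * Real.log y))) := by
  have ha' : 0 < 1 - a := by linarith
  have htendsto : Tendsto (fun y => (1 - a) * Real.log y) atTop atTop :=
    Real.tendsto_log_atTop.const_mul_atTop ha'
  filter_upwards [htendsto.eventually (eventually_exp_le_dickman (div_pos hβ ha')),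
    eventually_gt_atTop 0] with y hle hy
  have hexponent : β / (1 - a) * ((1 - a) * Real.log y) = Real.log y * β := by field_simp
  rw [hexponent, ← Real.rpow_def_of_pos hy] at hle
  exact (Real.le_log_iff_exp_le (dickman_pos _)).mpr hle

lemma eventually_logFriableRatio_le {a β : ℝ} (ha₀ : 0 < a) (ha₁ : a < 1)
    (hβ : max (1 - 2 * a) 0 < β) :
    ∀ᶠ y : ℝ in atTop, ∀ x, 1 ≤ x →
      Real.log x = expQuot ((1 - a) * Real.log y) * Real.log y →
      logFriableRatio x y ≤ primePowError a y + y ^ β / 2 := by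
  have hβ₀ : 0 < β := (le_max_right _ _).trans_lt hβ
  filter_upwards [eventually_gt_atTop 1, eventually_le_log_dickman ha₁ (half_pos hβ₀),
    eventually_const_mul_log_pow_mul_rpow_le (4 * eulerFactorTwo a) 1 hβ,
    eventually_const_mul_log_pow_mul_rpow_le 4 0 (half_lt_self hβ₀)]
    with y hy hdickman hpowers hsmall x hx hxy
  have hu : Real.log x / Real.log y = expQuot ((1 - a) * Real.log y) := by
    rw [hxy, mul_div_cancel_right₀ _ (Real.log_pos hy).ne']
  have hproduct : expQuot ((1 - a) * Real.log y) * ((1 - a) * Real.log y)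
      = (1 - a) * Real.log x := by
    rw [hxy]
    ring
  rw [hproduct] at hdickman
  rw [logFriableRatio_eq hx, hu, primePowError]
  linarith [log_friableCount_le ha₀ hx y, logPartialZeta_le_primePowSum_add ha₀ hy.le]

lemma eventually_log_le_meanLog {a : ℝ} (ha₀ : 0 < a) (ha₁ : a < 1) :
    ∀ᶠ y : ℝ in atTop, Real.log y ≤ meanLog a y := by
  filter_upwards [eventually_half_le_sum_log_largePrimes, eventually_gt_atTop 0,
    eventually_const_mul_log_pow_le_rpow 2 1 (sub_pos.mpr ha₁)] with y hlarge hy hlog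
  linarith [rpow_div_two_le_sum_largePrimes hy ha₀.le hlarge, sum_largePrimes_le_meanLog ha₀ y]

lemma log_dickman_le {a x y : ℝ} (ha : a ≤ 1) (hy : 1 < y) (hxy : Real.log y ≤ Real.log x) :
    Real.log (dickman (Real.log x / Real.log y)) ≤ Real.log (dickmanLaplace 0)
      + expQuotInt ((1 - a) * Real.log y) - (1 - a) * (Real.log x - Real.log y) := by
  have hlog := Real.log_pos hy
  have hρ := dickman_pos (Real.log x / Real.log y)
  have hlaplace := dickman_mul_exp_le ((one_le_div hlog).mpr hxy)
    (mul_nonneg (sub_nonneg.mpr ha) hlog.le)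
  rw [dickmanLaplace_eq] at hlaplace
  have hle := Real.log_le_log (by positivity) hlaplace
  rw [Real.log_mul hρ.ne' (Real.exp_pos _).ne', Real.log_exp,
    Real.log_mul (dickmanLaplace_pos 0).ne' (Real.exp_pos _).ne', Real.log_exp, mul_assoc,
    mul_sub_one, mul_div_cancel₀ _ hlog.ne'] at hle
  linarith

lemma rpow_max_div_log_le {a y : ℝ} (hy : 1 ≤ y) (hlog : 1 ≤ Real.log y) :
    y ^ max (1 - 2 * a) (1 / 2 - a) / Real.log y ≤ 1 + y ^ (1 - 2 * a) / Real.log y := by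
  have hlog₀ : 0 < Real.log y := by linarith
  rcases le_total a (1 / 2) with ha | ha
  · rw [max_eq_left (by linarith)]
    linarith
  · have hone : y ^ max (1 - 2 * a) (1 / 2 - a) ≤ 1 :=
      Real.rpow_le_one_of_one_le_of_nonpos hy (max_le (by linarith) (by linarith))
    exact ((div_le_one hlog₀).mpr (hone.trans hlog)).trans
      (le_add_of_nonneg_right (by positivity))

lemma eventually_rpow_mul_one_add_rpow_le {a β η : ℝ} (ha : a ≤ 1) (hηa : η < (1 - a) / 2)
    (hηβ : η < β) : ∀ᶠ y : ℝ in atTop, y ^ η * (1 + y ^ (max (1 - 2 * a) 0 - (1 - a) / 2))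
      ≤ y ^ β / 8 + y ^ (1 - 2 * a) / (8 * Real.log y) := by
  filter_upwards [eventually_gt_atTop 1,
    eventually_const_mul_log_pow_mul_rpow_le 16 0 hηβ,
    eventually_const_mul_log_pow_mul_rpow_le 8 1
      (show η + (1 - 2 * a - (1 - a) / 2) < 1 - 2 * a by linarith)] with y hy hpow hmain
  have hlog := Real.log_pos hy
  have hη : 0 < y ^ η := by positivity
  rw [mul_one_add]
  rcases le_total a (1 / 2) with hhalf | hhalf
  · rw [max_eq_left (by linarith), ← Real.rpow_add (by linarith)]
    gcongr
    · linarith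
    · rw [le_div_iff₀ (by positivity)]
      have hterm : 0 < y ^ (η + (1 - 2 * a - (1 - a) / 2)) := by positivity
      linarith
  · have hone : y ^ (max (1 - 2 * a) 0 - (1 - a) / 2) ≤ 1 :=
      Real.rpow_le_one_of_one_le_of_nonpos hy.le (by rw [max_eq_right (by linarith)]; linarith)
    have hnonneg : 0 ≤ y ^ (1 - 2 * a) / (8 * Real.log y) := by positivity
    linarith [mul_le_of_le_one_right hη.le hone]

lemma eventually_le_logFriableRatio {a β : ℝ} (ha₀ : 0 < a) (ha₁ : a < 1) (hβ : 0 < β) :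
    ∀ᶠ y : ℝ in atTop, ∀ x, 0 < x → Real.log x = meanLog a y →
      primePowError a y + 1 / 8 * y ^ max (1 - 2 * a) (1 / 2 - a) / Real.log y - y ^ β / 2
        ≤ logFriableRatio x y := by
  obtain ⟨η, hη, hηlt⟩ := exists_between
    (show 0 < min ((1 - a) / 2) β from lt_min (by linarith) hβ)
  rw [lt_min_iff] at hηlt
  filter_upwards [eventually_gt_atTop 1, Real.tendsto_log_atTop.eventually_ge_atTop 1,
    eventually_log_le_meanLog ha₀ ha₁, eventually_half_le_sum_log_largePrimes,
    eventually_rpow_mul_partialZeta_le ha₀ ha₁ hη,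
    eventually_rpow_mul_one_add_rpow_le ha₁.le hηlt.1 hηlt.2,
    eventually_const_mul_log_pow_le_rpow 8 1 hβ,
    eventually_const_mul_log_pow_le_rpow (8 * Real.log (dickmanLaplace 0)) 0 hβ]
    with y hy hlog hlogle hlarge hsaddle herror hlogβ hconst x hx hxy
  have hx₁ : 1 ≤ x := (Real.log_nonneg_iff hx).mp (hxy ▸ meanLog_nonneg ha₀ y)
  have hΨ : (0 : ℝ) < friableCount x y := by exact_mod_cast friableCount_pos hx₁ y
  have hzeta := hsaddle x hx hxy
  rw [rpow_mul_partialZeta ha₀ hx, ← Real.le_log_iff_exp_le (by positivity),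
    Real.log_mul (Real.exp_pos _).ne' hΨ.ne', Real.log_exp] at hzeta
  have hpowers : primePowSum a y + y ^ (1 - 2 * a) / Real.log y / 4 ≤ logPartialZeta a y := by
    have hle := rpow_div_log_le_sum_largePrimes (show 0 ≤ 2 * a by linarith) hy hlarge
    rw [mul_comm (2 : ℝ) (Real.log y), ← div_div] at hle
    linarith [primePowSum_add_le_logPartialZeta ha₀ hy.le]
  have hmax := rpow_max_div_log_le (a := a) hy.le hlog
  rw [mul_comm (8 : ℝ), ← div_div] at herror
  rw [logFriableRatio_eq hx₁, primePowError, mul_div_assoc]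
  have halog : 0 ≤ a * Real.log y := by positivity
  linarith [log_dickman_le ha₁.le hy (hlogle.trans_eq hxy.symm)]

end Comparison

section Omega

lemma isOmegaMinus_logFriableRatio {σ₀ ε : ℝ} (hσ₁ : 1 - zetaTheta < σ₀) (hσ₂ : σ₀ < zetaTheta)
    (hε : 0 < ε) {x : ℝ → ℝ} (hx : ∀ y > (2 : ℝ), y ≤ x y ∧ sigma (x y) y = σ₀) :
    IsOmegaMinus (fun y => logFriableRatio (x y) y) fun y => y ^ (zetaTheta - σ₀ - ε) := by
  have hσ_pos : 0 < σ₀ := by linarith [zetaTheta_le_one]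
  have hσ_lt_one : σ₀ < 1 := hσ₂.trans_le zetaTheta_le_one
  obtain ⟨β, hβ, hβΘ⟩ := exists_between
    (show max (zetaTheta - σ₀ - ε) (max (1 - 2 * σ₀) 0) < zetaTheta - σ₀ from
      max_lt (by linarith) (max_lt (by linarith) (by linarith)))
  obtain ⟨hεβ, hβ_powers⟩ := max_lt_iff.mp hβ
  have hβ₀ := (le_max_right _ _).trans_lt hβ_powers
  refine ⟨1 / 2, by norm_num, ((frequently_rpow_le_mul_primePowError hσ_pos.le hσ_lt_one hβ₀
    (neg_ne_zero.mpr one_ne_zero) (by linarith)).and_eventually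
    ((eventually_logFriableRatio_le hσ_pos hσ_lt_one hβ_powers).and
      (eventually_gt_atTop 2))).mono ?_⟩
  rintro y ⟨hosc, hratio, hy⟩
  have hxy := hx y hy
  have hle := hratio (x y) (by linarith)
    ((sigma_eq_iff hσ_lt_one (by linarith) (by linarith)).mp hxy)
  have hpow : y ^ (zetaTheta - σ₀ - ε) ≤ y ^ β :=
    Real.rpow_le_rpow_of_exponent_le (by linarith) hεβ.le
  linarith

lemma isOmegaPlus_logFriableRatio_sub {α₀ ε : ℝ} (hα₀ : 0 < α₀) (hα₁ : α₀ < zetaTheta)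
    (hε : 0 < ε) {x : ℝ → ℝ} (hx : ∀ y > (2 : ℝ), 0 < x y ∧ IsSaddlePoint (x y) y α₀) :
    IsOmegaPlus (fun y => logFriableRatio (x y) y
        - 1 / 8 * y ^ max (1 - 2 * α₀) (1 / 2 - α₀) / Real.log y)
      fun y => y ^ (zetaTheta - α₀ - ε) := by
  have hα_lt_one : α₀ < 1 := hα₁.trans_le zetaTheta_le_one
  obtain ⟨β, hβ, hβΘ⟩ := exists_between
    (show max (zetaTheta - α₀ - ε) 0 < zetaTheta - α₀ from max_lt (by linarith) (by linarith))
  obtain ⟨hεβ, hβ₀⟩ := max_lt_iff.mp hβ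
  refine ⟨1 / 2, by norm_num, ((frequently_rpow_le_mul_primePowError hα₀.le hα_lt_one hβ₀
    one_ne_zero (by linarith)).and_eventually
    ((eventually_le_logFriableRatio hα₀ hα_lt_one hβ₀).and (eventually_gt_atTop 2))).mono ?_⟩
  rintro y ⟨hosc, hratio, hy⟩
  have hxy := hx y hy
  have hle := hratio (x y) hxy.1 ((isSaddlePoint_iff hxy.1 hα₀).mp hxy.2)
  have hpow : y ^ (zetaTheta - α₀ - ε) ≤ y ^ β :=
    Real.rpow_le_rpow_of_exponent_le (by linarith) hεβ.le
  linarith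

lemma one_le_of_isSaddlePoint {x y a : ℝ} (hx : 0 < x) (hxy : IsSaddlePoint x y a) : 1 ≤ x := by
  rw [← Real.log_nonneg_iff hx, (isSaddlePoint_iff hx hxy.1).mp hxy]
  exact meanLog_nonneg hxy.1 y

end Omega

theorem proposition2 :
    (¬ RiemannHypothesis →
      (∀ σ₀ ∈ Set.Ioo (1 - zetaTheta) zetaTheta, ∀ y > (2 : ℝ),
        ∃! x : ℝ, y ≤ x ∧ sigma x y = σ₀) ∧
      ∃ C > (0 : ℝ), ∀ σ₀ ∈ Set.Ioo (1 - zetaTheta) zetaTheta, ∀ ε > (0 : ℝ), ∀ x : ℝ → ℝ,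
        (∀ y > (2 : ℝ), y ≤ x y ∧ sigma (x y) y = σ₀) →
        ∃ h : ℝ → ℝ, IsOmegaMinus h (fun y => y ^ (zetaTheta - σ₀ - ε)) ∧
          ∀ y > (2 : ℝ), (friableCount (x y) y : ℝ) ≤
            C * (x y * dickman (Real.log (x y) / Real.log y) * Real.exp (h y))) ∧
    ((∀ α₀ ∈ Set.Ioo 0 zetaTheta, ∀ y > (2 : ℝ),
        ∃! x : ℝ, 0 < x ∧ IsSaddlePoint x y α₀) ∧
      ∃ C > (0 : ℝ), ∀ α₀ ∈ Set.Ioo 0 zetaTheta, ∃ c > (0 : ℝ), ∀ ε > (0 : ℝ), ∀ x : ℝ → ℝ,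
        (∀ y > (2 : ℝ), 0 < x y ∧ IsSaddlePoint (x y) y α₀) →
        ∃ h : ℝ → ℝ, IsOmegaPlus h (fun y => y ^ (zetaTheta - α₀ - ε)) ∧
          ∀ y > (2 : ℝ),
            C * (x y * dickman (Real.log (x y) / Real.log y) *
              Real.exp (c * y ^ max (1 - 2 * α₀) (1 / 2 - α₀) / Real.log y) * Real.exp (h y))
            ≤ (friableCount (x y) y : ℝ)) := by
  refine ⟨fun _ => ⟨fun σ₀ hσ y hy => ?_, 1, one_pos, fun σ₀ hσ ε hε x hx => ?_⟩,
    fun α₀ hα y _ => existsUnique_isSaddlePoint hα.1 y, 1, one_pos,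
    fun α₀ hα => ⟨1 / 8, by norm_num, fun ε hε x hx => ?_⟩⟩
  · exact existsUnique_sigma_eq (hσ.2.trans_le zetaTheta_le_one) (by linarith)
  · refine ⟨_, isOmegaMinus_logFriableRatio hσ.1 hσ.2 hε hx, fun y hy => ?_⟩
    rw [one_mul, friableCount_eq_mul_exp (by linarith [hx y hy])]
  · refine ⟨_, isOmegaPlus_logFriableRatio_sub hα.1 hα.2 hε hx, fun y hy => ?_⟩
    rw [one_mul, mul_assoc, ← Real.exp_add, add_sub_cancel,
      friableCount_eq_mul_exp (one_le_of_isSaddlePoint (hx y hy).1 (hx y hy).2)]
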